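/- Let $n\ge 3$ and $2\le r\le n-1$ be integers. Let $M^n$ be a smooth $n$-dimensional manifold, smoothly immersed in the Euclidean space $\mathbb{E}^{n+1}$ as an oriented hypersurface with smooth unit normal field $\xi$ and the induced metric $g$. Let $\mathcal{A}$ be its shape operator, given by $\overline\nabla_X\xi=-\mathcal{A}X$ for tangent vectors $X$, where $\overline\nabla$ is the standard flat connection of $\mathbb{E}^{n+1}$; the principal curvatures at a point are the eigenvalues of $\mathcal{A}$ there. Let $H=\frac1n\operatorname{trace}\mathcal{A}$ be the mean curvature, $\vec H=H\xi$ the mean curvature vector field, and $\Delta$ the Laplace operator of $g$, acting componentwise on $\mathbb{E}^{n+1}$-valued functions. For a linear subspace $L\subseteq T_pM$ with orthonormal basis $e_1,\dots,e_k$ put $\tau(L)=\sum_{a<b}K(e_a\wedge e_b)$, where $K$ is the sectional curvature of $g$; put $\tau(p)=\tau(T_pM)$ and $$\delta(r)(p)=\tau(p)-\inf\{\tau(L): L\subseteq T_pM,\ \dim L=r\}.$$ Suppose that 1. $M$ is $\delta(r)$-ideal, i.e. $\delta(r)(p)=\dfrac{n^2(n-r)}{2(n-r+1)}\,H(p)^2$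 for every $p\in M$; 2. $M$ is biharmonic, i.e. $\Delta\vec H=0$ on $M$; 3. at every point of $M$ there are at most $r+1$ distinct principal curvatures. Then $M$ is minimal, i.e. $H(p)=0$ for every $p\in M$. -/

import Mathlib

open scoped Manifold ContDiff

noncomputable section

namespace DeltaIdeal

/-- Euclidean space of dimension `m`, with its standard inner product. -/
abbrev E (m : ℕ) : Type := EuclideanSpace ℝ (Fin m)

/-! ### Riemannian geometry in coordinates

`G : E n → Matrix (Fin n) (Fin n) ℝ` is the matrix of components `g_{ij}` of a Riemannian metric in
a coordinate system. -/

/-- The `i`-th partial derivative of `F` at `u`. -/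
def pd {n : ℕ} {W : Type*} [NormedAddCommGroup W] [NormedSpace ℝ W]
    (i : Fin n) (F : E n → W) (u : E n) : W :=
  fderiv ℝ F u (EuclideanSpace.single i 1)

/-- The Christoffel symbol `Γ^k_{ij}` of the Levi-Civita connection of the metric `G`. -/
def christoffel {n : ℕ} (G : E n → Matrix (Fin n) (Fin n) ℝ) (k i j : Fin n) (u : E n) : ℝ :=
  (1 / 2) * ∑ l, (G u)⁻¹ k l *
    (pd i (fun v => G v j l) u + pd j (fun v => G v i l) u - pd l (fun v => G v i j) u)

/-- The component `R^l` of `R(∂_i, ∂_j) ∂_k = ∇_i ∇_j ∂_k - ∇_j ∇_i ∂_k = ∑ l, R^l ∂_l`. -/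
def riemannUp {n : ℕ} (G : E n → Matrix (Fin n) (Fin n) ℝ) (i j k l : Fin n) (u : E n) : ℝ :=
  pd i (christoffel G l j k) u - pd j (christoffel G l i k) u
    + ∑ m, (christoffel G l i m u * christoffel G m j k u
        - christoffel G l j m u * christoffel G m i k u)

/-- The component `g(R(∂_i, ∂_j) ∂_k, ∂_l)` of the curvature tensor. -/
def riemann {n : ℕ} (G : E n → Matrix (Fin n) (Fin n) ℝ) (i j k l : Fin n) (u : E n) : ℝ :=
  ∑ m, riemannUp G i j k m u * G u m l

/-- The Laplace operator of the metric `G` on vector-valued functions, with the sign for which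
`Δ f = - f''` in one variable: `Δ F = - ∑ i j, g^{ij} (∂_i ∂_j F - ∑ k, Γ^k_{ij} ∂_k F)`. -/
def coordLaplacian {n : ℕ} {W : Type*} [NormedAddCommGroup W] [NormedSpace ℝ W]
    (G : E n → Matrix (Fin n) (Fin n) ℝ) (F : E n → W) (u : E n) : W :=
  -∑ i, ∑ j, (G u)⁻¹ i j • (pd i (pd j F) u - ∑ k, christoffel G k i j u • pd k F u)

section Hypersurface

variable {n : ℕ} {M : Type*} [TopologicalSpace M] [ChartedSpace (E n) M]

/-- The differential of `f` at `p` as a linear map into `E^{m}`. -/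
def differential {m : ℕ} (f : M → E m) (p : M) : TangentSpace (𝓡 n) p →ₗ[ℝ] E m :=
  (mfderiv (𝓡 n) 𝓘(ℝ, E m) f p : TangentSpace (𝓡 n) p →L[ℝ] E m).toLinearMap

/-- `f : M → E^{n+1}` is a smooth immersion and `ξ` is a smooth unit normal field along `f`
(a choice of orientation of the hypersurface). -/
structure IsOrientedHypersurface (f ξ : M → E (n + 1)) : Prop where
  smooth : ContMDiff (𝓡 n) 𝓘(ℝ, E (n + 1)) ∞ f
  immersion : ∀ p, Function.Injective (differential (n := n) f p)
  smooth_normal : ContMDiff (𝓡 n) 𝓘(ℝ, E (n + 1)) ∞ ξ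
  unit_normal : ∀ p, ‖ξ p‖ = 1
  orthogonal : ∀ (p : M) (v : TangentSpace (𝓡 n) p),
    inner ℝ (differential (n := n) f p v) (ξ p) = 0

/-! ### Extrinsic geometry -/

/-- The shape operator `A` at `p`, given by the Weingarten formula `dξ(v) = - df(A v)`. For an
oriented hypersurface the range of `dξ` lies in the range of the injective map `df`, so that the
choice of the left inverse of `df` does not matter. -/
def shapeOperator (f ξ : M → E (n + 1)) (p : M) :
    TangentSpace (𝓡 n) p →ₗ[ℝ] TangentSpace (𝓡 n) p :=
  -((differential f p).leftInverse ∘ₗ differential ξ p)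

/-- The mean curvature `H = (1 / n) trace A`. -/
def meanCurvature (f ξ : M → E (n + 1)) (p : M) : ℝ :=
  (1 / (n : ℝ)) * LinearMap.trace ℝ (TangentSpace (𝓡 n) p) (shapeOperator f ξ p)

/-- The mean curvature vector field `H ξ`. -/
def meanCurvatureVector (f ξ : M → E (n + 1)) (p : M) : E (n + 1) :=
  meanCurvature f ξ p • ξ p

/-- The set of principal curvatures at `p`: the eigenvalues of the shape operator. -/
def principalCurvatures (f ξ : M → E (n + 1)) (p : M) : Set ℝ :=
  {μ | Module.End.HasEigenvalue (shapeOperator f ξ p) μ}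

/-! ### Intrinsic geometry of the induced metric

Tensors at `p` are computed in the preferred chart at `p`; a tangent vector at `p` is, by
definition of `TangentSpace`, the vector of its components in that chart. -/

/-- The components `g_{ij} = ⟨∂_i f, ∂_j f⟩` of the induced metric in the preferred chart at `p`. -/
def inducedMetric (f : M → E (n + 1)) (p : M) (u : E n) : Matrix (Fin n) (Fin n) ℝ :=
  Matrix.of fun i j =>
    inner ℝ (pd i (f ∘ (chartAt (E n) p).symm) u) (pd j (f ∘ (chartAt (E n) p).symm) u)

/-- The Laplace operator of the induced metric on `W`-valued functions on `M`. -/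
def laplacian {W : Type*} [NormedAddCommGroup W] [NormedSpace ℝ W]
    (f : M → E (n + 1)) (F : M → W) (p : M) : W :=
  coordLaplacian (inducedMetric f p) (F ∘ (chartAt (E n) p).symm) (chartAt (E n) p p)

/-- The hypersurface is biharmonic: the Laplacian of its mean curvature vector field vanishes. -/
def IsBiharmonic (f ξ : M → E (n + 1)) : Prop :=
  ∀ p, laplacian f (meanCurvatureVector f ξ) p = 0

/-- `g(R(v, w) w, v)` at `p`; for orthonormal `v`, `w` this is the sectional curvature of the plane
that they span. -/
def sectionalForm (f : M → E (n + 1)) (p : M) (v w : E n) : ℝ :=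
  ∑ i, ∑ j, ∑ k, ∑ l,
    v i * w j * w k * v l * riemann (inducedMetric f p) i j k l (chartAt (E n) p p)

/-- `e` is an `r`-tuple of tangent vectors at `p` that is orthonormal for the induced metric, i.e.
an orthonormal basis of an `r`-dimensional linear subspace of the tangent space. -/
def IsOrthonormalFrame {r : ℕ} (f : M → E (n + 1)) (p : M) (e : Fin r → TangentSpace (𝓡 n) p) :
    Prop :=
  Orthonormal ℝ fun a => differential f p (e a)

/-- The scalar curvature `τ(L) = ∑_{a < b} K(e_a ∧ e_b)` of the linear subspace `L` of the tangent
space at `p` with orthonormal basis `e`. -/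
def subspaceScalarCurvature {r : ℕ} (f : M → E (n + 1)) (p : M)
    (e : Fin r → TangentSpace (𝓡 n) p) : ℝ :=
  ∑ a, ∑ b, if a < b then sectionalForm f p (e a) (e b) else 0

/-- The scalar curvature at `p` in the normalization `τ = ∑_{a < b} K(e_a ∧ e_b)` for an orthonormal
basis of the tangent space, which is one half of the full contraction of the curvature tensor. -/
def scalarCurvature (f : M → E (n + 1)) (p : M) : ℝ :=
  (1 / 2) * ∑ i, ∑ j, ∑ k, ∑ l,
    (inducedMetric f p (chartAt (E n) p p))⁻¹ i l * (inducedMetric f p (chartAt (E n) p p))⁻¹ j k *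
      riemann (inducedMetric f p) i j k l (chartAt (E n) p p)

/-- Chen's invariant `δ(r)(p) = τ(p) - inf τ(L)`, the infimum running over all `r`-dimensional
linear subspaces `L` of the tangent space at `p`. -/
def deltaInvariant (r : ℕ) (f : M → E (n + 1)) (p : M) : ℝ :=
  scalarCurvature f p -
    sInf {t : ℝ | ∃ e : Fin r → TangentSpace (𝓡 n) p,
      IsOrthonormalFrame f p e ∧ t = subspaceScalarCurvature f p e}

/-- The hypersurface is `δ(r)`-ideal: equality holds at every point in Chen's inequality
`δ(r) ≤ n² (n - r) / (2 (n - r + 1)) H²`. -/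
def IsDeltaIdeal (r : ℕ) (f ξ : M → E (n + 1)) : Prop :=
  ∀ p, deltaInvariant r f p =
    (n : ℝ) ^ 2 * ((n : ℝ) - r) / (2 * ((n : ℝ) - r + 1)) * meanCurvature f ξ p ^ 2

end Hypersurface

end DeltaIdeal

end

open scoped Manifold ContDiff

noncomputable section

namespace DeltaIdeal

open Filter Topology

/-! ### The profile functions on a strip -/

/-! Suppose that H is nonzero somewhere. The proof extracts an overdetermined system of ordinary
differential equations along the integral curves of grad H and refutes it by analytic continuation.

Pointwise input. Equality in Chen's inequality is the vanishing of a sum of squares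
(`eq_of_chen_equality`), which makes nH/(n - r + 1) a principal curvature
(`exists_eigenvector_of_ideal`). The biharmonic equation splits into a tangential part, A grad H =
-(n/2) H grad H, and a normal part, trace Hess H = H |A|² (`curvatureEquationsAt`). If H is locally
constant, the normal part gives A = 0, hence H = 0. Otherwise restrict to an open set where H and
grad H do not vanish and put y = -(n/2) H and X = grad H / |grad H|. Then X is principal with
curvature y, trace A = -2y, and c y is a principal curvature, where c = -2/(n - r + 1) < 0.

Evolution. After shrinking the open set, y has multiplicity one (`exists_simple`). The Codazzi
equation then makes the integral curves of X geodesics, and the plane spanned by X and the normal is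
constant along each of them, so its orthogonal complement V is one fixed space. On V the shape
operator A and the derivative B of X are symmetric and satisfy A' = yB - AB, B' = -yA - B². Symmetry
of A' forces AB = BA, and a joint eigenbasis at one point remains one nearby
(`eventually_eigenvector`). The eigenvalues of A and B are β/φ and α/φ with φ' = α, α' = -yβ, β' =
yα. On some subinterval a fixed one of the β/φ equals c y. The trace and the normal equation become
∑ β/φ = -3y and y'' + (∑ α/φ) y' = y (y² + ∑ (β/φ)²).

Contradiction. All pairs (α, β) rotate with the same speed y. For the distinguished index take v =
α/β as the new parameter: every quantity, after division by a power of y, becomes an explicit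
function of v built from P = (1 + v²)^(-c/2) and a primitive R of P/(1 + v²)
(`no_curvature_evolution`). The two equations become identities between functions meromorphic on |Im
v| < 1, and they may be examined as v = it tends to i (`profile_identities_absurd`). As c < 0, P
tends to 0 there, and only the terms whose denominator is a multiple of P survive. If there are N of
these, the limits read cN = -3 and -cN - 2(1 - c)² - 1 = 0, so c(4 - 2c) = 0, impossible for c < 0.
-/

/-- The open strip `|Im z| < 1`. -/
def strip : Set ℂ := {z | |z.im| < 1}

/-- The holomorphic function `(1 + z²)^(-c/2)` on the strip. -/
def profile (c : ℝ) (z : ℂ) : ℂ := Complex.exp (-(c / 2) * Complex.log (1 + z ^ 2))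

lemma isOpen_strip : IsOpen strip :=
  isOpen_lt (continuous_abs.comp Complex.continuous_im) continuous_const

lemma convex_strip : Convex ℝ strip := by
  have h : strip = Complex.imLm ⁻¹' Set.Ioo (-1) 1 := by
    ext z; simp [strip, abs_lt]
  rw [h]
  exact (convex_Ioo _ _).linear_preimage _

lemma one_add_sq_mem_slitPlane {z : ℂ} (hz : z ∈ strip) : 1 + z ^ 2 ∈ Complex.slitPlane := by
  left
  have h : |z.im| < 1 := hz
  have : z.im ^ 2 < 1 := by rw [← sq_abs]; nlinarith [abs_nonneg z.im]
  simp [pow_two]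
  nlinarith [sq_nonneg z.re]

lemma one_add_sq_ne_zero {z : ℂ} (hz : z ∈ strip) : 1 + z ^ 2 ≠ 0 :=
  Complex.slitPlane_ne_zero (one_add_sq_mem_slitPlane hz)

lemma hasDerivAt_profile (c : ℝ) {z : ℂ} (hz : z ∈ strip) :
    HasDerivAt (profile c) (-c * z * profile c z / (1 + z ^ 2)) z := by
  have h1 : HasDerivAt (fun z : ℂ => 1 + z ^ 2) (2 * z) z := by
    simpa using ((hasDerivAt_id z).pow 2).const_add 1
  have h2 := ((h1.clog (one_add_sq_mem_slitPlane hz)).const_mul (-((c : ℂ) / 2))).cexp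
  refine h2.congr_deriv ?_
  simp only [profile]
  field_simp

lemma ofReal_mem_strip (x : ℝ) : (x : ℂ) ∈ strip := by simp [strip]

lemma mul_I_mem_strip {t : ℝ} (h0 : 0 ≤ t) (h1 : t < 1) : (t : ℂ) * Complex.I ∈ strip := by
  simp [strip, abs_of_nonneg h0, h1]

lemma profile_ofReal (c x : ℝ) :
    profile c x = (Real.exp (-(c / 2) * Real.log (1 + x ^ 2)) : ℝ) := by
  simp only [profile]
  rw [show (1 + (x : ℂ) ^ 2) = ((1 + x ^ 2 : ℝ) : ℂ) by push_cast; ring,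
    ← Complex.ofReal_log (by positivity)]
  push_cast; ring_nf

lemma profile_mul_I (c : ℝ) {t : ℝ} (h0 : 0 ≤ t) (h1 : t < 1) :
    profile c (t * Complex.I) = (Real.exp (-(c / 2) * Real.log (1 - t ^ 2)) : ℝ) := by
  simp only [profile]
  rw [show (1 + ((t : ℂ) * Complex.I) ^ 2) = ((1 - t ^ 2 : ℝ) : ℂ) by
      push_cast; rw [mul_pow, Complex.I_sq]; ring,
    ← Complex.ofReal_log (by nlinarith)]
  push_cast; ring_nf

lemma exists_const_of_hasDerivAt_zero {f : ℝ → ℝ} {a b : ℝ} 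
    (h : ∀ x ∈ Set.Ioo a b, HasDerivAt f 0 x) : ∃ C, ∀ x ∈ Set.Ioo a b, f x = C := by
  by_cases hab : a < b
  · refine ⟨f ((a + b) / 2), fun x hx => ?_⟩
    refine isOpen_Ioo.is_const_of_deriv_eq_zero isPreconnected_Ioo
      (fun x hx => (h x hx).differentiableAt.differentiableWithinAt)
      (fun x hx => (h x hx).deriv) hx ⟨by linarith, by linarith⟩
  · exact ⟨0, fun x hx => absurd (hx.1.trans hx.2) hab⟩

/-- A primitive of `(1 + z²)^(-c/2 - 1)` on the strip, real on the real axis. -/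
lemma exists_profile_primitive (c : ℝ) : ∃ R : ℂ → ℂ, R 0 = 0 ∧
    ∀ z ∈ strip, HasDerivAt R (profile c z / (1 + z ^ 2)) z := by
  have hd : DifferentiableOn ℂ (fun z => profile c z / (1 + z ^ 2)) strip := fun z hz =>
    ((hasDerivAt_profile c hz).differentiableAt.div (by fun_prop)
      (one_add_sq_ne_zero hz)).differentiableWithinAt
  obtain ⟨g, hg⟩ := convex_strip.exists_forall_hasDerivWithinAt hd
  refine ⟨fun z => g z - g 0, by simp, fun z hz => ?_⟩
  exact ((hg z hz).hasDerivAt (isOpen_strip.mem_nhds hz)).sub_const _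

variable {c : ℝ} {R : ℂ → ℂ}

lemma primitive_ofReal_im (h0 : R 0 = 0)
    (hR : ∀ z ∈ strip, HasDerivAt R (profile c z / (1 + z ^ 2)) z) (x : ℝ) : (R x).im = 0 := by
  have h : ∀ x : ℝ, HasDerivAt (fun x : ℝ => (R x).im) 0 x := fun x => by
    have h1 := (hR x (ofReal_mem_strip x)).comp_ofReal
    have h2 := Complex.imCLM.hasFDerivAt.comp_hasDerivAt x h1
    refine h2.congr_deriv ?_
    rw [profile_ofReal, show (1 + (x : ℂ) ^ 2) = ((1 + x ^ 2 : ℝ) : ℂ) by push_cast; ring,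
      ← Complex.ofReal_div]
    rw [Complex.imCLM_apply, Complex.ofReal_im]
  have := is_const_of_deriv_eq_zero (fun x => (h x).differentiableAt) (fun x => (h x).deriv) x 0
  simpa [h0] using this

lemma primitive_ofReal_hasDerivAt 
    (hR : ∀ z ∈ strip, HasDerivAt R (profile c z / (1 + z ^ 2)) z) (x : ℝ) :
    HasDerivAt (fun x : ℝ => (R x).re) ((profile c x).re / (1 + x ^ 2)) x := by
  have h2 := Complex.reCLM.hasFDerivAt.comp_hasDerivAt x
    (hR x (ofReal_mem_strip x)).comp_ofReal
  refine h2.congr_deriv ?_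
  rw [profile_ofReal, show (1 + (x : ℂ) ^ 2) = ((1 + x ^ 2 : ℝ) : ℂ) by push_cast; ring,
    ← Complex.ofReal_div]
  exact Complex.ofReal_re _

/-- On the imaginary segment the primitive is `i` times an increasing real function. -/
lemma primitive_mul_I (h0 : R 0 = 0)
    (hR : ∀ z ∈ strip, HasDerivAt R (profile c z / (1 + z ^ 2)) z) :
    ∃ ρ : ℝ, 0 < ρ ∧ ∀ t : ℝ, 1 / 2 ≤ t → t < 1 →
      (R (t * Complex.I)).re = 0 ∧ ρ ≤ (R (t * Complex.I)).im := by
  -- On the segment, d/dt R(it) = i (1 - t²)^(-c/2 - 1), a positive multiple of i. Hence Re R(it)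
  -- stays 0 and Im R(it) increases strictly from 0.
  have key : ∀ t : ℝ, |t| < 1 → HasDerivAt (fun t : ℝ => R (t * Complex.I))
      (Complex.I * ((Real.exp (-(c / 2) * Real.log (1 - t ^ 2)) / (1 - t ^ 2) : ℝ))) t := by
    intro t ht
    have hm : (t : ℂ) * Complex.I ∈ strip := by simpa [strip] using ht
    have h1 : HasDerivAt (fun z : ℂ => z * Complex.I) Complex.I (t : ℂ) := by
      simpa using (hasDerivAt_id (t : ℂ)).mul_const Complex.I
    have h2 := (HasDerivAt.comp (t : ℂ) (hR _ hm) h1).comp_ofReal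
    refine h2.congr_deriv (Eq.symm ?_)
    have ht2 : t ^ 2 < 1 := by rw [← sq_abs]; nlinarith [abs_nonneg t]
    have e : (1 + ((t : ℂ) * Complex.I) ^ 2) = ((1 - t ^ 2 : ℝ) : ℂ) := by
      push_cast; rw [mul_pow, Complex.I_sq]; ring
    simp only [profile]
    rw [e, ← Complex.ofReal_log (by nlinarith)]
    push_cast; ring_nf
  have hre : ∀ t ∈ Set.Ioo (-1 : ℝ) 1, HasDerivAt (fun t : ℝ => (R (t * Complex.I)).re) 0 t :=
    fun t ht => by
      have h2 := Complex.reCLM.hasFDerivAt.comp_hasDerivAt t (key t (abs_lt.2 ht))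
      refine h2.congr_deriv ?_
      simp only [Complex.reCLM_apply, Complex.re_mul_ofReal, Complex.I_re, zero_mul]
  have him : ∀ t ∈ Set.Ioo (-1 : ℝ) 1, HasDerivAt (fun t : ℝ => (R (t * Complex.I)).im)
      (Real.exp (-(c / 2) * Real.log (1 - t ^ 2)) / (1 - t ^ 2)) t := fun t ht => by
    have h2 := Complex.imCLM.hasFDerivAt.comp_hasDerivAt t (key t (abs_lt.2 ht))
    refine h2.congr_deriv ?_
    simp only [Complex.imCLM_apply, Complex.im_mul_ofReal, Complex.I_im, one_mul]
  have hmono : StrictMonoOn (fun t : ℝ => (R (t * Complex.I)).im) (Set.Ioo (-1 : ℝ) 1) := by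
    refine strictMonoOn_of_deriv_pos (convex_Ioo _ _)
      (fun t ht => (him t ht).continuousAt.continuousWithinAt) fun t ht => ?_
    rw [interior_Ioo] at ht
    rw [(him t ht).deriv]
    have : 0 < 1 - t ^ 2 := by nlinarith [ht.1, ht.2]
    positivity
  obtain ⟨C, hC⟩ := exists_const_of_hasDerivAt_zero hre
  have hC0 : C = 0 := by have := hC 0 (by norm_num); simpa [h0] using this.symm
  refine ⟨(R ((1 / 2 : ℝ) * Complex.I)).im, ?_, fun t h1 h2 => ⟨?_, ?_⟩⟩
  · have := hmono (a := 0) (b := 1 / 2) (by norm_num) (by norm_num) (by norm_num)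
    simpa [h0] using this
  · rw [hC t ⟨by linarith, h2⟩, hC0]
  · exact hmono.monotoneOn (by norm_num) ⟨by linarith, h2⟩ h1

/-! ### Analytic continuation of identities between partial fractions -/

/-- Multiplying by all denominators gives a function Ψ analytic on U even where some D j vanishes.
The identity theorem applies to Ψ, and one divides back at points where no denominator is zero. This
continues an identity past possible poles. -/
lemma sum_div_eq_of_frequently {ι : Type*} [Fintype ι] {U : Set ℂ} (hU : IsPreconnected U)
    {x D : ι → ℂ → ℂ} {e : ℂ → ℂ} (hx : ∀ j, AnalyticOnNhd ℂ (x j) U)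
    (hD : ∀ j, AnalyticOnNhd ℂ (D j) U) (he : AnalyticOnNhd ℂ e U) {z₀ : ℂ} (hz₀ : z₀ ∈ U)
    (h : ∃ᶠ z in 𝓝[≠] z₀, (∀ j, D j z ≠ 0) ∧ (∑ j, x j z / D j z) + e z = 0)
    {z : ℂ} (hz : z ∈ U) (hDz : ∀ j, D j z ≠ 0) : (∑ j, x j z / D j z) + e z = 0 := by
  classical
  set Ψ : ℂ → ℂ := fun z => (∑ j, x j z * ∏ k ∈ Finset.univ.erase j, D k z) + e z * ∏ k, D k z
  have hΨ : ∀ z, (∀ j, D j z ≠ 0) → Ψ z = ((∑ j, x j z / D j z) + e z) * ∏ k, D k z := by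
    intro z hz
    simp only [Ψ]
    rw [add_mul, Finset.sum_mul]
    refine congrArg (· + _) ?_
    refine Finset.sum_congr rfl fun j _ => ?_
    rw [← Finset.mul_prod_erase Finset.univ (fun k => D k z) (Finset.mem_univ j)]
    field_simp [hz j]
  have hprod : ∀ s : Finset ι, AnalyticOnNhd ℂ (fun z => ∏ k ∈ s, D k z) U := fun s z hz =>
    Finset.analyticAt_fun_prod _ fun k _ => hD k z hz
  have hΨa : AnalyticOnNhd ℂ Ψ U := fun z hz =>
    (Finset.analyticAt_fun_sum _ fun j _ => (hx j z hz).mul (hprod _ z hz)).add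
      ((he z hz).mul (hprod _ z hz))
  have h0 := hΨa.eqOn_zero_of_preconnected_of_frequently_eq_zero hU hz₀
    (h.mono fun z hz => by rw [hΨ z hz.1, hz.2, zero_mul])
  have := h0 hz
  rw [hΨ z hDz] at this
  exact (mul_eq_zero.1 this).resolve_right (Finset.prod_ne_zero_iff.2 fun j _ => hDz j)

lemma tendsto_div_zero_of_le_norm {α : Type*} {l : Filter α} {x D : α → ℂ} {δ : ℝ} (hδ : 0 < δ)
    (hx : Tendsto x l (𝓝 0)) (hD : ∀ᶠ t in l, δ ≤ ‖D t‖) :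
    Tendsto (fun t => x t / D t) l (𝓝 0) := by
  refine squeeze_zero_norm' (a := fun t => ‖x t‖ / δ) (hD.mono fun t ht => ?_) ?_
  · rw [norm_div]
    exact div_le_div_of_nonneg_left (norm_nonneg _) hδ ht
  · simpa using hx.norm.div_const δ

/-- At z = it the profile is (1 - t²)^(-c/2), whose exponent is positive exactly because c < 0. -/
lemma tendsto_profile_mul_I (hc : c < 0) :
    Tendsto (fun t : ℝ => profile c (t * Complex.I)) (𝓝[<] 1) (𝓝 0) := by
  have h1 : Tendsto (fun t : ℝ => 1 - t ^ 2) (𝓝[<] 1) (𝓝[>] 0) := by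
    refine tendsto_nhdsWithin_iff.2 ⟨?_, ?_⟩
    · have : Tendsto (fun t : ℝ => 1 - t ^ 2) (𝓝 1) (𝓝 (1 - 1 ^ 2)) :=
        Continuous.tendsto (by fun_prop) 1
      simpa using this.mono_left nhdsWithin_le_nhds
    · filter_upwards [Ioo_mem_nhdsLT (show (0 : ℝ) < 1 by norm_num)] with t ht
      simp only [Set.mem_Ioi]
      nlinarith [ht.1, ht.2]
  have h2 := (Real.tendsto_log_nhdsGT_zero.comp h1).const_mul_atBot
    (show 0 < -(c / 2) by linarith)
  have h3 := (Complex.continuous_ofReal.tendsto 0).comp (Real.tendsto_exp_atBot.comp h2)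
  rw [Complex.ofReal_zero] at h3
  refine h3.congr' ?_
  filter_upwards [Ioo_mem_nhdsLT (show (0 : ℝ) < 1 by norm_num)] with t ht
  rw [profile_mul_I c ht.1.le ht.2]
  rfl

/-- The denominators `d + p P + c q R` of the rescaled principal curvatures. -/
def profileDenom (c : ℝ) (R : ℂ → ℂ) (p q d : ℝ) (z : ℂ) : ℂ :=
  d + p * profile c z + c * q * R z

/-- On the imaginary segment d + pP is real and cqR is purely imaginary, so for q ≠ 0 no
cancellation can occur and the imaginary part alone bounds the denominator below. For q = 0 the
denominator tends to d ≠ 0. In the excluded case it is pP, which tends to 0. -/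
lemma profileDenom_bound (hc : c < 0) (h0 : R 0 = 0)
    (hR : ∀ z ∈ strip, HasDerivAt R (profile c z / (1 + z ^ 2)) z) {p q d : ℝ}
    (hqd : ¬ (q = 0 ∧ d = 0)) :
    ∃ δ > 0, ∀ᶠ t : ℝ in 𝓝[<] 1, δ ≤ ‖profileDenom c R p q d (t * Complex.I)‖ := by
  by_cases hq : q = 0
  · have hd : d ≠ 0 := fun h => hqd ⟨hq, h⟩
    refine ⟨|d| / 2, by positivity, ?_⟩
    have h1 : Tendsto (fun t : ℝ => ‖profileDenom c R p q d (t * Complex.I)‖) (𝓝[<] 1)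
        (𝓝 ‖((d : ℂ) + p * 0)‖) := by
      have := (((tendsto_profile_mul_I hc).const_mul (p : ℂ)).const_add (d : ℂ)).norm
      refine this.congr fun t => ?_
      simp [profileDenom, hq]
    have h2 : |d| / 2 < ‖((d : ℂ) + p * 0)‖ := by
      have : 0 < |d| := by positivity
      simpa using this
    exact (h1.eventually (lt_mem_nhds h2)).mono fun t ht => ht.le
  · obtain ⟨ρ, hρ, h⟩ := primitive_mul_I h0 hR
    have hcq : 0 < |c * q| := abs_pos.2 (mul_ne_zero hc.ne hq)
    refine ⟨|c * q| * ρ, by positivity, ?_⟩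
    filter_upwards [Ioo_mem_nhdsLT (show (1 / 2 : ℝ) < 1 by norm_num)] with t ht
    obtain ⟨h3, h4⟩ := h t ht.1.le ht.2
    refine le_trans ?_ (Complex.abs_im_le_norm _)
    have e : (profileDenom c R p q d (t * Complex.I)).im
        = c * q * (R (t * Complex.I)).im := by
      rw [profileDenom, profile_mul_I c (by linarith [ht.1]) ht.2, ← Complex.ofReal_mul,
        ← Complex.ofReal_mul, ← Complex.ofReal_add, Complex.add_im, Complex.ofReal_im,
        Complex.im_ofReal_mul, zero_add]
    rw [e, abs_mul (c * q)]
    exact mul_le_mul_of_nonneg_left (h4.trans (le_abs_self _)) hcq.le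

lemma analyticOnNhd_profile (c : ℝ) : AnalyticOnNhd ℂ (profile c) strip :=
  DifferentiableOn.analyticOnNhd
    (fun _ hz => (hasDerivAt_profile c hz).differentiableAt.differentiableWithinAt) isOpen_strip

/-- Continue both identities to z = it and let t tend to 1. A term with q = d = 0 has quotient
exactly c in the first sum and cz in the second, since P cancels; every other term tends to 0. The
limits are two linear equations in the number N of exceptional terms, and eliminating N leaves c(4 -
2c) = 0. -/
lemma profile_identities_absurd {ι : Type*} [Fintype ι] (hc : c < 0) (h0 : R 0 = 0)
    (hR : ∀ z ∈ strip, HasDerivAt R (profile c z / (1 + z ^ 2)) z) (p q d : ι → ℝ) (x₀ : ℝ)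
    (h : ∃ᶠ z in 𝓝[≠] (x₀ : ℂ), (∀ j, profileDenom c R (p j) (q j) (d j) z ≠ 0) ∧
      (∑ j, c * profile c z * (q j * z + p j) / profileDenom c R (p j) (q j) (d j) z) + 3 = 0 ∧
      (1 - c) * z * (∑ j, c * profile c z * (p j * z - q j) /
          profileDenom c R (p j) (q j) (d j) z)
        + (1 - c) * (2 * (1 - c) * z ^ 2 - (1 + z ^ 2))
        = 1 + ∑ j, (c * profile c z * (q j * z + p j) /
          profileDenom c R (p j) (q j) (d j) z) ^ 2) : False := by
  classical
  set D : ι → ℂ → ℂ := fun j => profileDenom c R (p j) (q j) (d j) with hDdef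
  set T : ι → ℂ → ℂ := fun j z => c * profile c z * (q j * z + p j) / D j z with hTdef
  set U : ι → ℂ → ℂ := fun j z => c * profile c z * (p j * z - q j) / D j z with hUdef
  have hP := analyticOnNhd_profile c
  have hRa : AnalyticOnNhd ℂ R strip := DifferentiableOn.analyticOnNhd
    (fun _ hz => (hR _ hz).differentiableAt.differentiableWithinAt) isOpen_strip
  have hD : ∀ j, AnalyticOnNhd ℂ (D j) strip := fun j z hz =>
    (analyticAt_const.add (analyticAt_const.mul (hP z hz))).add (analyticAt_const.mul (hRa z hz))
  have hTn : ∀ j, AnalyticOnNhd ℂ (fun z => c * profile c z * (q j * z + p j)) strip :=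
    fun j z hz => (analyticAt_const.mul (hP z hz)).mul
      ((analyticAt_const.mul analyticAt_id).add analyticAt_const)
  have hUn : ∀ j, AnalyticOnNhd ℂ (fun z => c * profile c z * (p j * z - q j)) strip :=
    fun j z hz => (analyticAt_const.mul (hP z hz)).mul
      ((analyticAt_const.mul analyticAt_id).sub analyticAt_const)
  have hpre : IsPreconnected strip := convex_strip.isPreconnected
  have I1 : ∀ z ∈ strip, (∀ j, D j z ≠ 0) → (∑ j, T j z) + 3 = 0 := fun z hz hDz =>
    sum_div_eq_of_frequently hpre hTn hD (fun z _ => analyticAt_const) (ofReal_mem_strip x₀)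
      (h.mono fun z hz => ⟨hz.1, hz.2.1⟩) hz hDz
  -- Over the denominators D² the linear and quadratic terms of the second identity combine into one
  -- sum of fractions, the shape needed for `sum_div_eq_of_frequently`.
  have split : ∀ z, (∀ j, D j z ≠ 0) →
      (∑ j, ((1 - c) * z * (c * profile c z * (p j * z - q j)) * D j z
        - (c * profile c z * (q j * z + p j)) ^ 2) / (D j z) ^ 2)
      = (1 - c) * z * (∑ j, U j z) - ∑ j, (T j z) ^ 2 := by
    intro z hz
    rw [Finset.mul_sum, ← Finset.sum_sub_distrib]
    refine Finset.sum_congr rfl fun j _ => ?_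
    simp only [hTdef, hUdef]
    field_simp [hz j]
  have I2 : ∀ z ∈ strip, (∀ j, D j z ≠ 0) → (1 - c) * z * (∑ j, U j z) - ∑ j, (T j z) ^ 2
      + ((1 - c) * (2 * (1 - c) * z ^ 2 - (1 + z ^ 2)) - 1) = 0 := by
    intro z hz hDz
    rw [← split z hDz]
    refine sum_div_eq_of_frequently hpre
      (x := fun j z => (1 - c) * z * (c * profile c z * (p j * z - q j)) * D j z
        - (c * profile c z * (q j * z + p j)) ^ 2) (D := fun j z => (D j z) ^ 2)
      (e := fun z => (1 - c) * (2 * (1 - c) * z ^ 2 - (1 + z ^ 2)) - 1)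
      (fun j z hz => ?_) (fun j z hz => (hD j z hz).pow 2) (fun z _ => ?_)
      (ofReal_mem_strip x₀) (h.mono fun z hz => ⟨fun j => pow_ne_zero 2 (hz.1 j), ?_⟩) hz
      (fun j => pow_ne_zero 2 (hDz j))
    · exact (((analyticAt_const.mul analyticAt_id).mul (hUn j z hz)).mul (hD j z hz)).sub
        ((hTn j z hz).pow 2)
    · fun_prop
    · rw [split z hz.1]
      linear_combination hz.2.2
  have hTU : ∀ j, (∀ᶠ t : ℝ in 𝓝[<] 1, D j (t * Complex.I) ≠ 0) ∧
      Tendsto (fun t : ℝ => T j (t * Complex.I)) (𝓝[<] 1)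
        (𝓝 (if q j = 0 ∧ d j = 0 then (c : ℂ) else 0)) ∧
      Tendsto (fun t : ℝ => U j (t * Complex.I)) (𝓝[<] 1)
        (𝓝 (if q j = 0 ∧ d j = 0 then (c : ℂ) * Complex.I else 0)) := by
    intro j
    have hz : Tendsto (fun t : ℝ => (t : ℂ) * Complex.I) (𝓝[<] 1) (𝓝 Complex.I) := by
      have : Tendsto (fun t : ℝ => (t : ℂ) * Complex.I) (𝓝 1) (𝓝 ((1 : ℝ) * Complex.I)) :=
        Continuous.tendsto (by fun_prop) 1
      simpa using this.mono_left nhdsWithin_le_nhds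
    by_cases hj : q j = 0 ∧ d j = 0
    · simp only [hj, and_self, if_true]
      -- With q = d = 0 the denominator is pP. It is nonzero at some point, so p ≠ 0 and the
      -- quotients can be simplified.
      obtain ⟨w, hw, -⟩ := h.exists
      have hp : (p j : ℂ) ≠ 0 := by
        intro hp
        exact hw j (by simp [profileDenom, hj, hp])
      have hPne : ∀ z, profile c z ≠ 0 := fun z => Complex.exp_ne_zero _
      have eD : ∀ z, D j z = p j * profile c z := fun z => by simp [hDdef, profileDenom, hj]
      have eT : ∀ z, T j z = c := fun z => by
        simp only [hTdef, eD, hj]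
        have := hPne z
        field_simp
        simp
      have eU : ∀ z, U j z = c * z := fun z => by
        simp only [hUdef, eD, hj]
        have := hPne z
        field_simp
        ring_nf
        simp
      simp only [eT, eU, eD]
      exact ⟨Eventually.of_forall fun t => mul_ne_zero hp (hPne _), tendsto_const_nhds,
        hz.const_mul _⟩
    · simp only [hj, if_false]
      obtain ⟨δ, hδ, hb⟩ := profileDenom_bound hc h0 hR (p := p j) hj
      have hP0 := (tendsto_profile_mul_I hc).const_mul (c : ℂ)
      refine ⟨hb.mono fun t ht hD0 => ?_, tendsto_div_zero_of_le_norm hδ ?_ hb,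
        tendsto_div_zero_of_le_norm hδ ?_ hb⟩
      · rw [show profileDenom c R (p j) (q j) (d j) (t * Complex.I) = 0 from hD0,
          norm_zero] at ht
        linarith
      · simpa using hP0.mul ((hz.const_mul (q j : ℂ)).add_const (p j : ℂ))
      · simpa using hP0.mul ((hz.const_mul (p j : ℂ)).sub_const (q j : ℂ))
  have hz : Tendsto (fun t : ℝ => (t : ℂ) * Complex.I) (𝓝[<] 1) (𝓝 Complex.I) := by
    have : Tendsto (fun t : ℝ => (t : ℂ) * Complex.I) (𝓝 1) (𝓝 ((1 : ℝ) * Complex.I)) :=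
      Continuous.tendsto (by fun_prop) 1
    simpa using this.mono_left nhdsWithin_le_nhds
  have hev : ∀ᶠ t : ℝ in 𝓝[<] 1, (t : ℂ) * Complex.I ∈ strip ∧
      ∀ j, D j (t * Complex.I) ≠ 0 := by
    refine Eventually.and ?_ (eventually_all.2 fun j => (hTU j).1)
    filter_upwards [Ioo_mem_nhdsLT (show (0 : ℝ) < 1 by norm_num)] with t ht
    exact mul_I_mem_strip ht.1.le ht.2
  -- N counts the exceptional indices, as a complex number.
  set N : ℂ := ∑ j, (if q j = 0 ∧ d j = 0 then (1 : ℂ) else 0) with hN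
  have L1 : (c : ℂ) * N + 3 = 0 := by
    have l := (tendsto_finsetSum (Finset.univ) fun j _ => (hTU j).2.1).add_const (3 : ℂ)
    have := tendsto_nhds_unique (l.congr' (hev.mono fun t ht => I1 _ ht.1 ht.2))
      tendsto_const_nhds
    rw [← this, hN, Finset.mul_sum]
    simp
  have L2 : (1 - c) * Complex.I * (c * Complex.I * N) - c ^ 2 * N
      + ((1 - c) * (2 * (1 - c) * Complex.I ^ 2 - (1 + Complex.I ^ 2)) - 1) = 0 := by
    have lU := tendsto_finsetSum (Finset.univ) fun j _ => (hTU j).2.2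
    have lT := tendsto_finsetSum (Finset.univ) fun j _ => (hTU j).2.1.pow 2
    have lp : Tendsto (fun t : ℝ => ((1 - c) * (2 * (1 - c) * ((t : ℂ) * Complex.I) ^ 2
        - (1 + ((t : ℂ) * Complex.I) ^ 2)) - 1)) (𝓝[<] 1)
        (𝓝 ((1 - c) * (2 * (1 - c) * Complex.I ^ 2 - (1 + Complex.I ^ 2)) - 1)) :=
      (Continuous.tendsto (f := fun z : ℂ => (1 - c) * (2 * (1 - c) * z ^ 2 - (1 + z ^ 2)) - 1)
        (by fun_prop) _).comp hz
    have l := (((hz.const_mul (1 - c : ℂ)).mul lU).sub lT).add lp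
    have := tendsto_nhds_unique (l.congr' (hev.mono fun t ht => I2 _ ht.1 ht.2))
      tendsto_const_nhds
    have e1 : (∑ j, if q j = 0 ∧ d j = 0 then (c : ℂ) * Complex.I else 0) = c * Complex.I * N := by
      rw [hN, Finset.mul_sum]
      exact Finset.sum_congr rfl fun j _ => by split_ifs <;> simp
    have e2 : (∑ j, (if q j = 0 ∧ d j = 0 then (c : ℂ) else 0) ^ 2) = c ^ 2 * N := by
      rw [hN, Finset.mul_sum]
      exact Finset.sum_congr rfl fun j _ => by split_ifs <;> simp
    rw [e1, e2] at this
    exact this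
  rw [Complex.I_sq] at L2
  have L3 : (c : ℂ) * (4 - 2 * c) = 0 := by
    linear_combination L2 + L1 - (1 - c) * c * N * Complex.I_sq
  have : (c * (4 - 2 * c) : ℝ) = 0 := by exact_mod_cast L3
  nlinarith

/-! ### Reduction of the curvature evolution to identities in one variable -/

/-- The system of ordinary differential equations that the principal curvatures `β j / φ j` and the
principal curvatures `α j / φ j` of the level sets satisfy along an integral curve of the gradient
of the mean curvature has no solution. -/
theorem no_curvature_evolution {ι : Type*} [Fintype ι] (hc : c < 0) {a b : ℝ} (hab : a < b)
    {y y1 y2 : ℝ → ℝ} {φ α β : ι → ℝ → ℝ}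
    (hy : ∀ s ∈ Set.Ioo a b, HasDerivAt y (y1 s) s)
    (hy1 : ∀ s ∈ Set.Ioo a b, HasDerivAt y1 (y2 s) s)
    (hφ : ∀ j, ∀ s ∈ Set.Ioo a b, HasDerivAt (φ j) (α j s) s)
    (hα : ∀ j, ∀ s ∈ Set.Ioo a b, HasDerivAt (α j) (-(y s * β j s)) s)
    (hβ : ∀ j, ∀ s ∈ Set.Ioo a b, HasDerivAt (β j) (y s * α j s) s)
    (hφ0 : ∀ j, ∀ s ∈ Set.Ioo a b, φ j s ≠ 0) (hy0 : ∀ s ∈ Set.Ioo a b, y s ≠ 0)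
    (j₀ : ι) (hj₀ : ∀ s ∈ Set.Ioo a b, β j₀ s = c * y s * φ j₀ s)
    (htr : ∀ s ∈ Set.Ioo a b, ∑ j, β j s / φ j s = -3 * y s)
    (hlap : ∀ s ∈ Set.Ioo a b, y2 s + (∑ j, α j s / φ j s) * y1 s
      = y s * (y s ^ 2 + ∑ j, (β j s / φ j s) ^ 2)) : False := by
  obtain ⟨R, hR0, hR⟩ := exists_profile_primitive c
  have hc0 : c ≠ 0 := hc.ne
  set I := Set.Ioo a b with hI
  have hβ0 : ∀ s ∈ I, β j₀ s ≠ 0 := fun s hs => by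
    rw [hj₀ s hs]; exact mul_ne_zero (mul_ne_zero hc0 (hy0 s hs)) (hφ0 _ s hs)
  -- The pair (α, β) rotates with speed y, and v is the cotangent of its angle. As v' = -y(1 + v²)
  -- never vanishes, v can replace s as the parameter.
  set v : ℝ → ℝ := fun s => α j₀ s / β j₀ s with hv
  have hv' : ∀ s ∈ I, HasDerivAt v (-(y s * (1 + v s ^ 2))) s := fun s hs => by
    refine ((hα j₀ s hs).div (hβ j₀ s hs) (hβ0 s hs)).congr_deriv ?_
    have := hβ0 s hs
    simp only [hv]
    field_simp
    ring
  -- Differentiate β = c y φ at the index j₀ and compare with β' = yα.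
  have hy1v : ∀ s ∈ I, y1 s = (1 - c) * y s ^ 2 * v s := fun s hs => by
    have e1 := (((hy s hs).const_mul c).mul (hφ j₀ s hs))
    have e2 : HasDerivAt (fun s => c * y s * φ j₀ s) (y s * α j₀ s) s :=
      (hβ j₀ s hs).congr_of_eventuallyEq
        (Filter.eventually_of_mem (isOpen_Ioo.mem_nhds hs) fun t ht => (hj₀ t ht).symm)
    have e3 := e1.unique e2
    have e4 : v s * (c * y s * φ j₀ s) = α j₀ s := by
      rw [← hj₀ s hs]; exact div_mul_cancel₀ _ (hβ0 s hs)
    have := hφ0 j₀ s hs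
    apply mul_left_cancel₀ (mul_ne_zero hc0 this)
    linear_combination e3 - (1 - c) * y s * e4
  have hy2v : ∀ s ∈ I, y2 s
      = (1 - c) * y s ^ 3 * (2 * (1 - c) * v s ^ 2 - (1 + v s ^ 2)) := fun s hs => by
    have e1 := (((hy s hs).pow 2).const_mul (1 - c)).mul (hv' s hs)
    have e2 := (hy1 s hs).congr_of_eventuallyEq (f₁ := fun s => (1 - c) * y s ^ 2 * v s)
        (Filter.eventually_of_mem (isOpen_Ioo.mem_nhds hs) fun t ht => (hy1v t ht).symm)
    have e3 := e2.unique e1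
    rw [e3, hy1v s hs]
    simp
    ring
  -- All pairs (α j, β j) rotate by the same angle, so lengths, scalar products and cross products
  -- with the pair of index j₀ are first integrals. They give the constants ρ, p and q.
  have hρ : ∃ C, ∀ s ∈ I, α j₀ s ^ 2 + β j₀ s ^ 2 = C := exists_const_of_hasDerivAt_zero
    fun s hs => (((hα j₀ s hs).pow 2).add ((hβ j₀ s hs).pow 2)).congr_deriv (by simp; ring)
  obtain ⟨ρ, hρ⟩ := hρ
  have hmid : (a + b) / 2 ∈ I := ⟨by linarith, by linarith⟩
  have hρ0 : ρ ≠ 0 := by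
    rw [← hρ _ hmid]
    have := hβ0 _ hmid
    positivity
  have hp : ∀ j, ∃ C, ∀ s ∈ I, (α j s * α j₀ s + β j s * β j₀ s) / ρ = C := fun j =>
    exists_const_of_hasDerivAt_zero fun s hs =>
      ((((hα j s hs).mul (hα j₀ s hs)).add ((hβ j s hs).mul (hβ j₀ s hs))).div_const ρ).congr_deriv
        (by ring)
  have hq : ∀ j, ∃ C, ∀ s ∈ I, (β j s * α j₀ s - α j s * β j₀ s) / ρ = C := fun j =>
    exists_const_of_hasDerivAt_zero fun s hs =>
      ((((hβ j s hs).mul (hα j₀ s hs)).sub ((hα j s hs).mul (hβ j₀ s hs))).div_const ρ).congr_deriv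
        (by ring)
  choose p hp using hp
  choose q hq using hq
  have hαv : ∀ j, ∀ s ∈ I, α j s = β j₀ s * (p j * v s - q j) := fun j s hs => by
    have := hβ0 s hs
    rw [← hp j s hs, ← hq j s hs, hv]
    have e := hρ s hs
    field_simp
    rw [← e]; ring
  have hβv : ∀ j, ∀ s ∈ I, β j s = β j₀ s * (q j * v s + p j) := fun j s hs => by
    have := hβ0 s hs
    rw [← hp j s hs, ← hq j s hs, hv]
    have e := hρ s hs
    field_simp
    rw [← e]; ring
  set P : ℝ → ℝ := fun x => Real.exp (-(c / 2) * Real.log (1 + x ^ 2)) with hP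
  have hPpos : ∀ x, 0 < P x := fun x => Real.exp_pos _
  have hP' : ∀ x, HasDerivAt P (-c * x * P x / (1 + x ^ 2)) x := fun x => by
    have h1 : HasDerivAt (fun x : ℝ => 1 + x ^ 2) (2 * x) x := by
      simpa using ((hasDerivAt_id x).pow 2).const_add 1
    have hne : 1 + x ^ 2 ≠ 0 := by positivity
    refine ((h1.log hne).const_mul (-(c / 2))).exp.congr_deriv ?_
    simp only [hP]
    field_simp
  have hPv : ∀ s ∈ I, HasDerivAt (fun s => P (v s)) (c * y s * v s * P (v s)) s := fun s hs => by
    refine (HasDerivAt.comp s (hP' (v s)) (hv' s hs)).congr_deriv ?_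
    have hne : 1 + v s ^ 2 ≠ 0 := by positivity
    field_simp
  -- Both φ j₀ and P(v) have logarithmic derivative c y v; this is what dictates the exponent -c/2
  -- in the profile.
  have hκ : ∃ C, ∀ s ∈ I, φ j₀ s / P (v s) = C := exists_const_of_hasDerivAt_zero fun s hs => by
    refine ((hφ j₀ s hs).div (hPv s hs) (hPpos _).ne').congr_deriv ?_
    rw [div_eq_zero_iff]; left
    have e4 : v s * (c * y s * φ j₀ s) = α j₀ s := by
      rw [← hj₀ s hs]; exact div_mul_cancel₀ _ (hβ0 s hs)
    rw [← e4]; ring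
  obtain ⟨κ, hκ⟩ := hκ
  have hκ0 : κ ≠ 0 := by
    rw [← hκ _ hmid]; exact div_ne_zero (hφ0 _ _ hmid) (hPpos _).ne'
  have hφκ : ∀ s ∈ I, φ j₀ s = κ * P (v s) := fun s hs => by
    rw [← hκ s hs, div_mul_cancel₀ _ (hPpos _).ne']
  have hβκ : ∀ s ∈ I, β j₀ s = c * y s * κ * P (v s) := fun s hs => by
    rw [hj₀ s hs, hφκ s hs]; ring
  -- Here φ' = α = c y κ P(v)(p v - q). The part with p v integrates to P(v) and the part with -q to
  -- R(v), because P(v)' = c y v P(v) and R(v)' = -y P(v). The constant of integration is d.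
  have hd : ∀ j, ∃ C, ∀ s ∈ I, φ j s / κ - p j * P (v s) - c * q j * (R (v s)).re = C := fun j =>
    exists_const_of_hasDerivAt_zero fun s hs => by
      have h1 := HasDerivAt.comp s (primitive_ofReal_hasDerivAt hR (v s)) (hv' s hs)
      refine ((((hφ j s hs).div_const κ).sub ((hPv s hs).const_mul (p j))).sub
        (h1.const_mul (c * q j))).congr_deriv ?_
      rw [hαv j s hs, hβκ s hs, profile_ofReal, Complex.ofReal_re]
      have hne : 1 + v s ^ 2 ≠ 0 := by positivity
      simp only [hP]
      field_simp
      ring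
  choose d hd using hd
  have hreal : ∀ x : ℝ, R x = ((R x).re : ℝ) := fun x =>
    Complex.ext (by simp) (by simp [primitive_ofReal_im hR0 hR x])
  have hPc : ∀ s, profile c (v s) = (P (v s) : ℝ) := fun s => profile_ofReal c (v s)
  have hden : ∀ j, ∀ s ∈ I, profileDenom c R (p j) (q j) (d j) (v s) = (φ j s / κ : ℝ) :=
    fun j s hs => by
      rw [profileDenom, hreal, hPc, ← hd j s hs]
      push_cast
      ring
  have hT : ∀ j, ∀ s ∈ I, c * profile c (v s) * (q j * v s + p j) /
      profileDenom c R (p j) (q j) (d j) (v s) = (β j s / φ j s / y s : ℝ) := fun j s hs => by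
    rw [hden j s hs, hPc, hβv j s hs, hβκ s hs]
    have h1 := hφ0 j s hs
    have h2 := hy0 s hs
    rw [show (c * P (v s) * (q j * v s + p j) / ((φ j s / κ : ℝ) : ℂ) : ℂ)
      = ((c * P (v s) * (q j * v s + p j) / (φ j s / κ) : ℝ) : ℂ) by push_cast; ring]
    congr 1
    field_simp
  have hU : ∀ j, ∀ s ∈ I, c * profile c (v s) * (p j * v s - q j) /
      profileDenom c R (p j) (q j) (d j) (v s) = (α j s / φ j s / y s : ℝ) := fun j s hs => by
    rw [hden j s hs, hPc, hαv j s hs, hβκ s hs]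
    have h1 := hφ0 j s hs
    have h2 := hy0 s hs
    rw [show (c * P (v s) * (p j * v s - q j) / ((φ j s / κ : ℝ) : ℂ) : ℂ)
      = ((c * P (v s) * (p j * v s - q j) / (φ j s / κ) : ℝ) : ℂ) by push_cast; ring]
    congr 1
    field_simp
  refine profile_identities_absurd hc hR0 hR p q d (v ((a + b) / 2)) ?_
  set s₀ := (a + b) / 2 with hs₀
  -- Since v' ≠ 0, the values v(s) differ from v(s₀) for s near s₀, so the identities hold at real
  -- points accumulating at v(s₀).
  have htend : Tendsto (fun s => (v s : ℂ)) (𝓝[≠] s₀) (𝓝[≠] (v s₀ : ℂ)) := by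
    refine tendsto_nhdsWithin_iff.2 ⟨?_, ?_⟩
    · exact ((Complex.continuous_ofReal.tendsto _).comp
        (hv' s₀ hmid).continuousAt.tendsto).mono_left nhdsWithin_le_nhds
    · have hne : -(y s₀ * (1 + v s₀ ^ 2)) ≠ 0 :=
        neg_ne_zero.2 (mul_ne_zero (hy0 _ hmid) (by positivity))
      refine ((hv' s₀ hmid).eventually_ne (c := v s₀) hne).mono fun s hs => ?_
      simpa using hs
  refine htend.frequently (Eventually.frequently ?_)
  refine Filter.eventually_of_mem
    (mem_nhdsWithin_of_mem_nhds (isOpen_Ioo.mem_nhds hmid)) fun s hs => ?_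
  refine ⟨fun j => ?_, ?_, ?_⟩
  · rw [hden j s hs]
    exact_mod_cast div_ne_zero (hφ0 j s hs) hκ0
  · rw [Finset.sum_congr rfl fun j _ => hT j s hs]
    have := htr s hs
    have h2 := hy0 s hs
    norm_cast
    rw [← Finset.sum_div, this]
    field_simp
    norm_num
  · rw [Finset.sum_congr rfl fun j _ => hU j s hs,
      Finset.sum_congr rfl fun j _ => congrArg (· ^ 2) (hT j s hs)]
    have e := hlap s hs
    have h2 := hy0 s hs
    rw [hy2v s hs, hy1v s hs] at e
    norm_cast
    rw [← Finset.sum_div]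
    simp only [div_pow] at e ⊢
    rw [← Finset.sum_div]
    field_simp
    apply mul_left_cancel₀ h2
    linear_combination e

/-! ### Parametrized hypersurfaces -/

section Calculus

variable {V W : Type*} [NormedAddCommGroup V] [NormedSpace ℝ V]
  [NormedAddCommGroup W] [NormedSpace ℝ W]

lemma hasFDerivAt_of_contDiffAt {f : V → W} {u : V} (hf : ContDiffAt ℝ ∞ f u) :
    HasFDerivAt f (fderiv ℝ f u) u :=
  (hf.differentiableAt (by simp)).hasFDerivAt

lemma contDiffAt_fderiv {f : V → W} {u : V} (hf : ContDiffAt ℝ ∞ f u) :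
    ContDiffAt ℝ ∞ (fderiv ℝ f) u :=
  hf.fderiv_right (by simp)

lemma hasFDerivAt_fderiv_of_contDiffAt {f : V → W} {u : V} (hf : ContDiffAt ℝ ∞ f u) :
    HasFDerivAt (fderiv ℝ f) (fderiv ℝ (fderiv ℝ f) u) u :=
  hasFDerivAt_of_contDiffAt (contDiffAt_fderiv hf)

lemma sndFDeriv_comm {f : V → W} {u : V} (hf : ContDiffAt ℝ ∞ f u) (v w : V) :
    fderiv ℝ (fderiv ℝ f) u v w = fderiv ℝ (fderiv ℝ f) u w v :=
  hf.isSymmSndFDerivAt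
    (by rw [minSmoothness_of_isRCLikeNormedField]; exact WithTop.coe_le_coe.2 le_top) v w

end Calculus

/-- `F` is a smooth immersion of the open set `Ω` as a hypersurface, and `N` is a smooth unit
normal field. -/
structure IsLocalHypersurface {n : ℕ} (F N : E n → E (n + 1)) (Ω : Set (E n)) : Prop where
  isOpen : IsOpen Ω
  smooth : ContDiffOn ℝ ∞ F Ω
  smooth_normal : ContDiffOn ℝ ∞ N Ω
  injective : ∀ u ∈ Ω, Function.Injective (fderiv ℝ F u)
  norm_normal : ∀ u ∈ Ω, ‖N u‖ = 1
  orthogonal : ∀ u ∈ Ω, ∀ v, inner ℝ (fderiv ℝ F u v) (N u) = 0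

namespace IsLocalHypersurface

variable {n : ℕ} {F N : E n → E (n + 1)} {Ω : Set (E n)} {u : E n}

lemma mono (H : IsLocalHypersurface F N Ω) {Ω' : Set (E n)} (ho : IsOpen Ω') (h : Ω' ⊆ Ω) :
    IsLocalHypersurface F N Ω' :=
  ⟨ho, H.smooth.mono h, H.smooth_normal.mono h, fun u hu => H.injective u (h hu),
    fun u hu => H.norm_normal u (h hu), fun u hu => H.orthogonal u (h hu)⟩

lemma contDiffAt (H : IsLocalHypersurface F N Ω) (hu : u ∈ Ω) : ContDiffAt ℝ ∞ F u :=
  H.smooth.contDiffAt (H.isOpen.mem_nhds hu)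

lemma contDiffAt_normal (H : IsLocalHypersurface F N Ω) (hu : u ∈ Ω) : ContDiffAt ℝ ∞ N u :=
  H.smooth_normal.contDiffAt (H.isOpen.mem_nhds hu)

/-- The range of the injective differential has dimension n and lies in the orthogonal complement of
the normal, which also has dimension n; so they coincide. -/
lemma exists_fderiv_eq (H : IsLocalHypersurface F N Ω) (hu : u ∈ Ω) {z : E (n + 1)}
    (hz : inner ℝ z (N u) = 0) : ∃ v, fderiv ℝ F u v = z := by
  set L := LinearMap.range (fderiv ℝ F u).toLinearMap with hL
  have hN : N u ≠ 0 := by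
    intro h; have := H.norm_normal u hu; simp [h] at this
  have h1 : Module.finrank ℝ L = n := by
    rw [hL, LinearMap.finrank_range_of_inj (H.injective u hu)]; simp
  have h2 : Module.finrank ℝ (ℝ ∙ N u)ᗮ = n := by
    have := Submodule.finrank_add_finrank_orthogonal (ℝ ∙ N u)
    rw [finrank_span_singleton hN] at this
    simp at this
    omega
  have h3 : L ≤ (ℝ ∙ N u)ᗮ := by
    rintro _ ⟨v, rfl⟩
    rw [Submodule.mem_orthogonal_singleton_iff_inner_left]
    exact H.orthogonal u hu v
  have h4 := Submodule.eq_of_le_of_finrank_eq h3 (h1.trans h2.symm)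
  have : z ∈ L := by
    rw [h4, Submodule.mem_orthogonal_singleton_iff_inner_left]; exact hz
  exact this

lemma eq_zero_of_inner (H : IsLocalHypersurface F N Ω) (hu : u ∈ Ω) {z : E (n + 1)}
    (hz : inner ℝ z (N u) = 0) (h : ∀ v, inner ℝ z (fderiv ℝ F u v) = 0) : z = 0 := by
  obtain ⟨v, rfl⟩ := H.exists_fderiv_eq hu hz
  exact inner_self_eq_zero.1 (h v)

lemma inner_fderiv_normal (H : IsLocalHypersurface F N Ω) (hu : u ∈ Ω) (v : E n) :
    inner ℝ (fderiv ℝ N u v) (N u) = 0 := by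
  have hN := hasFDerivAt_of_contDiffAt (H.contDiffAt_normal hu)
  have h1 := (hN.inner ℝ hN).fderiv
  have h2 : (fun t => inner ℝ (N t) (N t)) =ᶠ[𝓝 u] fun _ => (1 : ℝ) :=
    eventually_of_mem (H.isOpen.mem_nhds hu) fun t ht => by
      simp [H.norm_normal t ht]
  rw [h2.fderiv_eq, fderiv_fun_const] at h1
  have := congrArg (fun L => L v) h1
  simp at this
  have e := real_inner_comm (N u) (fderiv ℝ N u v)
  linarith

/-- The second fundamental form in terms of second derivatives. -/
lemma inner_fderiv_normal_fderiv (H : IsLocalHypersurface F N Ω) (hu : u ∈ Ω) (v w : E n) :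
    inner ℝ (fderiv ℝ N u v) (fderiv ℝ F u w)
      = -inner ℝ (fderiv ℝ (fderiv ℝ F) u v w) (N u) := by
  have hN := hasFDerivAt_of_contDiffAt (H.contDiffAt_normal hu)
  have hF := (hasFDerivAt_fderiv_of_contDiffAt (H.contDiffAt hu)).clm_apply
    (hasFDerivAt_const w u)
  have h1 := (hF.inner ℝ hN).fderiv
  have h2 : (fun t => inner ℝ (fderiv ℝ F t w) (N t)) =ᶠ[𝓝 u] fun _ => (0 : ℝ) :=
    eventually_of_mem (H.isOpen.mem_nhds hu) fun t ht => H.orthogonal t ht w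
  rw [h2.fderiv_eq, fderiv_fun_const] at h1
  have := congrArg (fun L => L v) h1
  simp at this
  rw [real_inner_comm (fderiv ℝ F u w)]
  linarith

lemma inner_fderiv_normal_comm (H : IsLocalHypersurface F N Ω) (hu : u ∈ Ω) (v w : E n) :
    inner ℝ (fderiv ℝ N u v) (fderiv ℝ F u w) = inner ℝ (fderiv ℝ N u w) (fderiv ℝ F u v) := by
  rw [H.inner_fderiv_normal_fderiv hu, H.inner_fderiv_normal_fderiv hu,
    sndFDeriv_comm (H.contDiffAt hu)]

end IsLocalHypersurface

/-! ### The left inverse of an injective linear map -/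

section PseudoInverse

variable {m n : ℕ}

/-- The left inverse `(Lᵀ L)⁻¹ Lᵀ` of an injective linear map `L`. -/
def pinv (L : E n →L[ℝ] E m) : E m →L[ℝ] E n :=
  (L.adjoint ∘L L).inverse ∘L L.adjoint

lemma exists_equiv_gram {L : E n →L[ℝ] E m} (hL : Function.Injective L) :
    ∃ e : E n ≃L[ℝ] E n, (e : E n →L[ℝ] E n) = L.adjoint ∘L L := by
  have hinj : Function.Injective (L.adjoint ∘L L).toLinearMap := by
    refine (injective_iff_map_eq_zero _).2 fun v hv => hL ?_
    have h1 : inner ℝ ((L.adjoint ∘L L) v) v = 0 := by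
      have : (L.adjoint ∘L L) v = 0 := hv
      rw [this, inner_zero_left]
    rw [ContinuousLinearMap.comp_apply, ContinuousLinearMap.adjoint_inner_left,
      inner_self_eq_zero] at h1
    rw [h1, map_zero]
  refine ⟨(LinearEquiv.ofInjectiveEndo _ hinj).toContinuousLinearEquiv, ?_⟩
  ext v
  rfl

lemma pinv_apply_apply {L : E n →L[ℝ] E m} (hL : Function.Injective L) (v : E n) :
    pinv L (L v) = v := by
  obtain ⟨e, he⟩ := exists_equiv_gram hL
  have : pinv L (L v) = (L.adjoint ∘L L).inverse ((L.adjoint ∘L L) v) := rfl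
  rw [this, ← he, ContinuousLinearMap.inverse_equiv]
  simp

/-- Inversion of operators is smooth at an invertible one, and the Gram operator of an injective L
is invertible. This smooth dependence on L is why an explicit left inverse is used rather than a
chosen one. -/
lemma contDiffAt_pinv {L : E n →L[ℝ] E m} (hL : Function.Injective L) :
    ContDiffAt ℝ ∞ (pinv : (E n →L[ℝ] E m) → _) L := by
  obtain ⟨e, he⟩ := exists_equiv_gram hL
  have h1 : ContDiff ℝ ∞ (fun L : E n →L[ℝ] E m => L.adjoint) :=
    (ContinuousLinearMap.adjoint (𝕜 := ℝ) (E := E n) (F := E m)).toContinuousLinearEquiv.contDiff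
  have h2 : ContDiffAt ℝ ∞ (fun L : E n →L[ℝ] E m => L.adjoint ∘L L) L :=
    (h1.clm_comp contDiff_id).contDiffAt
  have h3 : ContDiffAt ℝ ∞ ContinuousLinearMap.inverse (L.adjoint ∘L L) := by
    rw [← he]; exact contDiffAt_map_inverse e
  exact (ContDiffAt.comp (g := ContinuousLinearMap.inverse)
    (f := fun L : E n →L[ℝ] E m => L.adjoint ∘L L) L h3 h2).clm_comp h1.contDiffAt

end PseudoInverse

namespace IsLocalHypersurface

variable {n : ℕ} {F N : E n → E (n + 1)} {Ω : Set (E n)} {u : E n}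

lemma fderiv_pinv (H : IsLocalHypersurface F N Ω) (hu : u ∈ Ω) {z : E (n + 1)}
    (hz : inner ℝ z (N u) = 0) : fderiv ℝ F u (pinv (fderiv ℝ F u) z) = z := by
  obtain ⟨v, rfl⟩ := H.exists_fderiv_eq hu hz
  rw [pinv_apply_apply (H.injective u hu)]

lemma contDiffAt_pinv_fderiv (H : IsLocalHypersurface F N Ω) (hu : u ∈ Ω) :
    ContDiffAt ℝ ∞ (fun u => pinv (fderiv ℝ F u)) u :=
  ContDiffAt.comp u (contDiffAt_pinv (H.injective u hu)) (contDiffAt_fderiv (H.contDiffAt hu))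

/-- The shape operator of a parametrized hypersurface, as an endomorphism of the parameter
space. -/
def _root_.DeltaIdeal.localShape (F N : E n → E (n + 1)) (u : E n) : E n →L[ℝ] E n :=
  -(pinv (fderiv ℝ F u) ∘L fderiv ℝ N u)

lemma fderiv_localShape (H : IsLocalHypersurface F N Ω) (hu : u ∈ Ω) (v : E n) :
    fderiv ℝ F u (localShape F N u v) = -fderiv ℝ N u v := by
  simp [localShape, H.fderiv_pinv hu (H.inner_fderiv_normal hu v)]

lemma contDiffAt_localShape (H : IsLocalHypersurface F N Ω) (hu : u ∈ Ω) :
    ContDiffAt ℝ ∞ (localShape F N) u :=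
  ((H.contDiffAt_pinv_fderiv hu).clm_comp (contDiffAt_fderiv (H.contDiffAt_normal hu))).neg

end IsLocalHypersurface

/-! ### Hypersurfaces on which the gradient of a principal curvature is principal -/

/-- The vector field along `F` with components `X`. -/
def push {n : ℕ} (F : E n → E (n + 1)) (X : E n → E n) (u : E n) : E (n + 1) :=
  fderiv ℝ F u (X u)

/-- The gradient of the smooth function `y` is the nonzero multiple `η` of the unit vector field
`X`, which is principal with principal curvature `y`. -/
structure IsGradientFrame {n : ℕ} (F N : E n → E (n + 1)) (X : E n → E n) (y η : E n → ℝ)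
    (Ω : Set (E n)) : Prop extends IsLocalHypersurface F N Ω where
  smooth_field : ContDiffOn ℝ ∞ X Ω
  smooth_curvature : ContDiffOn ℝ ∞ y Ω
  smooth_slope : ContDiffOn ℝ ∞ η Ω
  norm_push : ∀ u ∈ Ω, ‖push F X u‖ = 1
  fderiv_curvature : ∀ u ∈ Ω, ∀ v, fderiv ℝ y u v = η u * inner ℝ (push F X u) (fderiv ℝ F u v)
  slope_ne_zero : ∀ u ∈ Ω, η u ≠ 0
  principal : ∀ u ∈ Ω, fderiv ℝ N u (X u) = -(y u • push F X u)

namespace IsGradientFrame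

variable {n : ℕ} {F N : E n → E (n + 1)} {X : E n → E n} {y η : E n → ℝ} {Ω : Set (E n)} {u : E n}

lemma mono (H : IsGradientFrame F N X y η Ω) {Ω' : Set (E n)} (ho : IsOpen Ω') (h : Ω' ⊆ Ω) :
    IsGradientFrame F N X y η Ω' :=
  ⟨H.toIsLocalHypersurface.mono ho h, H.smooth_field.mono h, H.smooth_curvature.mono h,
    H.smooth_slope.mono h, fun u hu => H.norm_push u (h hu),
    fun u hu => H.fderiv_curvature u (h hu), fun u hu => H.slope_ne_zero u (h hu),
    fun u hu => H.principal u (h hu)⟩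

lemma contDiffAt_field (H : IsGradientFrame F N X y η Ω) (hu : u ∈ Ω) : ContDiffAt ℝ ∞ X u :=
  H.smooth_field.contDiffAt (H.isOpen.mem_nhds hu)

lemma contDiffAt_curvature (H : IsGradientFrame F N X y η Ω) (hu : u ∈ Ω) :
    ContDiffAt ℝ ∞ y u :=
  H.smooth_curvature.contDiffAt (H.isOpen.mem_nhds hu)

lemma contDiffAt_slope (H : IsGradientFrame F N X y η Ω) (hu : u ∈ Ω) : ContDiffAt ℝ ∞ η u :=
  H.smooth_slope.contDiffAt (H.isOpen.mem_nhds hu)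

lemma contDiffAt_push (H : IsGradientFrame F N X y η Ω) (hu : u ∈ Ω) :
    ContDiffAt ℝ ∞ (push F X) u :=
  (contDiffAt_fderiv (H.contDiffAt hu)).clm_apply (H.contDiffAt_field hu)

lemma fderiv_push (H : IsGradientFrame F N X y η Ω) (hu : u ∈ Ω) (w : E n) :
    fderiv ℝ (push F X) u w
      = fderiv ℝ (fderiv ℝ F) u w (X u) + fderiv ℝ F u (fderiv ℝ X u w) := by
  have h := (hasFDerivAt_fderiv_of_contDiffAt (H.contDiffAt hu)).clm_apply
    (hasFDerivAt_of_contDiffAt (H.contDiffAt_field hu))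
  rw [show push F X = fun u => fderiv ℝ F u (X u) from rfl, h.fderiv]
  simp [add_comm]

lemma sndFDeriv_normal (H : IsGradientFrame F N X y η Ω) (hu : u ∈ Ω) (w : E n) :
    fderiv ℝ (fderiv ℝ N) u w (X u) + fderiv ℝ N u (fderiv ℝ X u w)
      = -(fderiv ℝ y u w • push F X u + y u • fderiv ℝ (push F X) u w) := by
  have h := ((hasFDerivAt_fderiv_of_contDiffAt (H.contDiffAt_normal hu)).clm_apply
    (hasFDerivAt_of_contDiffAt (H.contDiffAt_field hu))).fderiv
  have h2 : (fun u => fderiv ℝ N u (X u)) =ᶠ[𝓝 u] fun u => -(y u • push F X u) :=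
    eventually_of_mem (H.isOpen.mem_nhds hu) fun t ht => H.principal t ht
  have h3 := (((hasFDerivAt_of_contDiffAt (H.contDiffAt_curvature hu)).smul
    (hasFDerivAt_of_contDiffAt (H.contDiffAt_push hu))).neg).fderiv
  rw [h2.fderiv_eq] at h
  have := congrArg (fun L => L w) (h.symm.trans h3)
  simp at this
  rw [add_comm (fderiv ℝ (fderiv ℝ N) u w (X u)), this]
  abel

lemma inner_push_self (H : IsGradientFrame F N X y η Ω) (hu : u ∈ Ω) :
    inner ℝ (push F X u) (push F X u) = 1 := by
  rw [real_inner_self_eq_norm_sq, H.norm_push u hu, one_pow]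

lemma inner_fderiv_push_push (H : IsGradientFrame F N X y η Ω) (hu : u ∈ Ω) (w : E n) :
    inner ℝ (fderiv ℝ (push F X) u w) (push F X u) = 0 := by
  have hE := hasFDerivAt_of_contDiffAt (H.contDiffAt_push hu)
  have h1 := (hE.inner ℝ hE).fderiv
  have h2 : (fun t => inner ℝ (push F X t) (push F X t)) =ᶠ[𝓝 u] fun _ => (1 : ℝ) :=
    eventually_of_mem (H.isOpen.mem_nhds hu) fun t ht => H.inner_push_self ht
  rw [h2.fderiv_eq, fderiv_fun_const] at h1
  have := congrArg (fun L => L w) h1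
  simp at this
  have e := real_inner_comm (push F X u) (fderiv ℝ (push F X) u w)
  linarith

lemma inner_push_normal (H : IsGradientFrame F N X y η Ω) (hu : u ∈ Ω) :
    inner ℝ (push F X u) (N u) = 0 := H.orthogonal u hu _

lemma inner_fderiv_normal_push (H : IsGradientFrame F N X y η Ω) (hu : u ∈ Ω) (v : E n) :
    inner ℝ (fderiv ℝ N u v) (push F X u) = -(y u * inner ℝ (push F X u) (fderiv ℝ F u v)) := by
  rw [push, H.inner_fderiv_normal_comm hu, H.principal u hu, inner_neg_left, real_inner_smul_left]
  rfl

lemma inner_fderiv_push_normal (H : IsGradientFrame F N X y η Ω) (hu : u ∈ Ω) (w : E n) :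
    inner ℝ (fderiv ℝ (push F X) u w) (N u)
      = y u * inner ℝ (push F X u) (fderiv ℝ F u w) := by
  have hE := hasFDerivAt_of_contDiffAt (H.contDiffAt_push hu)
  have hN := hasFDerivAt_of_contDiffAt (H.contDiffAt_normal hu)
  have h1 := (hE.inner ℝ hN).fderiv
  have h2 : (fun t => inner ℝ (push F X t) (N t)) =ᶠ[𝓝 u] fun _ => (0 : ℝ) :=
    eventually_of_mem (H.isOpen.mem_nhds hu) fun t ht => H.inner_push_normal ht
  rw [h2.fderiv_eq, fderiv_fun_const] at h1
  have := congrArg (fun L => L w) h1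
  simp at this
  have e := real_inner_comm (push F X u) (fderiv ℝ N u w)
  have e2 := H.inner_fderiv_normal_push hu w
  linarith

lemma sndFDeriv_curvature (H : IsGradientFrame F N X y η Ω) (hu : u ∈ Ω) (w v : E n) :
    fderiv ℝ (fderiv ℝ y) u w v = fderiv ℝ η u w * inner ℝ (push F X u) (fderiv ℝ F u v)
      + η u * (inner ℝ (fderiv ℝ (push F X) u w) (fderiv ℝ F u v)
        + inner ℝ (push F X u) (fderiv ℝ (fderiv ℝ F) u w v)) := by
  have hy := ((hasFDerivAt_fderiv_of_contDiffAt (H.contDiffAt_curvature hu)).clm_apply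
    (hasFDerivAt_const v u)).fderiv
  have hF := (hasFDerivAt_fderiv_of_contDiffAt (H.contDiffAt hu)).clm_apply
    (hasFDerivAt_const v u)
  have h1 := ((hasFDerivAt_of_contDiffAt (H.contDiffAt_slope hu)).mul
    ((hasFDerivAt_of_contDiffAt (H.contDiffAt_push hu)).inner ℝ hF)).fderiv
  have h2 : (fun u => fderiv ℝ y u v)
      =ᶠ[𝓝 u] fun u => η u * inner ℝ (push F X u) (fderiv ℝ F u v) :=
    eventually_of_mem (H.isOpen.mem_nhds hu) fun t ht => H.fderiv_curvature t ht v
  rw [h2.fderiv_eq] at hy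
  have := congrArg (fun L => L w) (hy.symm.trans h1)
  simp at this
  rw [this]
  ring

/-- The covariant derivative of the field is symmetric on its orthogonal complement. -/
lemma inner_fderiv_push_comm (H : IsGradientFrame F N X y η Ω) (hu : u ∈ Ω) {v w : E n}
    (hv : inner ℝ (push F X u) (fderiv ℝ F u v) = 0)
    (hw : inner ℝ (push F X u) (fderiv ℝ F u w) = 0) :
    inner ℝ (fderiv ℝ (push F X) u v) (fderiv ℝ F u w)
      = inner ℝ (fderiv ℝ (push F X) u w) (fderiv ℝ F u v) := by
  -- The second derivative of y is symmetric. For v and w orthogonal to the field its formula leaves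
  -- η times the covariant derivative, plus a term that is already symmetric.
  have h1 := H.sndFDeriv_curvature hu v w
  have h2 := H.sndFDeriv_curvature hu w v
  rw [sndFDeriv_comm (H.contDiffAt_curvature hu), h2, sndFDeriv_comm (H.contDiffAt hu) w v,
    hv, hw] at h1
  apply mul_left_cancel₀ (H.slope_ne_zero u hu)
  linarith

/-- The consequence of the Codazzi equation in the direction of the field. -/
lemma inner_shape_fderiv_push_field (H : IsGradientFrame F N X y η Ω) (hu : u ∈ Ω) {w : E n}
    (hw : inner ℝ (push F X u) (fderiv ℝ F u w) = 0) :
    inner ℝ (fderiv ℝ N u w + y u • fderiv ℝ F u w) (fderiv ℝ (push F X) u (X u)) = 0 := by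
  have hyw : fderiv ℝ y u w = 0 := by rw [H.fderiv_curvature u hu, hw, mul_zero]
  have hNw := (hasFDerivAt_fderiv_of_contDiffAt (H.contDiffAt_normal hu)).clm_apply
    (hasFDerivAt_const w u)
  have hFw := (hasFDerivAt_fderiv_of_contDiffAt (H.contDiffAt hu)).clm_apply
    (hasFDerivAt_const w u)
  have hE := hasFDerivAt_of_contDiffAt (H.contDiffAt_push hu)
  have hy := hasFDerivAt_of_contDiffAt (H.contDiffAt_curvature hu)
  have h1 := (hNw.inner ℝ hE).fderiv
  have h3 := (hy.mul (hE.inner ℝ hFw)).neg.fderiv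
  -- The Codazzi argument: the derivative along X of this identity is compared with the derivative
  -- in the direction w of dN(X) = -y push F X. Symmetry of second derivatives identifies the
  -- leading terms, and y does not change in the direction w.
  have h2 : (fun u => inner ℝ (fderiv ℝ N u w) (push F X u))
      =ᶠ[𝓝 u] fun u => -(y u * inner ℝ (push F X u) (fderiv ℝ F u w)) :=
    eventually_of_mem (H.isOpen.mem_nhds hu) fun t ht => H.inner_fderiv_normal_push ht w
  rw [h2.fderiv_eq] at h1
  have key := congrArg (fun L => L (X u)) (h1.symm.trans h3)
  simp [hw] at key
  have e1 := congrArg (fun z => inner ℝ z (push F X u)) (H.sndFDeriv_normal hu w)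
  have e2 := congrArg (fun z => inner ℝ z (push F X u)) (H.fderiv_push hu w)
  simp only [inner_add_left, inner_neg_left, real_inner_smul_left, hyw, zero_mul,
    H.inner_fderiv_push_push hu, H.inner_fderiv_normal_push hu] at e1 e2
  rw [sndFDeriv_comm (H.contDiffAt_normal hu)] at e1
  rw [sndFDeriv_comm (H.contDiffAt hu)] at e2
  rw [inner_add_left, real_inner_smul_left]
  have c1 := real_inner_comm (push F X u) (fderiv ℝ F u (fderiv ℝ X u w))
  have c2 := real_inner_comm (push F X u) (fderiv ℝ (fderiv ℝ F) u (X u) w)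
  have c3 := real_inner_comm (fderiv ℝ (push F X) u (X u)) (fderiv ℝ F u w)
  linear_combination key - e1 + y u * (e2 + c1 + c2 + c3)

/-- The principal curvature `y` has multiplicity one at `u`. -/
def IsSimpleAt (F N : E n → E (n + 1)) (X : E n → E n) (y : E n → ℝ) (u : E n) : Prop :=
  ∀ z, inner ℝ (push F X u) (fderiv ℝ F u z) = 0 →
    fderiv ℝ N u z = -(y u • fderiv ℝ F u z) → z = 0

/-- Integral curves of the field are geodesics, at points where `y` has multiplicity one. -/
lemma fderiv_push_field (H : IsGradientFrame F N X y η Ω) (hu : u ∈ Ω)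
    (hs : IsSimpleAt F N X y u) :
    fderiv ℝ (push F X) u (X u) = y u • N u := by
  have hNN : inner ℝ (N u) (N u) = 1 := by
    rw [real_inner_self_eq_norm_sq, H.norm_normal u hu, one_pow]
  have h1 : inner ℝ (fderiv ℝ (push F X) u (X u) - y u • N u) (N u) = 0 := by
    rw [inner_sub_left, H.inner_fderiv_push_normal hu, real_inner_smul_left, hNN,
      show fderiv ℝ F u (X u) = push F X u from rfl, H.inner_push_self hu, sub_self]
  -- z is the tangential acceleration of the integral curve. It is orthogonal to the field, and the
  -- previous lemma puts it in the kernel of A - y, so multiplicity one makes it vanish.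
  obtain ⟨z, hz⟩ := H.exists_fderiv_eq hu h1
  have hzE : inner ℝ (push F X u) (fderiv ℝ F u z) = 0 := by
    rw [hz, inner_sub_right, real_inner_comm, H.inner_fderiv_push_push hu,
      real_inner_smul_right, H.inner_push_normal hu, mul_zero, sub_zero]
  have h2 : ∀ w, inner ℝ (push F X u) (fderiv ℝ F u w) = 0 →
      inner ℝ (fderiv ℝ N u z + y u • fderiv ℝ F u z) (fderiv ℝ F u w) = 0 := by
    intro w hw
    have h3 := H.inner_shape_fderiv_push_field hu hw
    have h4 : fderiv ℝ (push F X) u (X u) = fderiv ℝ F u z + y u • N u := by rw [hz]; abel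
    rw [h4, inner_add_right, real_inner_smul_right, inner_add_left, inner_add_left,
      real_inner_smul_left, real_inner_smul_left, H.inner_fderiv_normal hu,
      H.orthogonal u hu, H.inner_fderiv_normal_comm hu] at h3
    rw [inner_add_left, real_inner_smul_left, real_inner_comm (fderiv ℝ F u w) (fderiv ℝ F u z)]
    linarith
  have h5 : fderiv ℝ N u z + y u • fderiv ℝ F u z = 0 := by
    refine H.eq_zero_of_inner hu ?_ fun w => ?_
    · rw [inner_add_left, H.inner_fderiv_normal hu, real_inner_smul_left, H.orthogonal u hu]
      ring
    · have h6 : fderiv ℝ F u w = fderiv ℝ F u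
          (w - inner ℝ (push F X u) (fderiv ℝ F u w) • X u)
            + inner ℝ (push F X u) (fderiv ℝ F u w) • push F X u := by
        simp [push]
      rw [h6, inner_add_right, h2, real_inner_smul_right, inner_add_left,
        H.inner_fderiv_normal_push hu, real_inner_smul_left, hzE,
        real_inner_comm (push F X u) (fderiv ℝ F u z), hzE]
      · ring
      · rw [map_sub, map_smul, inner_sub_right, real_inner_smul_right,
          show fderiv ℝ F u (X u) = push F X u from rfl, H.inner_push_self hu]
        ring
  have h6 := hs z hzE (eq_neg_of_add_eq_zero_left h5)
  rw [h6, map_zero] at hz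
  exact (sub_eq_zero.1 hz.symm)

/-- The symmetric operator whose kernel consists of the vectors orthogonal to the field that are
principal with principal curvature `y`. -/
def simpleOp (F N : E n → E (n + 1)) (X : E n → E n) (y : E n → ℝ) (u : E n) : E n →L[ℝ] E n :=
  (fderiv ℝ F u).adjoint ∘L (fderiv ℝ N u + y u • fderiv ℝ F u)
    + (innerSL ℝ ((fderiv ℝ F u).adjoint (push F X u))).smulRight
      ((fderiv ℝ F u).adjoint (push F X u))

lemma inner_simpleOp (v w : E n) : inner ℝ (simpleOp F N X y u v) w
    = inner ℝ (fderiv ℝ N u v + y u • fderiv ℝ F u v) (fderiv ℝ F u w)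
      + inner ℝ (push F X u) (fderiv ℝ F u v) * inner ℝ (push F X u) (fderiv ℝ F u w) := by
  simp only [simpleOp, add_apply, ContinuousLinearMap.comp_apply,
    ContinuousLinearMap.smulRight_apply, inner_add_left, ContinuousLinearMap.adjoint_inner_left,
    innerSL_apply_apply, real_inner_smul_left, smul_apply]

lemma contDiffAt_simpleOp (H : IsGradientFrame F N X y η Ω) (hu : u ∈ Ω) :
    ContDiffAt ℝ ∞ (simpleOp F N X y) u := by
  have h1 : ContDiff ℝ ∞ (fun L : E n →L[ℝ] E (n + 1) => L.adjoint) :=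
    (ContinuousLinearMap.adjoint (𝕜 := ℝ) (E := E n)
      (F := E (n + 1))).toContinuousLinearEquiv.contDiff
  have hF := contDiffAt_fderiv (H.contDiffAt hu)
  have hA : ContDiffAt ℝ ∞ (fun u => (fderiv ℝ F u).adjoint) u := h1.contDiffAt.comp u hF
  have hE : ContDiffAt ℝ ∞ (fun u => (fderiv ℝ F u).adjoint (push F X u)) u :=
    hA.clm_apply (H.contDiffAt_push hu)
  refine (hA.clm_comp ((contDiffAt_fderiv (H.contDiffAt_normal hu)).add
    ((H.contDiffAt_curvature hu).smul hF))).add ?_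
  exact (((innerSL ℝ).contDiff.contDiffAt (𝕜 := ℝ)).comp u hE).smulRight hE

/-- Testing a kernel vector against X cancels the first summand of `simpleOp`, as X is principal,
and so forces orthogonality to X; what remains is the eigenvector equation. Multiplicity one thereby
becomes injectivity of a smooth family of operators, an open condition. -/
lemma isSimpleAt_iff (H : IsGradientFrame F N X y η Ω) (hu : u ∈ Ω) :
    IsSimpleAt F N X y u ↔ Function.Injective (simpleOp F N X y u) := by
  have hX := H.inner_push_self hu
  constructor
  · intro hs
    refine (injective_iff_map_eq_zero _).2 fun z hz => ?_
    have h1 : ∀ w, inner ℝ (simpleOp F N X y u z) w = 0 := fun w => by simp [hz]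
    simp only [inner_simpleOp] at h1
    have h2 : inner ℝ (push F X u) (fderiv ℝ F u z) = 0 := by
      have := h1 (X u)
      rw [show fderiv ℝ F u (X u) = push F X u from rfl, hX, inner_add_left,
        H.inner_fderiv_normal_push hu, real_inner_smul_left,
        real_inner_comm (push F X u) (fderiv ℝ F u z)] at this
      linarith
    refine hs z h2 (eq_neg_of_add_eq_zero_left (H.eq_zero_of_inner hu ?_ fun w => ?_))
    · rw [inner_add_left, H.inner_fderiv_normal hu, real_inner_smul_left, H.orthogonal u hu]
      ring
    · have := h1 w
      rwa [h2, zero_mul, add_zero] at this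
  · intro hs z hz1 hz2
    refine hs ?_
    rw [map_zero]
    refine ext_inner_right ℝ fun w => ?_
    rw [inner_simpleOp, hz1, hz2, inner_zero_left]
    simp

lemma simpleOp_symmetric (H : IsGradientFrame F N X y η Ω) (hu : u ∈ Ω) (v w : E n) :
    inner ℝ (simpleOp F N X y u v) w = inner ℝ v (simpleOp F N X y u w) := by
  rw [real_inner_comm _ v, inner_simpleOp, inner_simpleOp, inner_add_left, inner_add_left,
    H.inner_fderiv_normal_comm hu, real_inner_smul_left, real_inner_smul_left,
    real_inner_comm (fderiv ℝ F u v) (fderiv ℝ F u w)]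
  ring

/-- On the kernel of `simpleOp`, its derivative along the field is a nonzero multiple of the
metric. -/
lemma inner_fderiv_simpleOp (H : IsGradientFrame F N X y η Ω) (hu : u ∈ Ω) {w : E n}
    (hw : simpleOp F N X y u w = 0) :
    inner ℝ (fderiv ℝ (simpleOp F N X y) u (X u) w) w
      = η u * inner ℝ (fderiv ℝ F u w) (fderiv ℝ F u w) := by
  have hX := H.inner_push_self hu
  have h1 : ∀ v, inner ℝ (simpleOp F N X y u w) v = 0 := fun v => by simp [hw]
  simp only [inner_simpleOp] at h1
  have hwE : inner ℝ (push F X u) (fderiv ℝ F u w) = 0 := by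
    have := h1 (X u)
    rw [show fderiv ℝ F u (X u) = push F X u from rfl, hX, inner_add_left,
      H.inner_fderiv_normal_push hu, real_inner_smul_left,
      real_inner_comm (push F X u) (fderiv ℝ F u w)] at this
    linarith
  have hNw : fderiv ℝ N u w + y u • fderiv ℝ F u w = 0 := by
    refine H.eq_zero_of_inner hu ?_ fun v => ?_
    · rw [inner_add_left, H.inner_fderiv_normal hu, real_inner_smul_left, H.orthogonal u hu]
      ring
    · have := h1 v
      rwa [hwE, zero_mul, add_zero] at this
  have hyX : fderiv ℝ y u (X u) = η u := by
    rw [H.fderiv_curvature u hu, show fderiv ℝ F u (X u) = push F X u from rfl, hX, mul_one]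
  have hyw : fderiv ℝ y u w = 0 := by rw [H.fderiv_curvature u hu, hwE, mul_zero]
  have hS := (((hasFDerivAt_of_contDiffAt (H.contDiffAt_simpleOp hu)).clm_apply
    (hasFDerivAt_const w u)).inner ℝ (hasFDerivAt_const w u)).fderiv
  have hN' := (hasFDerivAt_fderiv_of_contDiffAt (H.contDiffAt_normal hu)).clm_apply
    (hasFDerivAt_const w u)
  have hF' := (hasFDerivAt_fderiv_of_contDiffAt (H.contDiffAt hu)).clm_apply
    (hasFDerivAt_const w u)
  have hE' := hasFDerivAt_of_contDiffAt (H.contDiffAt_push hu)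
  have hy' := hasFDerivAt_of_contDiffAt (H.contDiffAt_curvature hu)
  have hR := (((hN'.add (hy'.smul hF')).inner ℝ hF').add
    ((hE'.inner ℝ hF').mul (hE'.inner ℝ hF'))).fderiv
  have e0 : (fun u => inner ℝ (simpleOp F N X y u w) w) = fun u =>
      inner ℝ (fderiv ℝ N u w + y u • fderiv ℝ F u w) (fderiv ℝ F u w)
      + inner ℝ (push F X u) (fderiv ℝ F u w) * inner ℝ (push F X u) (fderiv ℝ F u w) := by
    funext u; exact inner_simpleOp w w
  rw [e0] at hS
  have key := congrArg (fun L => L (X u)) (hS.symm.trans hR)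
  simp [hwE, hNw, hyX] at key
  rw [key]
  -- The rank-one summand is a square vanishing on the kernel, so it has zero derivative. In the
  -- rest, Codazzi replaces the derivative of dN along X by one in the direction w, everything
  -- cancels on an eigenvector, and only the derivative η of y along X is left.
  have e1 := congrArg (fun z => inner ℝ z (fderiv ℝ F u w)) (H.sndFDeriv_normal hu w)
  have e2 := congrArg (fun z => inner ℝ z (fderiv ℝ F u w)) (H.fderiv_push hu w)
  have e3 : fderiv ℝ N u w = -(y u • fderiv ℝ F u w) := eq_neg_of_add_eq_zero_left hNw
  have e4 := H.inner_fderiv_normal_comm hu (fderiv ℝ X u w) w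
  rw [e3] at e4
  simp only [inner_add_left, inner_neg_left, real_inner_smul_left, hyw, zero_mul] at e1 e2 e4
  rw [sndFDeriv_comm (H.contDiffAt_normal hu)] at e1
  rw [sndFDeriv_comm (H.contDiffAt hu)] at e2
  have c1 := real_inner_comm (fderiv ℝ F u w) (fderiv ℝ F u (fderiv ℝ X u w))
  simp only [inner_add_left, real_inner_smul_left]
  linear_combination e1 - e4 - y u * e2 - y u * c1

end IsGradientFrame

/-- If the derivative of a family of symmetric operators is nondegenerate on the kernel, then
nearby members of the family are injective. -/
lemma eventually_injective_of_hasDerivAt {n : ℕ} {S : ℝ → E n →L[ℝ] E n} {S' : E n →L[ℝ] E n}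
    (hS : HasDerivAt S S' 0) (hsym : ∀ v w, inner ℝ (S 0 v) w = inner ℝ v (S 0 w))
    (hker : ∀ v, S 0 v = 0 → inner ℝ (S' v) v = 0 → v = 0) :
    ∀ᶠ t in 𝓝[≠] (0 : ℝ), Function.Injective (S t) := by
  by_contra hcon
  rw [not_eventually] at hcon
  have hcon' : ∃ᶠ t in 𝓝[≠] (0 : ℝ), ∃ v : E n, ‖v‖ = 1 ∧ S t v = 0 := by
    refine hcon.mono fun t ht => ?_
    rw [injective_iff_map_eq_zero] at ht
    push Not at ht
    obtain ⟨v, hv, hv0⟩ := ht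
    refine ⟨‖v‖⁻¹ • v, ?_, by rw [map_smul, hv, smul_zero]⟩
    rw [norm_smul, norm_inv, norm_norm, inv_mul_cancel₀ (norm_ne_zero_iff.2 hv0)]
  obtain ⟨t, ht, hp⟩ := exists_seq_forall_of_frequently hcon'
  choose v hv1 hv0 using hp
  -- Unit kernel vectors at parameters tending to 0 subconverge to a unit vector z in the kernel of
  -- S 0. By symmetry of S 0 the difference quotients applied to these vectors are orthogonal to z,
  -- so S' is degenerate on z, against the hypothesis.
  obtain ⟨z, hz, φ, hφ, hlim⟩ := (isCompact_sphere (0 : E n) 1).tendsto_subseq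
    (fun k => show v k ∈ Metric.sphere (0 : E n) 1 by simp [hv1])
  have htφ := ht.comp hφ.tendsto_atTop
  have hS0 : S 0 z = 0 := by
    have h1 : Tendsto (fun k => S (t (φ k)) (v (φ k))) atTop (𝓝 (S 0 z)) :=
      (isBoundedBilinearMap_apply.continuous.tendsto (S 0, z)).comp ((hS.continuousAt.tendsto.comp
        (htφ.mono_right nhdsWithin_le_nhds)).prodMk_nhds hlim)
    refine tendsto_nhds_unique h1 ?_
    simp [hv0]
  have h2 : Tendsto (fun k => inner ℝ (slope S 0 (t (φ k)) (v (φ k))) z) atTop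
      (𝓝 (inner ℝ (S' z) z)) :=
    ((isBoundedBilinearMap_apply.continuous.tendsto (S', z)).comp
      (((hasDerivAt_iff_tendsto_slope.1 hS).comp htφ).prodMk_nhds hlim)).inner tendsto_const_nhds
  have h3 : ∀ k, inner ℝ (slope S 0 (t (φ k)) (v (φ k))) z = 0 := fun k => by
    simp [slope_def_module, hv0, hsym, hS0, real_inner_smul_left]
  simp only [h3] at h2
  have h4 := hker z hS0 (tendsto_nhds_unique h2 tendsto_const_nhds)
  rw [h4] at hz
  simp at hz

/-- Near every point there are points with a neighbourhood on which the principal curvature `y`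
has multiplicity one. -/
lemma IsGradientFrame.exists_simple {n : ℕ} {F N : E n → E (n + 1)} {X : E n → E n}
    {y η : E n → ℝ} {Ω : Set (E n)} (H : IsGradientFrame F N X y η Ω) (hne : Ω.Nonempty) :
    ∃ Ω' ⊆ Ω, IsOpen Ω' ∧ Ω'.Nonempty ∧ ∀ u ∈ Ω', IsSimpleAt F N X y u := by
  obtain ⟨u, hu⟩ := hne
  have hcont : ContinuousOn (simpleOp F N X y) Ω := fun t ht =>
    (H.contDiffAt_simpleOp ht).continuousAt.continuousWithinAt
  -- A straight line in the direction X u suffices: the first derivative of `simpleOp` in that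
  -- direction is η times the metric on the kernel, which is definite.
  have hline : HasDerivAt (fun t : ℝ => u + t • X u) (X u) 0 := by
    simpa using ((hasDerivAt_id (0 : ℝ)).smul_const (X u)).const_add u
  have h1 : HasDerivAt (fun t : ℝ => simpleOp F N X y (u + t • X u))
      (fderiv ℝ (simpleOp F N X y) u (X u)) 0 := by
    have h := hasFDerivAt_of_contDiffAt (H.contDiffAt_simpleOp hu)
    refine HasFDerivAt.comp_hasDerivAt (0 : ℝ) (l := simpleOp F N X y) ?_ hline
    simpa using h
  have h2 := eventually_injective_of_hasDerivAt h1
    (by simpa using H.simpleOp_symmetric hu) (fun v hv hv' => by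
      simp only [zero_smul, add_zero] at hv
      rw [H.inner_fderiv_simpleOp hu hv] at hv'
      have := (mul_eq_zero.1 hv').resolve_left (H.slope_ne_zero u hu)
      rw [inner_self_eq_zero] at this
      exact H.injective u hu (by rw [this, map_zero]))
  have h3 : ∀ᶠ t in 𝓝[≠] (0 : ℝ), u + t • X u ∈ Ω := by
    refine (hline.continuousAt.tendsto.mono_left nhdsWithin_le_nhds).eventually ?_
    simpa using H.isOpen.mem_nhds hu
  obtain ⟨t, ht1, ht2⟩ := (h2.and h3).exists
  refine ⟨Ω ∩ simpleOp F N X y ⁻¹' {L | Function.Injective L}, Set.inter_subset_left,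
    hcont.isOpen_inter_preimage H.isOpen ContinuousLinearMap.isOpen_injective,
    ⟨_, ht2, ht1⟩, fun v hv => (H.isSimpleAt_iff hv.1).2 hv.2⟩

/-! ### Shape operator and derivative of the field as operators of the ambient space -/

namespace IsGradientFrame

variable {n : ℕ} {F N : E n → E (n + 1)} {X : E n → E n} {y η : E n → ℝ} {Ω : Set (E n)} {u : E n}

/-- The shape operator as an operator on the ambient space. -/
def ambShape (F N : E n → E (n + 1)) (u : E n) : E (n + 1) →L[ℝ] E (n + 1) :=
  -(fderiv ℝ N u ∘L pinv (fderiv ℝ F u))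

/-- The derivative of the field `push F X`, as an operator on the ambient space. -/
def ambHess (F : E n → E (n + 1)) (X : E n → E n) (u : E n) : E (n + 1) →L[ℝ] E (n + 1) :=
  fderiv ℝ (push F X) u ∘L pinv (fderiv ℝ F u)

/-- `w` is orthogonal to the field and to the normal at `u`. -/
def IsHorizontal (F N : E n → E (n + 1)) (X : E n → E n) (u : E n) (w : E (n + 1)) : Prop :=
  inner ℝ (push F X u) w = 0 ∧ inner ℝ w (N u) = 0

lemma ambShape_fderiv (H : IsGradientFrame F N X y η Ω) (hu : u ∈ Ω) (v : E n) :
    ambShape F N u (fderiv ℝ F u v) = -fderiv ℝ N u v := by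
  simp [ambShape, pinv_apply_apply (H.injective u hu)]

lemma ambHess_fderiv (H : IsGradientFrame F N X y η Ω) (hu : u ∈ Ω) (v : E n) :
    ambHess F X u (fderiv ℝ F u v) = fderiv ℝ (push F X) u v := by
  simp [ambHess, pinv_apply_apply (H.injective u hu)]

lemma isHorizontal_ambShape (H : IsGradientFrame F N X y η Ω) (hu : u ∈ Ω) {w : E (n + 1)}
    (hw : IsHorizontal F N X u w) : IsHorizontal F N X u (ambShape F N u w) := by
  obtain ⟨v, rfl⟩ := H.exists_fderiv_eq hu hw.2
  rw [H.ambShape_fderiv hu]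
  refine ⟨?_, ?_⟩
  · rw [inner_neg_right, real_inner_comm, H.inner_fderiv_normal_push hu, hw.1]
    simp
  · rw [inner_neg_left, H.inner_fderiv_normal hu, neg_zero]

lemma isHorizontal_ambHess (H : IsGradientFrame F N X y η Ω) (hu : u ∈ Ω) {w : E (n + 1)}
    (hw : IsHorizontal F N X u w) : IsHorizontal F N X u (ambHess F X u w) := by
  obtain ⟨v, rfl⟩ := H.exists_fderiv_eq hu hw.2
  rw [H.ambHess_fderiv hu]
  refine ⟨?_, ?_⟩
  · rw [real_inner_comm, H.inner_fderiv_push_push hu]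
  · rw [H.inner_fderiv_push_normal hu, hw.1, mul_zero]

lemma inner_ambShape_comm (H : IsGradientFrame F N X y η Ω) (hu : u ∈ Ω) {w w' : E (n + 1)}
    (hw : IsHorizontal F N X u w) (hw' : IsHorizontal F N X u w') :
    inner ℝ (ambShape F N u w) w' = inner ℝ w (ambShape F N u w') := by
  obtain ⟨v, rfl⟩ := H.exists_fderiv_eq hu hw.2
  obtain ⟨v', rfl⟩ := H.exists_fderiv_eq hu hw'.2
  rw [H.ambShape_fderiv hu, H.ambShape_fderiv hu, inner_neg_left, inner_neg_right,
    H.inner_fderiv_normal_comm hu, real_inner_comm]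

lemma inner_ambHess_comm (H : IsGradientFrame F N X y η Ω) (hu : u ∈ Ω) {w w' : E (n + 1)}
    (hw : IsHorizontal F N X u w) (hw' : IsHorizontal F N X u w') :
    inner ℝ (ambHess F X u w) w' = inner ℝ w (ambHess F X u w') := by
  obtain ⟨v, rfl⟩ := H.exists_fderiv_eq hu hw.2
  obtain ⟨v', rfl⟩ := H.exists_fderiv_eq hu hw'.2
  rw [H.ambHess_fderiv hu, H.ambHess_fderiv hu, H.inner_fderiv_push_comm hu hw.1 hw'.1,
    real_inner_comm]

lemma continuousAt_ambShape (H : IsGradientFrame F N X y η Ω) (hu : u ∈ Ω) :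
    ContinuousAt (ambShape F N) u :=
  ((contDiffAt_fderiv (H.contDiffAt_normal hu)).clm_comp
    (H.contDiffAt_pinv_fderiv hu)).neg.continuousAt

lemma continuousAt_ambHess (H : IsGradientFrame F N X y η Ω) (hu : u ∈ Ω) :
    ContinuousAt (ambHess F X) u :=
  ((contDiffAt_fderiv (H.contDiffAt_push hu)).clm_comp
    (H.contDiffAt_pinv_fderiv hu)).continuousAt

/-! ### Evolution along the integral curves of the field -/

section Curve

variable {γ : ℝ → E n} {a b : ℝ}

/-- The plane spanned by the field and the normal is constant along integral curves. -/
lemma isHorizontal_curve (H : IsGradientFrame F N X y η Ω) (hs : ∀ u ∈ Ω, IsSimpleAt F N X y u)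
    (hγ : ∀ s ∈ Set.Ioo a b, HasDerivAt γ (X (γ s)) s) (hγΩ : ∀ s ∈ Set.Ioo a b, γ s ∈ Ω)
    {s₀ : ℝ} (hs₀ : s₀ ∈ Set.Ioo a b) {w : E (n + 1)} (hw : IsHorizontal F N X (γ s₀) w)
    {s : ℝ} (hs' : s ∈ Set.Ioo a b) : IsHorizontal F N X (γ s) w := by
  have hE : ∀ s ∈ Set.Ioo a b, HasDerivAt (fun s => inner ℝ (push F X (γ s)) w)
      (y (γ s) * inner ℝ w (N (γ s))) s := fun s hs' => by
    have h1 := (hasFDerivAt_of_contDiffAt (H.contDiffAt_push (hγΩ s hs'))).comp_hasDerivAt s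
      (hγ s hs')
    refine (h1.inner ℝ (hasDerivAt_const s w)).congr_deriv ?_
    rw [H.fderiv_push_field (hγΩ s hs') (hs _ (hγΩ s hs')), inner_zero_right,
      real_inner_smul_left, real_inner_comm w, zero_add]
  have hN : ∀ s ∈ Set.Ioo a b, HasDerivAt (fun s => inner ℝ w (N (γ s)))
      (-(y (γ s) * inner ℝ (push F X (γ s)) w)) s := fun s hs' => by
    have h1 := (hasFDerivAt_of_contDiffAt (H.contDiffAt_normal (hγΩ s hs'))).comp_hasDerivAt s
      (hγ s hs')
    refine ((hasDerivAt_const s w).inner ℝ h1).congr_deriv ?_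
    rw [H.principal _ (hγΩ s hs'), inner_zero_left, inner_neg_right,
      real_inner_smul_right, real_inner_comm w, add_zero]
  -- With E = push F X, along the curve E' = yN and N' = -yE. The frame rotates in its own plane, so
  -- the squared length of the projection of w to that plane is constant.
  obtain ⟨C, hC⟩ := exists_const_of_hasDerivAt_zero (a := a) (b := b)
    (f := fun s => inner ℝ (push F X (γ s)) w ^ 2 + inner ℝ w (N (γ s)) ^ 2) fun s hs' =>
    (((hE s hs').pow 2).add ((hN s hs').pow 2)).congr_deriv (by simp; ring)
  have h0 : C = 0 := by rw [← hC s₀ hs₀, hw.1, hw.2]; simp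
  have h1 := hC s hs'
  rw [h0] at h1
  constructor <;> nlinarith [sq_nonneg (inner ℝ (push F X (γ s)) w), sq_nonneg (inner ℝ w (N (γ s)))]

/-- The derivative of the lift of a constant horizontal vector along an integral curve. -/
lemma exists_hasDerivAt_lift (H : IsGradientFrame F N X y η Ω)
    (hγ : ∀ s ∈ Set.Ioo a b, HasDerivAt γ (X (γ s)) s) (hγΩ : ∀ s ∈ Set.Ioo a b, γ s ∈ Ω)
    {w : E (n + 1)} (hw : ∀ s ∈ Set.Ioo a b, IsHorizontal F N X (γ s) w)
    {s : ℝ} (hs' : s ∈ Set.Ioo a b) : ∃ W' : E n,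
    HasDerivAt (fun s => pinv (fderiv ℝ F (γ s)) w) W' s ∧
    W' - fderiv ℝ X (γ s) (pinv (fderiv ℝ F (γ s)) w)
      = -pinv (fderiv ℝ F (γ s)) (ambHess F X (γ s) w) := by
  have hu := hγΩ s hs'
  have h1 := ((hasFDerivAt_of_contDiffAt (H.contDiffAt_pinv_fderiv hu)).comp_hasDerivAt s
    (hγ s hs')).clm_apply (hasDerivAt_const s w)
  refine ⟨_, h1, ?_⟩
  set W' := (fderiv ℝ (fun u => pinv (fderiv ℝ F u)) (γ s)) (X (γ s)) w
    + pinv (fderiv ℝ F (γ s)) 0 with hW'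
  set W := pinv (fderiv ℝ F (γ s)) w with hW
  have h2 := ((hasFDerivAt_fderiv_of_contDiffAt (H.contDiffAt hu)).comp_hasDerivAt s
    (hγ s hs')).clm_apply h1
  -- The lift W satisfies dF(W) = w with w constant. Thus W' - dX(W) plays the role of the bracket
  -- [X, W], and as W is parallel along the curve it equals minus the covariant derivative of X in
  -- the direction W.
  have h3 : (fun s => fderiv ℝ F (γ s) (pinv (fderiv ℝ F (γ s)) w)) =ᶠ[𝓝 s] fun _ => w :=
    eventually_of_mem (isOpen_Ioo.mem_nhds hs') fun t ht => H.fderiv_pinv (hγΩ t ht) (hw t ht).2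
  have h4 := (h2.congr_of_eventuallyEq h3.symm).unique (hasDerivAt_const s w)
  change fderiv ℝ (fderiv ℝ F) (γ s) (X (γ s)) W + fderiv ℝ F (γ s) W' = 0 at h4
  have h5 := H.fderiv_push hu W
  rw [sndFDeriv_comm (H.contDiffAt hu)] at h5
  have h6 : fderiv ℝ F (γ s) (W' - fderiv ℝ X (γ s) W) = -(ambHess F X (γ s) w) := by
    rw [map_sub, show ambHess F X (γ s) w = fderiv ℝ (push F X) (γ s) W from rfl, h5,
      eq_neg_of_add_eq_zero_right h4]
    abel
  change W' - fderiv ℝ X (γ s) W = _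
  rw [← pinv_apply_apply (H.injective _ hu) (W' - fderiv ℝ X (γ s) W), h6, map_neg]

/-- The evolution of the shape operator along an integral curve. -/
lemma hasDerivAt_ambShape (H : IsGradientFrame F N X y η Ω)
    (hγ : ∀ s ∈ Set.Ioo a b, HasDerivAt γ (X (γ s)) s) (hγΩ : ∀ s ∈ Set.Ioo a b, γ s ∈ Ω)
    {w : E (n + 1)} (hw : ∀ s ∈ Set.Ioo a b, IsHorizontal F N X (γ s) w)
    {s : ℝ} (hs' : s ∈ Set.Ioo a b) :
    HasDerivAt (fun s => ambShape F N (γ s) w)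
    (y (γ s) • ambHess F X (γ s) w - ambShape F N (γ s) (ambHess F X (γ s) w)) s := by
  have hu := hγΩ s hs'
  obtain ⟨W', h1, h2⟩ := exists_hasDerivAt_lift H hγ hγΩ hw hs'
  have h3 := (((hasFDerivAt_fderiv_of_contDiffAt (H.contDiffAt_normal hu)).comp_hasDerivAt s
    (hγ s hs')).clm_apply h1).neg
  refine h3.congr_deriv ?_
  set W := pinv (fderiv ℝ F (γ s)) w with hW
  -- The equation dN(X) = -y push F X is differentiated in the horizontal direction W, in which y is
  -- stationary; symmetry of the second derivative then turns this into a derivative along the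
  -- curve.
  have h4 := H.sndFDeriv_normal hu W
  have hyW : fderiv ℝ y (γ s) W = 0 := by
    rw [H.fderiv_curvature _ hu, H.fderiv_pinv hu (hw s hs').2, (hw s hs').1, mul_zero]
  rw [sndFDeriv_comm (H.contDiffAt_normal hu), hyW, zero_smul, zero_add] at h4
  have h5 : ambShape F N (γ s) (ambHess F X (γ s) w)
      = fderiv ℝ N (γ s) (W' - fderiv ℝ X (γ s) W) := by
    rw [h2, map_neg]; rfl
  rw [h5, map_sub, show ambHess F X (γ s) w = fderiv ℝ (push F X) (γ s) W from rfl]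
  change -(fderiv ℝ (fderiv ℝ N) (γ s) (X (γ s)) W + fderiv ℝ N (γ s) W') = _
  rw [eq_sub_of_add_eq h4]
  abel

/-- The evolution of the derivative of the field along an integral curve. -/
lemma hasDerivAt_ambHess (H : IsGradientFrame F N X y η Ω)
    (hs : ∀ u ∈ Ω, IsSimpleAt F N X y u)
    (hγ : ∀ s ∈ Set.Ioo a b, HasDerivAt γ (X (γ s)) s) (hγΩ : ∀ s ∈ Set.Ioo a b, γ s ∈ Ω)
    {w : E (n + 1)} (hw : ∀ s ∈ Set.Ioo a b, IsHorizontal F N X (γ s) w)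
    {s : ℝ} (hs' : s ∈ Set.Ioo a b) :
    HasDerivAt (fun s => ambHess F X (γ s) w)
    (-(y (γ s) • ambShape F N (γ s) w) - ambHess F X (γ s) (ambHess F X (γ s) w)) s := by
  have hu := hγΩ s hs'
  obtain ⟨W', h1, h2⟩ := exists_hasDerivAt_lift H hγ hγΩ hw hs'
  have h3 := ((hasFDerivAt_fderiv_of_contDiffAt (H.contDiffAt_push hu)).comp_hasDerivAt s
    (hγ s hs')).clm_apply h1
  refine h3.congr_deriv ?_
  set W := pinv (fderiv ℝ F (γ s)) w with hW
  have hyW : fderiv ℝ y (γ s) W = 0 := by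
    rw [H.fderiv_curvature _ hu, H.fderiv_pinv hu (hw s hs').2, (hw s hs').1, mul_zero]
  -- This is the geodesic equation differentiated in the direction W. It holds on an open set, so
  -- differentiation across the curves is allowed.
  have h4 : fderiv ℝ (fderiv ℝ (push F X)) (γ s) W (X (γ s))
      + fderiv ℝ (push F X) (γ s) (fderiv ℝ X (γ s) W) = y (γ s) • fderiv ℝ N (γ s) W := by
    have e1 := ((hasFDerivAt_fderiv_of_contDiffAt (H.contDiffAt_push hu)).clm_apply
      (hasFDerivAt_of_contDiffAt (H.contDiffAt_field hu))).fderiv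
    have e2 : (fun u => fderiv ℝ (push F X) u (X u)) =ᶠ[𝓝 (γ s)] fun u => y u • N u :=
      eventually_of_mem (H.isOpen.mem_nhds hu) fun t ht => H.fderiv_push_field ht (hs t ht)
    have e3 := ((hasFDerivAt_of_contDiffAt (H.contDiffAt_curvature hu)).smul
      (hasFDerivAt_of_contDiffAt (H.contDiffAt_normal hu))).fderiv
    rw [e2.fderiv_eq] at e1
    have := congrArg (fun L => L W) (e1.symm.trans e3)
    simp [hyW] at this
    rw [← this, add_comm (fderiv ℝ (fderiv ℝ (push F X)) (γ s) W (X (γ s)))]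
  rw [sndFDeriv_comm (H.contDiffAt_push hu)] at h4
  have h5 : ambHess F X (γ s) (ambHess F X (γ s) w)
      = -fderiv ℝ (push F X) (γ s) (W' - fderiv ℝ X (γ s) W) := by
    rw [h2, map_neg, neg_neg]; rfl
  have h6 : y (γ s) • ambShape F N (γ s) w = -(y (γ s) • fderiv ℝ N (γ s) W) := by
    rw [show ambShape F N (γ s) w = -fderiv ℝ N (γ s) W from rfl, smul_neg]
  rw [h5, map_sub, h6]
  change fderiv ℝ (fderiv ℝ (push F X)) (γ s) (X (γ s)) W
    + fderiv ℝ (push F X) (γ s) W' = _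
  rw [eq_sub_of_add_eq h4]
  abel

end Curve

end IsGradientFrame

/-! ### Linear algebra -/

lemma trace_eq_sum_of_eigenbasis {V ι : Type*} [AddCommGroup V] [Module ℝ V] [Fintype ι]
    (b : Module.Basis ι ℝ V) {T : V →ₗ[ℝ] V} {μ : ι → ℝ} (h : ∀ j, T (b j) = μ j • b j) :
    LinearMap.trace ℝ V T = ∑ j, μ j := by
  classical
  rw [LinearMap.trace_eq_matrix_trace ℝ b, Matrix.trace]
  refine Finset.sum_congr rfl fun j _ => ?_
  simp [LinearMap.toMatrix_apply, h]

lemma exists_joint_eigenbasis {V : Type*} [NormedAddCommGroup V] [InnerProductSpace ℝ V]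
    [FiniteDimensional ℝ V] {A B : V →ₗ[ℝ] V} (hA : A.IsSymmetric) (hB : B.IsSymmetric)
    (hAB : Commute A B) : ∃ (b : Module.Basis (Fin (Module.finrank ℝ V)) ℝ V)
      (l m : Fin (Module.finrank ℝ V) → ℝ), ∀ j, A (b j) = l j • b j ∧ B (b j) = m j • b j := by
  classical
  have h := LinearMap.IsSymmetric.directSum_isInternal_of_commute hA hB hAB
  let v := fun i : ℝ × ℝ => Module.finBasis ℝ
    (Module.End.eigenspace A i.2 ⊓ Module.End.eigenspace B i.1 : Submodule ℝ V)
  let b := h.collectedBasis v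
  have := Module.Finite.finite_basis b
  have := Fintype.ofFinite (Σ i : ℝ × ℝ, Fin (Module.finrank ℝ
    (Module.End.eigenspace A i.2 ⊓ Module.End.eigenspace B i.1 : Submodule ℝ V)))
  let e := Fintype.equivFinOfCardEq (Module.finrank_eq_card_basis b).symm
  refine ⟨b.reindex e, fun j => (e.symm j).1.2, fun j => (e.symm j).1.1, fun j => ?_⟩
  have hm := h.collectedBasis_mem v (e.symm j)
  rw [Module.Basis.reindex_apply]
  exact ⟨Module.End.mem_eigenspace_iff.1 hm.1, Module.End.mem_eigenspace_iff.1 hm.2⟩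

/-- If one function is nonzero somewhere, then by continuity it is nonzero on a smaller interval,
which the remaining functions must cover; induct. It is used to fix the index of the eigenvalue c y,
which might otherwise change from point to point. -/
lemma exists_Ioo_eqOn_zero_of_cover {ι : Type*} (S : Finset ι) {g : ι → ℝ → ℝ} {a b : ℝ}
    (hab : a < b) (hg : ∀ j, ContinuousOn (g j) (Set.Ioo a b))
    (h : ∀ s ∈ Set.Ioo a b, ∃ j ∈ S, g j s = 0) :
    ∃ j ∈ S, ∃ a' b', a' < b' ∧ Set.Ioo a' b' ⊆ Set.Ioo a b ∧ ∀ s ∈ Set.Ioo a' b', g j s = 0 := by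
  classical
  induction S using Finset.induction_on generalizing a b with
  | empty =>
    obtain ⟨j, hj, -⟩ := h ((a + b) / 2) ⟨by linarith, by linarith⟩
    simp at hj
  | insert i S hi ih =>
    by_cases hz : ∀ s ∈ Set.Ioo a b, g i s = 0
    · exact ⟨i, Finset.mem_insert_self _ _, a, b, hab, subset_rfl, hz⟩
    · push Not at hz
      obtain ⟨s, hs, hs0⟩ := hz
      have h1 : ∀ᶠ t in 𝓝 s, g i t ≠ 0 ∧ t ∈ Set.Ioo a b :=
        (((hg i).continuousAt (isOpen_Ioo.mem_nhds hs)).eventually_ne hs0).and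
          (isOpen_Ioo.mem_nhds hs)
      obtain ⟨ε, hε, hball⟩ := Metric.eventually_nhds_iff_ball.1 h1
      rw [Real.ball_eq_Ioo] at hball
      have hsub : Set.Ioo (s - ε) (s + ε) ⊆ Set.Ioo a b := fun t ht => (hball t ht).2
      obtain ⟨j, hj, a', b', h2, h3, h4⟩ := ih (a := s - ε) (b := s + ε) (by linarith)
        (fun j => (hg j).mono hsub) fun t ht => by
          obtain ⟨j, hj, hj0⟩ := h t (hsub ht)
          rcases Finset.mem_insert.1 hj with rfl | hj
          · exact absurd hj0 (hball t ht).1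
          · exact ⟨j, hj, hj0⟩
      exact ⟨j, Finset.mem_insert_of_mem hj, a', b', h2, h3.trans hsub, h4⟩

lemma exists_primitive {f f' : ℝ → ℝ} {a b s₀ : ℝ} (C : ℝ)
    (hf : ∀ s ∈ Set.Ioo a b, HasDerivAt f (f' s) s) :
    ∃ g : ℝ → ℝ, g s₀ = C ∧ ∀ s ∈ Set.Ioo a b, HasDerivAt g (f s) s := by
  obtain ⟨g, hg⟩ := (convex_Ioo a b).exists_forall_hasDerivWithinAt
    (fun s hs => (hf s hs).differentiableAt.differentiableWithinAt)
  exact ⟨fun s => g s - g s₀ + C, by simp, fun s hs =>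
    (((hg s hs).hasDerivAt (isOpen_Ioo.mem_nhds hs)).sub_const _).add_const _⟩

/-- A joint eigenvector of `A 0` and `B 0` stays one under the evolution `A' = y B - A B`,
`B' = - y A - B²`. -/
lemma eventually_eigenvector {V : Type*} [NormedAddCommGroup V] [NormedSpace ℝ V]
    {A B : ℝ → V →L[ℝ] V} {y θ φ : ℝ → ℝ} {w : V} {l m : ℝ}
    (hA : ContinuousAt A 0) (hB : ContinuousAt B 0) (hy : ContinuousAt y 0)
    (hA' : ∀ᶠ s in 𝓝 0, HasDerivAt (fun s => A s w) (y s • B s w - A s (B s w)) s)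
    (hB' : ∀ᶠ s in 𝓝 0, HasDerivAt (fun s => B s w) (-(y s • A s w) - B s (B s w)) s)
    (hAw : A 0 w = l • w) (hBw : B 0 w = m • w)
    (hθ0 : θ 0 = 0) (hθ : ∀ᶠ s in 𝓝 0, HasDerivAt θ (y s) s) (hφ0 : φ 0 = 1)
    (hφ : ∀ᶠ s in 𝓝 0, HasDerivAt φ (m * Real.cos (θ s) - l * Real.sin (θ s)) s) :
    ∀ᶠ s in 𝓝 0, φ s • A s w = (m * Real.sin (θ s) + l * Real.cos (θ s)) • w ∧
      φ s • B s w = (m * Real.cos (θ s) - l * Real.sin (θ s)) • w := by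
  -- The defects (φ B w - α w, φ A w - β w), with α and β the trigonometric expressions, solve the
  -- linear equation p' = M p and vanish at 0, hence vanish identically. Working with φ A w rather
  -- than with the quotient β/φ makes the equation linear.
  set M : ℝ → V × V →L[ℝ] V × V := fun s =>
    ContinuousLinearMap.inl ℝ V V ∘L (-(y s • ContinuousLinearMap.snd ℝ V V)
      - B s ∘L ContinuousLinearMap.fst ℝ V V)
    + ContinuousLinearMap.inr ℝ V V ∘L (y s • ContinuousLinearMap.fst ℝ V V
      - A s ∘L ContinuousLinearMap.fst ℝ V V) with hM
  have hMc : ContinuousAt M 0 := by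
    refine (continuousAt_const.clm_comp ((hy.smul continuousAt_const).neg.sub
      (hB.clm_comp continuousAt_const))).add (continuousAt_const.clm_comp
      ((hy.smul continuousAt_const).sub (hA.clm_comp continuousAt_const)))
  have hMb : ∀ᶠ s in 𝓝 0, LipschitzOnWith (‖M 0‖₊ + 1) (M s) Set.univ := by
    have : ∀ᶠ s in 𝓝 0, ‖M s‖₊ < ‖M 0‖₊ + 1 :=
      hMc.nnnorm.eventually (gt_mem_nhds (lt_add_one _))
    exact this.mono fun s hs => ((M s).lipschitz.weaken hs.le).lipschitzOnWith
  set p : ℝ → V × V := fun s =>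
    (φ s • B s w - (m * Real.cos (θ s) - l * Real.sin (θ s)) • w,
      φ s • A s w - (m * Real.sin (θ s) + l * Real.cos (θ s)) • w) with hp
  have hpd : ∀ᶠ s in 𝓝 0, HasDerivAt p (M s (p s)) s ∧ p s ∈ (Set.univ : Set (V × V)) := by
    filter_upwards [hA', hB', hθ, hφ] with s h1 h2 h3 h4
    refine ⟨?_, trivial⟩
    have hc := (h3.cos.const_mul m).sub (h3.sin.const_mul l)
    have hs := (h3.sin.const_mul m).add (h3.cos.const_mul l)
    refine (((h4.smul h2).sub (hc.smul_const w)).prodMk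
      ((h4.smul h1).sub (hs.smul_const w))).congr_deriv ?_
    have e : M s (p s) = (-(y s • (p s).2) - B s (p s).1, y s • (p s).1 - A s (p s).1) := by
      simp [hM]
    rw [e]
    refine Prod.ext ?_ ?_
    · simp only [hp, map_sub, map_smul]
      module
    · simp only [hp, map_sub, map_smul]
      module
  have h0d : ∀ᶠ s in 𝓝 0, HasDerivAt (fun _ : ℝ => (0 : V × V)) (M s 0) s ∧
      (0 : V × V) ∈ (Set.univ : Set (V × V)) :=
    Eventually.of_forall fun s => ⟨by simpa using hasDerivAt_const s (0 : V × V), trivial⟩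
  have hp0 : p 0 = 0 := by simp [hp, hθ0, hφ0, hAw, hBw]
  have := ODE_solution_unique_of_eventually hMb hpd h0d hp0
  filter_upwards [this] with s hs
  have h1 := congrArg Prod.fst hs
  have h2 := congrArg Prod.snd hs
  exact ⟨sub_eq_zero.1 h2, sub_eq_zero.1 h1⟩

/-! ### The horizontal space and its traces -/

namespace IsGradientFrame

variable {k : ℕ} {F N : E (k + 1) → E (k + 1 + 1)} {X : E (k + 1) → E (k + 1)}
  {y η : E (k + 1) → ℝ} {Ω : Set (E (k + 1))} {u : E (k + 1)}

/-- The orthogonal complement of the field and the normal. -/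
def horizontal (F N : E (k + 1) → E (k + 1 + 1)) (X : E (k + 1) → E (k + 1)) (u : E (k + 1)) :
    Submodule ℝ (E (k + 1 + 1)) :=
  (Submodule.span ℝ (Set.range ![push F X u, N u]))ᗮ

lemma mem_horizontal {w : E (k + 1 + 1)} :
    w ∈ horizontal F N X u ↔ IsHorizontal F N X u w := by
  rw [horizontal, Submodule.mem_orthogonal]
  constructor
  · intro h
    refine ⟨h _ (Submodule.subset_span ⟨0, rfl⟩), ?_⟩
    rw [real_inner_comm]
    exact h _ (Submodule.subset_span ⟨1, rfl⟩)
  · intro h v hv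
    induction hv using Submodule.span_induction with
    | mem x hx =>
      obtain ⟨i, rfl⟩ := hx
      fin_cases i
      · exact h.1
      · have := h.2
        rw [real_inner_comm] at this
        exact this
    | zero => simp
    | add x z _ _ hx hz => rw [inner_add_left, hx, hz, add_zero]
    | smul a x _ hx => rw [real_inner_smul_left, hx, mul_zero]

lemma finrank_horizontal (H : IsGradientFrame F N X y η Ω) (hu : u ∈ Ω) :
    Module.finrank ℝ (horizontal F N X u) = k := by
  have ho : Orthonormal ℝ ![push F X u, N u] := by
    refine ⟨fun i => ?_, fun i j hij => ?_⟩
    · fin_cases i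
      · exact H.norm_push u hu
      · exact H.norm_normal u hu
    · have h1 := H.inner_push_normal hu
      fin_cases i <;> fin_cases j
      · exact absurd rfl hij
      · exact h1
      · rw [real_inner_comm] at h1; exact h1
      · exact absurd rfl hij
  have h1 := finrank_span_eq_card ho.linearIndependent
  have h2 := Submodule.finrank_add_finrank_orthogonal
    (Submodule.span ℝ (Set.range ![push F X u, N u]))
  rw [h1] at h2
  simp at h2
  rw [horizontal]
  omega

/-- The orthonormal frame consisting of the field and a horizontal orthonormal basis. -/
lemma orthonormal_cons (H : IsGradientFrame F N X y η Ω) (hu : u ∈ Ω)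
    {o : Fin k → E (k + 1 + 1)} (ho : Orthonormal ℝ o) (hh : ∀ j, IsHorizontal F N X u (o j)) :
    Orthonormal ℝ fun a => fderiv ℝ F u
      (Fin.cons (α := fun _ => E (k + 1)) (X u) (fun j => pinv (fderiv ℝ F u) (o j)) a) := by
  have e : (fun a => fderiv ℝ F u
      (Fin.cons (α := fun _ => E (k + 1)) (X u) (fun j => pinv (fderiv ℝ F u) (o j)) a))
      = Fin.cons (α := fun _ => E (k + 1 + 1)) (push F X u) o := by
    funext a
    refine Fin.cases ?_ (fun j => ?_) a
    · rfl
    · simp only [Fin.cons_succ]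
      exact H.fderiv_pinv hu (hh j).2
  rw [e]
  refine ⟨fun i => ?_, fun i j hij => ?_⟩
  · refine Fin.cases ?_ (fun j => ?_) i
    · exact H.norm_push u hu
    · exact ho.1 j
  · revert hij
    refine Fin.cases ?_ (fun i => ?_) i <;> refine Fin.cases ?_ (fun j => ?_) j
    · simp
    · intro _; exact (hh j).1
    · intro _; simp only [Fin.cons_succ, Fin.cons_zero]; rw [real_inner_comm]; exact (hh i).1
    · intro hij; exact ho.2 (fun h : i = j => hij (by rw [h]))

/-- The hypothesis `ht` says trace A = -2y, and the field itself contributes y, leaving -3y for the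
horizontal directions. -/
lemma sum_ambShape (H : IsGradientFrame F N X y η Ω) (hu : u ∈ Ω)
    (ht : ∀ ε : Fin (k + 1) → E (k + 1), Orthonormal ℝ (fun a => fderiv ℝ F u (ε a)) →
      ∑ a, inner ℝ (fderiv ℝ N u (ε a)) (fderiv ℝ F u (ε a)) = 2 * y u)
    {o : Fin k → E (k + 1 + 1)} (ho : Orthonormal ℝ o) (hh : ∀ j, IsHorizontal F N X u (o j)) :
    ∑ j, inner ℝ (o j) (ambShape F N u (o j)) = -3 * y u := by
  have h1 := ht _ (H.orthonormal_cons hu ho hh)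
  rw [Fin.sum_univ_succ] at h1
  simp only [Fin.cons_zero, Fin.cons_succ] at h1
  rw [H.principal u hu, show fderiv ℝ F u (X u) = push F X u from rfl, inner_neg_left,
    real_inner_smul_left, H.inner_push_self hu] at h1
  have h2 : ∑ j, inner ℝ (o j) (ambShape F N u (o j))
      = -∑ j, inner ℝ (fderiv ℝ N u (pinv (fderiv ℝ F u) (o j)))
        (fderiv ℝ F u (pinv (fderiv ℝ F u) (o j))) := by
    rw [← Finset.sum_neg_distrib]
    refine Finset.sum_congr rfl fun j _ => ?_
    rw [H.fderiv_pinv hu (hh j).2, real_inner_comm, ← inner_neg_left]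
    rfl
  rw [h2]
  linarith

/-- In the trace of the Hessian of y, the field direction contributes the derivative of η along X,
since the field has unit length, and a horizontal direction contributes η times a diagonal entry of
the derivative of the field. -/
lemma slope_add_sum_ambHess (H : IsGradientFrame F N X y η Ω) (hu : u ∈ Ω)
    (hl : ∀ ε : Fin (k + 1) → E (k + 1), Orthonormal ℝ (fun a => fderiv ℝ F u (ε a)) →
      ∑ a, (fderiv ℝ (fderiv ℝ y) u (ε a) (ε a)
        - η u * inner ℝ (push F X u) (fderiv ℝ (fderiv ℝ F) u (ε a) (ε a)))
      = y u * ∑ a, ‖fderiv ℝ N u (ε a)‖ ^ 2)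
    {o : Fin k → E (k + 1 + 1)} (ho : Orthonormal ℝ o) (hh : ∀ j, IsHorizontal F N X u (o j)) :
    fderiv ℝ η u (X u) + (∑ j, inner ℝ (o j) (ambHess F X u (o j))) * η u
      = y u * (y u ^ 2 + ∑ j, inner ℝ (o j) (ambShape F N u (ambShape F N u (o j)))) := by
  have h1 := hl _ (H.orthonormal_cons hu ho hh)
  have e0 : fderiv ℝ F u (X u) = push F X u := rfl
  rw [Fin.sum_univ_succ, Fin.sum_univ_succ] at h1
  simp only [Fin.cons_zero, Fin.cons_succ] at h1
  rw [H.principal u hu, norm_neg, norm_smul, H.norm_push u hu, mul_one, Real.norm_eq_abs, sq_abs,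
    H.sndFDeriv_curvature hu, e0, H.inner_push_self hu, H.inner_fderiv_push_push hu] at h1
  have h2 : ∀ j, fderiv ℝ (fderiv ℝ y) u (pinv (fderiv ℝ F u) (o j)) (pinv (fderiv ℝ F u) (o j))
      - η u * inner ℝ (push F X u) (fderiv ℝ (fderiv ℝ F) u (pinv (fderiv ℝ F u) (o j))
        (pinv (fderiv ℝ F u) (o j))) = inner ℝ (o j) (ambHess F X u (o j)) * η u := fun j => by
    rw [H.sndFDeriv_curvature hu, H.fderiv_pinv hu (hh j).2, (hh j).1, real_inner_comm _ (o j),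
      show fderiv ℝ (push F X) u (pinv (fderiv ℝ F u) (o j)) = ambHess F X u (o j) from rfl]
    ring
  have h3 : ∀ j, ‖fderiv ℝ N u (pinv (fderiv ℝ F u) (o j))‖ ^ 2
      = inner ℝ (o j) (ambShape F N u (ambShape F N u (o j))) := fun j => by
    rw [← H.inner_ambShape_comm hu (hh j) (H.isHorizontal_ambShape hu (hh j)),
      real_inner_self_eq_norm_sq,
      show ambShape F N u (o j) = -fderiv ℝ N u (pinv (fderiv ℝ F u) (o j)) from rfl, norm_neg]
  simp only [h2, h3] at h1
  rw [Finset.sum_mul]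
  linarith

end IsGradientFrame

/-- A hypersurface on which the gradient of a principal curvature `y` is nonzero and principal with
principal curvature `y`, for which `c y` is also a principal curvature, cannot satisfy the equations
`trace A = - 2 y` and `Δ y = y |A|²`. -/
theorem IsGradientFrame.absurd {k : ℕ} {F N : E (k + 1) → E (k + 1 + 1)}
    {X : E (k + 1) → E (k + 1)} {y η : E (k + 1) → ℝ} {Ω : Set (E (k + 1))}
    (H : IsGradientFrame F N X y η Ω) (hne : Ω.Nonempty) {c : ℝ} (hc : c < 0)
    (hy0 : ∀ u ∈ Ω, y u ≠ 0)
    (ha : ∀ u ∈ Ω, ∃ v ≠ 0, fderiv ℝ N u v = -((c * y u) • fderiv ℝ F u v))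
    (ht : ∀ u ∈ Ω, ∀ ε : Fin (k + 1) → E (k + 1), Orthonormal ℝ (fun a => fderiv ℝ F u (ε a)) →
      ∑ a, inner ℝ (fderiv ℝ N u (ε a)) (fderiv ℝ F u (ε a)) = 2 * y u)
    (hl : ∀ u ∈ Ω, ∀ ε : Fin (k + 1) → E (k + 1), Orthonormal ℝ (fun a => fderiv ℝ F u (ε a)) →
      ∑ a, (fderiv ℝ (fderiv ℝ y) u (ε a) (ε a)
        - η u * inner ℝ (push F X u) (fderiv ℝ (fderiv ℝ F) u (ε a) (ε a)))
      = y u * ∑ a, ‖fderiv ℝ N u (ε a)‖ ^ 2) : False := by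
  obtain ⟨Ω', hsub, hopen, ⟨u₀, hu₀⟩, hsimple⟩ := H.exists_simple hne
  replace H := H.mono hopen hsub
  replace hy0 := fun u hu => hy0 u (hsub hu)
  replace ha := fun u hu => ha u (hsub hu)
  replace ht := fun u hu => ht u (hsub hu)
  replace hl := fun u hu => hl u (hsub hu)
  obtain ⟨γ, hγ0, ε, hε, hγ⟩ := ((H.contDiffAt_field hu₀).of_le
    (by simp)).exists_forall_mem_closedBall_exists_eq_forall_mem_Ioo_hasDerivAt₀ 0
  have h0ε : (0 : ℝ) ∈ Set.Ioo (0 - ε) (0 + ε) := ⟨by linarith, by linarith⟩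
  have hnear : ∀ᶠ s in 𝓝 (0 : ℝ), γ s ∈ Ω' ∧ HasDerivAt γ (X (γ s)) s := by
    refine Eventually.and ?_ (eventually_of_mem (isOpen_Ioo.mem_nhds h0ε) hγ)
    refine (hγ 0 h0ε).continuousAt.eventually ?_
    rw [hγ0]
    exact hopen.mem_nhds hu₀
  obtain ⟨δ, hδ, hball⟩ := Metric.eventually_nhds_iff_ball.1 hnear
  rw [Real.ball_eq_Ioo] at hball
  set I := Set.Ioo (0 - δ) (0 + δ) with hI
  have h0 : (0 : ℝ) ∈ I := ⟨by linarith, by linarith⟩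
  have hγΩ : ∀ s ∈ I, γ s ∈ Ω' := fun s hs => (hball s hs).1
  replace hγ : ∀ s ∈ I, HasDerivAt γ (X (γ s)) s := fun s hs => (hball s hs).2
  have hIn : ∀ᶠ s in 𝓝 (0 : ℝ), s ∈ I := isOpen_Ioo.mem_nhds h0
  set V := horizontal F N X (γ 0) with hV
  have hVh : ∀ w ∈ V, ∀ s ∈ I, IsHorizontal F N X (γ s) w := fun w hw s hs =>
    H.isHorizontal_curve hsimple hγ hγΩ h0 (mem_horizontal.1 hw) hs
  have hVh' : ∀ s ∈ I, ∀ w, IsHorizontal F N X (γ s) w → w ∈ V := fun s hs w hw =>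
    mem_horizontal.2 (H.isHorizontal_curve hsimple hγ hγΩ hs hw h0)
  set A := fun s => ambShape F N (γ s) with hA
  set B := fun s => ambHess F X (γ s) with hB
  have hAV : ∀ s ∈ I, ∀ w ∈ V, A s w ∈ V := fun s hs w hw =>
    hVh' s hs _ (H.isHorizontal_ambShape (hγΩ s hs) (hVh w hw s hs))
  have hBV : ∀ s ∈ I, ∀ w ∈ V, B s w ∈ V := fun s hs w hw =>
    hVh' s hs _ (H.isHorizontal_ambHess (hγΩ s hs) (hVh w hw s hs))
  have hA' : ∀ w ∈ V, ∀ s ∈ I, HasDerivAt (fun s => A s w)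
      (y (γ s) • B s w - A s (B s w)) s := fun w hw s hs =>
    H.hasDerivAt_ambShape hγ hγΩ (hVh w hw) hs
  have hB' : ∀ w ∈ V, ∀ s ∈ I, HasDerivAt (fun s => B s w)
      (-(y (γ s) • A s w) - B s (B s w)) s := fun w hw s hs =>
    H.hasDerivAt_ambHess hsimple hγ hγΩ (hVh w hw) hs
  have hAs : ∀ s ∈ I, ∀ w ∈ V, ∀ w' ∈ V, inner ℝ (A s w) w' = inner ℝ w (A s w') :=
    fun s hs w hw w' hw' => H.inner_ambShape_comm (hγΩ s hs) (hVh w hw s hs) (hVh w' hw' s hs)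
  have hBs : ∀ s ∈ I, ∀ w ∈ V, ∀ w' ∈ V, inner ℝ (B s w) w' = inner ℝ w (B s w') :=
    fun s hs w hw w' hw' => H.inner_ambHess_comm (hγΩ s hs) (hVh w hw s hs) (hVh w' hw' s hs)
  -- Symmetry of A persists along the curve, so A' = yB - AB is symmetric on V. Hence AB is
  -- symmetric there, which for symmetric A and B means that they commute.
  have hcomm : ∀ w ∈ V, A 0 (B 0 w) = B 0 (A 0 w) := by
    intro w hw
    have hz : A 0 (B 0 w) - B 0 (A 0 w) ∈ V :=
      V.sub_mem (hAV 0 h0 _ (hBV 0 h0 _ hw)) (hBV 0 h0 _ (hAV 0 h0 _ hw))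
    have key : ∀ w' ∈ V, inner ℝ (A 0 (B 0 w) - B 0 (A 0 w)) w' = 0 := by
      intro w' hw'
      have e1 := (hA' w hw 0 h0).inner ℝ (hasDerivAt_const (0 : ℝ) w')
      have e2 := (hasDerivAt_const (0 : ℝ) w).inner ℝ (hA' w' hw' 0 h0)
      have e3 : (fun s => inner ℝ (A s w) w') =ᶠ[𝓝 0] fun s => inner ℝ w (A s w') :=
        hIn.mono fun s hs => hAs s hs w hw w' hw'
      have e4 := (e1.congr_of_eventuallyEq e3.symm).unique e2
      simp only [inner_zero_right, inner_zero_left, zero_add, add_zero, inner_sub_left,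
        inner_sub_right, real_inner_smul_left, real_inner_smul_right,
        hBs 0 h0 w hw w' hw'] at e4
      rw [inner_sub_left, hBs 0 h0 _ (hAV 0 h0 w hw) w' hw', hAs 0 h0 w hw _ (hBV 0 h0 w' hw')]
      linarith
    exact sub_eq_zero.1 (inner_self_eq_zero.1 (key _ hz))
  set AV := fun (s : ℝ) (hs : s ∈ I) => (A s).toLinearMap.restrict (hAV s hs) with hAVdef
  set BV := fun (s : ℝ) (hs : s ∈ I) => (B s).toLinearMap.restrict (hBV s hs) with hBVdef
  have hcV : Commute (AV 0 h0) (BV 0 h0) := by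
    refine LinearMap.ext fun w => Subtype.ext ?_
    exact hcomm w w.2
  obtain ⟨b, l, m, hb⟩ := exists_joint_eigenbasis (A := AV 0 h0) (B := BV 0 h0)
    (fun v w => hAs 0 h0 v v.2 w w.2) (fun v w => hBs 0 h0 v v.2 w w.2) hcV
  have hyγ : ∀ s ∈ I, HasDerivAt (fun s => y (γ s)) (η (γ s)) s := fun s hs => by
    refine ((hasFDerivAt_of_contDiffAt (H.contDiffAt_curvature (hγΩ s hs))).comp_hasDerivAt s
      (hγ s hs)).congr_deriv ?_
    rw [H.fderiv_curvature _ (hγΩ s hs), show fderiv ℝ F (γ s) (X (γ s)) = push F X (γ s) from rfl,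
      H.inner_push_self (hγΩ s hs), mul_one]
  have hηγ : ∀ s ∈ I, HasDerivAt (fun s => η (γ s)) (fderiv ℝ η (γ s) (X (γ s))) s := fun s hs =>
    (hasFDerivAt_of_contDiffAt (H.contDiffAt_slope (hγΩ s hs))).comp_hasDerivAt s (hγ s hs)
  -- θ is the angle by which the plane of the field and the normal has turned; every pair (α, β)
  -- turns with it.
  obtain ⟨θ, hθ0, hθ⟩ := exists_primitive (s₀ := 0) 0 hyγ
  set α := fun j s => m j * Real.cos (θ s) - l j * Real.sin (θ s) with hα
  set β := fun j s => m j * Real.sin (θ s) + l j * Real.cos (θ s) with hβ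
  have hα' : ∀ j, ∀ s ∈ I, HasDerivAt (α j) (-(y (γ s) * β j s)) s := fun j s hs =>
    (((hθ s hs).cos.const_mul (m j)).sub ((hθ s hs).sin.const_mul (l j))).congr_deriv
      (by simp only [hβ]; ring)
  have hβ' : ∀ j, ∀ s ∈ I, HasDerivAt (β j) (y (γ s) * α j s) s := fun j s hs =>
    (((hθ s hs).sin.const_mul (m j)).add ((hθ s hs).cos.const_mul (l j))).congr_deriv
      (by simp only [hα]; ring)
  choose φ hφ0 hφ using fun j => exists_primitive (s₀ := 0) 1 (hα' j)
  have hgood : ∀ᶠ s in 𝓝 (0 : ℝ), ∀ j, φ j s ≠ 0 ∧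
      φ j s • A s (b j) = β j s • (b j : E (k + 1 + 1)) ∧
      φ j s • B s (b j) = α j s • (b j : E (k + 1 + 1)) := by
    refine eventually_all.2 fun j => Eventually.and ?_ ?_
    · exact (hφ j 0 h0).continuousAt.eventually_ne (by rw [hφ0]; norm_num)
    · have hγc := (hγ 0 h0).continuousAt
      refine eventually_eigenvector (y := fun s => y (γ s))
        ((H.continuousAt_ambShape (hγΩ 0 h0)).comp hγc)
        ((H.continuousAt_ambHess (hγΩ 0 h0)).comp hγc) (hyγ 0 h0).continuousAt
        (hIn.mono (hA' (b j) (b j).2)) (hIn.mono (hB' (b j) (b j).2)) ?_ ?_ hθ0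
        (hIn.mono hθ) (hφ0 j) (hIn.mono (hφ j))
      · exact congrArg Subtype.val (hb j).1
      · exact congrArg Subtype.val (hb j).2
  obtain ⟨δ', hδ', hball'⟩ := Metric.eventually_nhds_iff_ball.1 (hgood.and hIn)
  rw [Real.ball_eq_Ioo] at hball'
  set J := Set.Ioo (0 - δ') (0 + δ') with hJ
  have hJI : J ⊆ I := fun s hs => (hball' s hs).2
  have hAb : ∀ s (hs : s ∈ J), ∀ j, AV s (hJI hs) (b j) = (β j s / φ j s) • b j := by
    intro s hs j
    obtain ⟨h1, h2, -⟩ := (hball' s hs).1 j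
    refine Subtype.ext ?_
    change A s (b j) = (β j s / φ j s) • (b j : E (k + 1 + 1))
    rw [div_eq_inv_mul, mul_smul, ← h2, inv_smul_smul₀ h1]
  have hBb : ∀ s (hs : s ∈ J), ∀ j, BV s (hJI hs) (b j) = (α j s / φ j s) • b j := by
    intro s hs j
    obtain ⟨h1, -, h2⟩ := (hball' s hs).1 j
    refine Subtype.ext ?_
    change B s (b j) = (α j s / φ j s) • (b j : E (k + 1 + 1))
    rw [div_eq_inv_mul, mul_smul, ← h2, inv_smul_smul₀ h1]
  have hfin : Module.finrank ℝ V = k := H.finrank_horizontal (hγΩ 0 h0)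
  let o : OrthonormalBasis (Fin k) ℝ V := (stdOrthonormalBasis ℝ V).reindex (finCongr hfin)
  have ho : Orthonormal ℝ fun j => (o j : E (k + 1 + 1)) :=
    o.orthonormal.comp_linearIsometry V.subtypeₗᵢ
  have hoh : ∀ s ∈ I, ∀ j, IsHorizontal F N X (γ s) (o j) := fun s hs j => hVh _ (o j).2 s hs
  have htr : ∀ s ∈ J, ∑ j, β j s / φ j s = -3 * y (γ s) := fun s hs => by
    rw [← H.sum_ambShape (hγΩ s (hJI hs)) (ht _ (hγΩ s (hJI hs))) ho (hoh s (hJI hs)),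
      ← trace_eq_sum_of_eigenbasis b (hAb s hs), LinearMap.trace_eq_sum_inner _ o]
    rfl
  have hlap : ∀ s ∈ J, fderiv ℝ η (γ s) (X (γ s)) + (∑ j, α j s / φ j s) * η (γ s)
      = y (γ s) * (y (γ s) ^ 2 + ∑ j, (β j s / φ j s) ^ 2) := fun s hs => by
    have h1 := H.slope_add_sum_ambHess (hγΩ s (hJI hs)) (hl _ (hγΩ s (hJI hs))) ho
      (hoh s (hJI hs))
    rw [← trace_eq_sum_of_eigenbasis b (hBb s hs), LinearMap.trace_eq_sum_inner _ o,
      ← trace_eq_sum_of_eigenbasis b (T := AV s (hJI hs) ∘ₗ AV s (hJI hs))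
        (μ := fun j => (β j s / φ j s) ^ 2), LinearMap.trace_eq_sum_inner _ o]
    · exact h1
    · intro j
      rw [LinearMap.comp_apply, hAb s hs, map_smul, hAb s hs, smul_smul, pow_two]
  -- An eigenvector for c y is orthogonal to X, because c < 0 and y ≠ 0 make c y different from y.
  -- It is therefore horizontal, and expanding it in the eigenbasis shows that c y is one of the
  -- β/φ.
  have hcov : ∀ s ∈ J, ∃ j ∈ (Finset.univ : Finset (Fin (Module.finrank ℝ V))),
      β j s - c * y (γ s) * φ j s = 0 := by
    intro s hs
    have hu := hγΩ s (hJI hs)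
    obtain ⟨v, hv0, hv⟩ := ha _ hu
    set w := fderiv ℝ F (γ s) v with hw
    have hwE : inner ℝ (push F X (γ s)) w = 0 := by
      have h1 := H.inner_fderiv_normal_push hu v
      rw [hv, inner_neg_left, real_inner_smul_left, real_inner_comm] at h1
      have h2 : (1 - c) * y (γ s) * inner ℝ (push F X (γ s)) w = 0 := by linarith
      refine (mul_eq_zero.1 h2).resolve_left (mul_ne_zero (by linarith) (hy0 _ hu))
    have hwV : w ∈ V := hVh' s (hJI hs) w ⟨hwE, H.orthogonal _ hu v⟩
    have hw0 : (⟨w, hwV⟩ : V) ≠ 0 := by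
      intro h
      have h1 : w = 0 := congrArg Subtype.val h
      exact hv0 (H.injective _ hu (by rw [← hw, h1, map_zero]))
    have hAw : AV s (hJI hs) ⟨w, hwV⟩ = (c * y (γ s)) • (⟨w, hwV⟩ : V) := by
      refine Subtype.ext ?_
      change ambShape F N (γ s) w = (c * y (γ s)) • w
      rw [hw, H.ambShape_fderiv hu, hv, neg_neg]
    obtain ⟨j, hj⟩ : ∃ j, b.repr ⟨w, hwV⟩ j ≠ 0 := by
      by_contra hcon
      push Not at hcon
      exact hw0 (b.repr.map_eq_zero_iff.1 (Finsupp.ext hcon))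
    refine ⟨j, Finset.mem_univ j, ?_⟩
    have h1 : b.repr (AV s (hJI hs) ⟨w, hwV⟩) j = (β j s / φ j s) * b.repr ⟨w, hwV⟩ j := by
      conv_lhs => rw [← b.sum_repr ⟨w, hwV⟩]
      simp only [map_sum, map_smul, hAb s hs, b.repr_self, Finsupp.coe_finsetSum,
        Finset.sum_apply, Finsupp.smul_apply, Finsupp.single_apply, smul_eq_mul, mul_ite, mul_one,
        mul_zero, Finset.sum_ite_eq', Finset.mem_univ, if_true]
      ring
    rw [hAw, map_smul, Finsupp.smul_apply, smul_eq_mul] at h1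
    have h2 := mul_right_cancel₀ hj h1
    have h3 := ((hball' s hs).1 j).1
    rw [h2]
    field_simp
    ring
  obtain ⟨j₀, -, a', b', hab', hsub', hj₀⟩ := exists_Ioo_eqOn_zero_of_cover Finset.univ
    (by linarith : 0 - δ' < 0 + δ')
    (fun j s hs => ((hβ' j s (hJI hs)).continuousAt.sub
      ((continuousAt_const.mul (hyγ s (hJI hs)).continuousAt).mul
        (hφ j s (hJI hs)).continuousAt)).continuousWithinAt) hcov
  exact no_curvature_evolution hc hab' (y := fun s => y (γ s))
    (fun s hs => hyγ s (hJI (hsub' hs))) (fun s hs => hηγ s (hJI (hsub' hs)))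
    (fun j s hs => hφ j s (hJI (hsub' hs))) (fun j s hs => hα' j s (hJI (hsub' hs)))
    (fun j s hs => hβ' j s (hJI (hsub' hs))) (fun j s hs => ((hball' s (hsub' hs)).1 j).1)
    (fun s hs => hy0 _ (hγΩ s (hJI (hsub' hs)))) j₀ (fun s hs => sub_eq_zero.1 (hj₀ s hs))
    (fun s hs => htr s (hsub' hs)) (fun s hs => hlap s (hsub' hs))

/-! ### From the curvature equations to a gradient frame -/

/-- The equations of a biharmonic hypersurface with mean curvature `h` that has
`- c (n / 2) h` as a principal curvature, at a point of a parametrized hypersurface. -/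
structure CurvatureEquationsAt {n : ℕ} (F N : E n → E (n + 1)) (h : E n → ℝ) (c : ℝ) (u : E n) :
    Prop where
  trace : ∀ ε : Fin n → E n, Orthonormal ℝ (fun a => fderiv ℝ F u (ε a)) →
    ∑ a, inner ℝ (fderiv ℝ N u (ε a)) (fderiv ℝ F u (ε a)) = -(n * h u)
  eigen : ∃ v ≠ 0, fderiv ℝ N u v = (c * (n / 2) * h u) • fderiv ℝ F u v
  tangential : ∀ v, (∀ w, inner ℝ (fderiv ℝ F u v) (fderiv ℝ F u w) = fderiv ℝ h u w) →
    fderiv ℝ N u v = (n / 2 * h u) • fderiv ℝ F u v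
  normal : ∀ ε : Fin n → E n, Orthonormal ℝ (fun a => fderiv ℝ F u (ε a)) →
    ∀ v, (∀ w, inner ℝ (fderiv ℝ F u v) (fderiv ℝ F u w) = fderiv ℝ h u w) →
    ∑ a, (fderiv ℝ (fderiv ℝ h) u (ε a) (ε a)
      - inner ℝ (fderiv ℝ F u v) (fderiv ℝ (fderiv ℝ F) u (ε a) (ε a)))
    = h u * ∑ a, ‖fderiv ℝ N u (ε a)‖ ^ 2

lemma exists_orthonormal_fderiv {n m : ℕ} {L : E n →L[ℝ] E m} (hL : Function.Injective L) :
    ∃ ε : Fin n → E n, Orthonormal ℝ fun a => L (ε a) := by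
  set R := LinearMap.range L.toLinearMap
  have h1 : Module.finrank ℝ R = n := by
    rw [LinearMap.finrank_range_of_inj hL]; simp
  let o := (stdOrthonormalBasis ℝ R).reindex (finCongr h1)
  have ho : Orthonormal ℝ fun j => (o j : E m) := o.orthonormal.comp_linearIsometry R.subtypeₗᵢ
  choose ε hε using fun j => (o j).2
  refine ⟨ε, ?_⟩
  have e : (fun a => L (ε a)) = fun j => (o j : E m) := funext hε
  rw [e]
  exact ho

/-- The gradient of `h` in the induced metric, in coordinates. -/
def coordGradient {n : ℕ} (F : E n → E (n + 1)) (h : E n → ℝ) (u : E n) : E n :=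
  pinv (fderiv ℝ F u) ((pinv (fderiv ℝ F u)).adjoint
    ((InnerProductSpace.toDual ℝ (E n)).symm (fderiv ℝ h u)))

namespace IsLocalHypersurface

variable {n : ℕ} {F N : E n → E (n + 1)} {Ω : Set (E n)} {u : E n}

lemma pinv_normal (H : IsLocalHypersurface F N Ω) (hu : u ∈ Ω) :
    pinv (fderiv ℝ F u) (N u) = 0 := by
  have h : (fderiv ℝ F u).adjoint (N u) = 0 := by
    refine ext_inner_left ℝ fun v => ?_
    rw [ContinuousLinearMap.adjoint_inner_right, H.orthogonal u hu, inner_zero_right]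
  simp [pinv, h]

lemma fderiv_coordGradient (H : IsLocalHypersurface F N Ω) (hu : u ∈ Ω) (h : E n → ℝ) :
    fderiv ℝ F u (coordGradient F h u) = (pinv (fderiv ℝ F u)).adjoint
    ((InnerProductSpace.toDual ℝ (E n)).symm (fderiv ℝ h u)) := by
  refine H.fderiv_pinv hu ?_
  rw [ContinuousLinearMap.adjoint_inner_left, H.pinv_normal hu, inner_zero_right]

lemma inner_fderiv_coordGradient (H : IsLocalHypersurface F N Ω) (hu : u ∈ Ω) (h : E n → ℝ)
    (w : E n) : inner ℝ (fderiv ℝ F u (coordGradient F h u)) (fderiv ℝ F u w)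
      = fderiv ℝ h u w := by
  rw [H.fderiv_coordGradient hu, ContinuousLinearMap.adjoint_inner_left,
    pinv_apply_apply (H.injective u hu), InnerProductSpace.toDual_symm_apply]

lemma contDiffAt_coordGradient (H : IsLocalHypersurface F N Ω) (hu : u ∈ Ω) {h : E n → ℝ}
    (hh : ContDiffAt ℝ ∞ h u) : ContDiffAt ℝ ∞ (coordGradient F h) u := by
  have h1 : ContDiff ℝ ∞ (fun L : E (n + 1) →L[ℝ] E n => L.adjoint) :=
    (ContinuousLinearMap.adjoint (𝕜 := ℝ) (E := E (n + 1))
      (F := E n)).toContinuousLinearEquiv.contDiff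
  have h2 : ContDiff ℝ ∞ (fun L : E n →L[ℝ] ℝ => (InnerProductSpace.toDual ℝ (E n)).symm L) :=
    (InnerProductSpace.toDual ℝ (E n)).symm.toContinuousLinearEquiv.contDiff
  have hP := H.contDiffAt_pinv_fderiv hu
  exact hP.clm_apply ((h1.contDiffAt.comp u hP).clm_apply
    (h2.contDiffAt.comp u (contDiffAt_fderiv hh)))

end IsLocalHypersurface

/-- A hypersurface satisfying the curvature equations is minimal somewhere. -/
theorem IsLocalHypersurface.absurd {k : ℕ} {F N : E (k + 1) → E (k + 1 + 1)}
    {Ω : Set (E (k + 1))} (H : IsLocalHypersurface F N Ω) (hne : Ω.Nonempty)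
    {h : E (k + 1) → ℝ} (hh : ContDiffOn ℝ ∞ h Ω) (h0 : ∀ u ∈ Ω, h u ≠ 0) {c : ℝ} (hc : c < 0)
    (hcurv : ∀ u ∈ Ω, CurvatureEquationsAt F N h c u) : False := by
  set q : ℝ := ((k + 1 : ℕ) : ℝ) / 2 with hq
  have hq0 : q ≠ 0 := by positivity
  have hhu : ∀ u ∈ Ω, ContDiffAt ℝ ∞ h u := fun u hu => hh.contDiffAt (H.isOpen.mem_nhds hu)
  -- If h has zero differential on all of Ω, the normal equation gives |A|² = 0, and then the trace
  -- equation gives h = 0.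
  by_cases hconst : ∀ u ∈ Ω, fderiv ℝ h u = 0
  · obtain ⟨u, hu⟩ := hne
    obtain ⟨ε, hε⟩ := exists_orthonormal_fderiv (H.injective u hu)
    have e1 : fderiv ℝ (fderiv ℝ h) u = 0 := by
      have : fderiv ℝ h =ᶠ[𝓝 u] fun _ => 0 :=
        eventually_of_mem (H.isOpen.mem_nhds hu) hconst
      rw [this.fderiv_eq, fderiv_fun_const]
      rfl
    have e2 := (hcurv u hu).normal ε hε 0 (by simp [hconst u hu])
    simp only [e1, map_zero, inner_zero_left, zero_apply, sub_zero,
      Finset.sum_const_zero] at e2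
    have e3 := (mul_eq_zero.1 e2.symm).resolve_left (h0 u hu)
    rw [Finset.sum_eq_zero_iff_of_nonneg fun a _ => sq_nonneg _] at e3
    have e4 : ∀ a, fderiv ℝ N u (ε a) = 0 := fun a =>
      norm_eq_zero.1 (pow_eq_zero_iff two_ne_zero |>.1 (e3 a (Finset.mem_univ a)))
    have e5 := (hcurv u hu).trace ε hε
    simp only [e4, inner_zero_left, Finset.sum_const_zero] at e5
    have : ((k + 1 : ℕ) : ℝ) * h u = 0 := by linarith
    rcases mul_eq_zero.1 this with h1 | h1
    · norm_cast at h1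
    · exact h0 u hu h1
  push Not at hconst
  obtain ⟨u₀, hu₀, hdu₀⟩ := hconst
  set Ω' := Ω ∩ fderiv ℝ h ⁻¹' {0}ᶜ with hΩ'
  have hdc : ContinuousOn (fderiv ℝ h) Ω := fun u hu =>
    (contDiffAt_fderiv (hhu u hu)).continuousAt.continuousWithinAt
  have ho : IsOpen Ω' := hdc.isOpen_inter_preimage H.isOpen isOpen_compl_singleton
  have hsub : Ω' ⊆ Ω := Set.inter_subset_left
  replace H := H.mono ho hsub
  set Y := coordGradient F h with hY
  have hYc : ∀ u ∈ Ω', ContDiffAt ℝ ∞ Y u := fun u hu =>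
    H.contDiffAt_coordGradient hu (hhu u (hsub hu))
  have hYi : ∀ u ∈ Ω', ∀ w, inner ℝ (fderiv ℝ F u (Y u)) (fderiv ℝ F u w) = fderiv ℝ h u w :=
    fun u hu w => H.inner_fderiv_coordGradient hu h w
  have hG0 : ∀ u ∈ Ω', fderiv ℝ F u (Y u) ≠ 0 := fun u hu hz => by
    refine hu.2 (ContinuousLinearMap.ext fun w => ?_)
    rw [← hYi u hu w, hz, inner_zero_left, zero_apply]
  set κ : E (k + 1) → ℝ := fun u => ‖fderiv ℝ F u (Y u)‖ with hκ
  have hκ0 : ∀ u ∈ Ω', κ u ≠ 0 := fun u hu => norm_ne_zero_iff.2 (hG0 u hu)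
  have hκc : ∀ u ∈ Ω', ContDiffAt ℝ ∞ κ u := fun u hu =>
    ((contDiffAt_fderiv (H.contDiffAt hu)).clm_apply (hYc u hu)).norm ℝ (hG0 u hu)
  set X : E (k + 1) → E (k + 1) := fun u => (κ u)⁻¹ • Y u with hX
  have hpush : ∀ u, push F X u = (κ u)⁻¹ • fderiv ℝ F u (Y u) := fun u => by
    simp only [push, hX, map_smul]
  -- The factor -q = -n/2 is the one in the tangential equation, so that y is the principal
  -- curvature of the gradient.
  set y : E (k + 1) → ℝ := fun u => -q * h u with hy
  set η : E (k + 1) → ℝ := fun u => -q * κ u with hη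
  have hdy : ∀ u ∈ Ω', fderiv ℝ y u = -q • fderiv ℝ h u := fun u hu =>
    ((hasFDerivAt_of_contDiffAt (hhu u (hsub hu))).const_mul (-q)).fderiv
  have hηpush : ∀ u ∈ Ω', ∀ z, η u * inner ℝ (push F X u) z
      = -q * inner ℝ (fderiv ℝ F u (Y u)) z := fun u hu z => by
    rw [hpush, real_inner_smul_left]
    have := hκ0 u hu
    simp only [hη]
    field_simp
  have HG : IsGradientFrame F N X y η Ω' := by
    refine ⟨H, ?_, ?_, ?_, ?_, ?_, ?_, ?_⟩
    · exact fun u hu => (((hκc u hu).inv (hκ0 u hu)).smul (hYc u hu)).contDiffWithinAt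
    · exact fun u hu => (contDiffAt_const.mul (hhu u (hsub hu))).contDiffWithinAt
    · exact fun u hu => (contDiffAt_const.mul (hκc u hu)).contDiffWithinAt
    · intro u hu
      rw [hpush, norm_smul, norm_inv, Real.norm_eq_abs, abs_of_nonneg (norm_nonneg _)]
      exact inv_mul_cancel₀ (hκ0 u hu)
    · intro u hu v
      rw [hdy u hu, hηpush u hu, hYi u hu, smul_apply, smul_eq_mul]
    · exact fun u hu => mul_ne_zero (neg_ne_zero.2 hq0) (hκ0 u hu)
    · intro u hu
      rw [hpush, map_smul, (hcurv u (hsub hu)).tangential (Y u) (hYi u hu), ← hq]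
      simp only [hy]
      module
  refine HG.absurd ⟨u₀, hu₀, hdu₀⟩ hc
    (fun u hu => mul_ne_zero (neg_ne_zero.2 hq0) (h0 u (hsub hu))) ?_ ?_ ?_
  · intro u hu
    obtain ⟨v, hv0, hv⟩ := (hcurv u (hsub hu)).eigen
    refine ⟨v, hv0, ?_⟩
    rw [hv, ← hq]
    simp only [hy]
    module
  · intro u hu ε hε
    rw [(hcurv u (hsub hu)).trace ε hε]
    simp only [hy, hq]
    ring
  · intro u hu ε hε
    have e1 := (hcurv u (hsub hu)).normal ε hε (Y u) (hYi u hu)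
    have e2 : fderiv ℝ (fderiv ℝ y) u = -q • fderiv ℝ (fderiv ℝ h) u := by
      have : fderiv ℝ y =ᶠ[𝓝 u] fun u => -q • fderiv ℝ h u :=
        eventually_of_mem (ho.mem_nhds hu) hdy
      rw [this.fderiv_eq]
      exact ((hasFDerivAt_fderiv_of_contDiffAt (hhu u (hsub hu))).const_smul (-q)).fderiv
    simp only [e2, hηpush u hu, smul_apply, smul_eq_mul, ← mul_sub]
    rw [← Finset.mul_sum, e1]
    simp only [hy]
    ring

/-! ### Change of parameters -/

section Comp

variable {n : ℕ} {W : Type*} [NormedAddCommGroup W] [NormedSpace ℝ W]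

lemma fderiv_eq_of_eventuallyEq_comp {F₀ F : E n → W} {τ : E n → E n} {u : E n}
    (hF : ContDiffAt ℝ ∞ F (τ u)) (hτ : ContDiffAt ℝ ∞ τ u)
    (h : F₀ =ᶠ[𝓝 u] fun t => F (τ t)) (v : E n) :
    fderiv ℝ F₀ u v = fderiv ℝ F (τ u) (fderiv ℝ τ u v) := by
  rw [h.fderiv_eq]
  exact congrArg (fun L => L v)
    ((hasFDerivAt_of_contDiffAt hF).comp u (hasFDerivAt_of_contDiffAt hτ)).fderiv

lemma eventually_contDiffAt {f : E n → W} {u : E n} (hf : ContDiffAt ℝ ∞ f u) :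
    ∀ᶠ t in 𝓝 u, DifferentiableAt ℝ f t :=
  ((hf.of_le (show (1 : WithTop ℕ∞) ≤ ∞ by simp)).eventually (by simp)).mono
    fun _ ht => ht.differentiableAt (by simp)

lemma sndFDeriv_eq_of_eventuallyEq_comp {F₀ F : E n → W} {τ : E n → E n} {u : E n}
    (hF : ContDiffAt ℝ ∞ F (τ u)) (hτ : ContDiffAt ℝ ∞ τ u)
    (h : F₀ =ᶠ[𝓝 u] fun t => F (τ t)) (v w : E n) :
    fderiv ℝ (fderiv ℝ F₀) u v w
      = fderiv ℝ (fderiv ℝ F) (τ u) (fderiv ℝ τ u v) (fderiv ℝ τ u w)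
        + fderiv ℝ F (τ u) (fderiv ℝ (fderiv ℝ τ) u v w) := by
  have h1 : fderiv ℝ F₀ =ᶠ[𝓝 u] fun t => (fderiv ℝ F (τ t)).comp (fderiv ℝ τ t) := by
    have h2 := hτ.continuousAt.eventually (eventually_contDiffAt hF)
    filter_upwards [h.eventuallyEq_nhds, h2, eventually_contDiffAt hτ] with t h3 h4 h5
    rw [h3.fderiv_eq]
    exact (h4.hasFDerivAt.comp t h5.hasFDerivAt).fderiv
  have h2 : HasFDerivAt (fun t => fderiv ℝ F (τ t))
      ((fderiv ℝ (fderiv ℝ F) (τ u)).comp (fderiv ℝ τ u)) u :=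
    (hasFDerivAt_fderiv_of_contDiffAt hF).comp u (hasFDerivAt_of_contDiffAt hτ)
  rw [h1.fderiv_eq, (h2.clm_comp (hasFDerivAt_fderiv_of_contDiffAt hτ)).fderiv]
  simp [add_comm]

end Comp

/-- The equations are tensorial: frames, eigenvectors and gradients are carried over by the
differential of τ. Its second derivative enters both terms of the Hessian, and the two contributions
cancel by the definition of the gradient. This is needed because the geometric hypotheses at a point
use the preferred chart at that point. -/
lemma CurvatureEquationsAt.comp {n : ℕ} {F N F₀ N₀ : E n → E (n + 1)} {h h₀ : E n → ℝ} {c : ℝ}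
    {τ : E n → E n} {u : E n} (H : CurvatureEquationsAt F N h c (τ u))
    (hτ : ContDiffAt ℝ ∞ τ u) (hbij : Function.Bijective (fderiv ℝ τ u))
    (hF : ContDiffAt ℝ ∞ F (τ u)) (hN : ContDiffAt ℝ ∞ N (τ u)) (hh : ContDiffAt ℝ ∞ h (τ u))
    (hF₀ : F₀ =ᶠ[𝓝 u] fun t => F (τ t)) (hN₀ : N₀ =ᶠ[𝓝 u] fun t => N (τ t))
    (hh₀ : h₀ =ᶠ[𝓝 u] fun t => h (τ t)) : CurvatureEquationsAt F₀ N₀ h₀ c u := by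
  have dF := fderiv_eq_of_eventuallyEq_comp hF hτ hF₀
  have dN := fderiv_eq_of_eventuallyEq_comp hN hτ hN₀
  have dh := fderiv_eq_of_eventuallyEq_comp hh hτ hh₀
  have eh : h₀ u = h (τ u) := hh₀.eq_of_nhds
  have hgrad : ∀ v, (∀ w, inner ℝ (fderiv ℝ F₀ u v) (fderiv ℝ F₀ u w) = fderiv ℝ h₀ u w) →
      ∀ w, inner ℝ (fderiv ℝ F (τ u) (fderiv ℝ τ u v)) (fderiv ℝ F (τ u) w)
        = fderiv ℝ h (τ u) w := by
    intro v hv w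
    obtain ⟨w', rfl⟩ := hbij.2 w
    have := hv w'
    rwa [dF, dF, dh] at this
  refine ⟨fun ε hε => ?_, ?_, fun v hv => ?_, fun ε hε v hv => ?_⟩
  · simp only [dF, dN, eh] at hε ⊢
    exact H.trace _ hε
  · obtain ⟨v, hv0, hv⟩ := H.eigen
    obtain ⟨v', rfl⟩ := hbij.2 v
    refine ⟨v', fun h0 => hv0 (by rw [h0, map_zero]), ?_⟩
    rw [dF, dN, eh, hv]
  · rw [dF, dN, eh]
    exact H.tangential _ (hgrad v hv)
  · have h1 := hgrad v hv
    simp only [dF] at hε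
    have h2 := H.normal _ hε _ h1
    simp only [dN, eh]
    rw [← h2]
    refine Finset.sum_congr rfl fun a _ => ?_
    rw [sndFDeriv_eq_of_eventuallyEq_comp hh hτ hh₀, sndFDeriv_eq_of_eventuallyEq_comp hF hτ hF₀,
      dF, inner_add_right, h1]
    ring

/-! ### The induced metric in coordinates -/

/-- The components of the metric induced by `F`. -/
def localMetric {n m : ℕ} (F : E n → E m) (u : E n) : Matrix (Fin n) (Fin n) ℝ :=
  Matrix.of fun i j => inner ℝ (pd i F u) (pd j F u)

/-- The second fundamental form. -/
def sff {n : ℕ} (F N : E n → E (n + 1)) (u v w : E n) : ℝ :=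
  inner ℝ (fderiv ℝ (fderiv ℝ F) u v w) (N u)

lemma eq_sum_single {n : ℕ} (v : E n) : v = ∑ i, v i • EuclideanSpace.single i (1 : ℝ) := by
  have := (EuclideanSpace.basisFun (Fin n) ℝ).sum_repr v
  simpa using this.symm

section Calculus

variable {n : ℕ} {W : Type*} [NormedAddCommGroup W] [NormedSpace ℝ W]

lemma fderiv_eq_sum_pd (F : E n → W) (u v : E n) : fderiv ℝ F u v = ∑ i, v i • pd i F u := by
  conv_lhs => rw [eq_sum_single v]
  simp [pd]

lemma pd_pd {F : E n → W} {u : E n} (hF : ContDiffAt ℝ ∞ F u) (i j : Fin n) :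
    pd i (pd j F) u = fderiv ℝ (fderiv ℝ F) u (EuclideanSpace.single i 1)
      (EuclideanSpace.single j 1) := by
  have h := ((hasFDerivAt_fderiv_of_contDiffAt hF).clm_apply
    (hasFDerivAt_const (EuclideanSpace.single j (1 : ℝ)) u)).fderiv
  have e : pd j F = fun u => fderiv ℝ F u (EuclideanSpace.single j 1) := rfl
  rw [pd, e, h]
  simp

end Calculus

namespace IsLocalHypersurface

variable {n : ℕ} {F N : E n → E (n + 1)} {Ω : Set (E n)} {u : E n}

lemma sff_comm (H : IsLocalHypersurface F N Ω) (hu : u ∈ Ω) (v w : E n) :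
    sff F N u v w = sff F N u w v := by
  rw [sff, sndFDeriv_comm (H.contDiffAt hu), sff]

lemma sff_eq (H : IsLocalHypersurface F N Ω) (hu : u ∈ Ω) (v w : E n) :
    sff F N u v w = -inner ℝ (fderiv ℝ N u v) (fderiv ℝ F u w) := by
  rw [H.inner_fderiv_normal_fderiv hu, neg_neg, sff]

lemma isUnit_det_localMetric (H : IsLocalHypersurface F N Ω) (hu : u ∈ Ω) :
    IsUnit (localMetric F u).det := by
  rw [isUnit_iff_ne_zero]
  intro h
  obtain ⟨x, hx0, hx⟩ := Matrix.exists_mulVec_eq_zero_iff.2 h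
  set v : E n := WithLp.toLp 2 x with hv
  have h1 : inner ℝ (fderiv ℝ F u v) (fderiv ℝ F u v) = 0 := by
    have h2 : ∀ i, inner ℝ (pd i F u) (fderiv ℝ F u v) = 0 := fun i => by
      have := congrFun hx i
      simp only [Matrix.mulVec, dotProduct, localMetric, Matrix.of_apply, Pi.zero_apply] at this
      rw [fderiv_eq_sum_pd, inner_sum, ← this]
      refine Finset.sum_congr rfl fun j _ => ?_
      rw [real_inner_smul_right, mul_comm]
    conv_lhs => rw [fderiv_eq_sum_pd F u v, sum_inner]
    rw [← fderiv_eq_sum_pd F u v]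
    simp [real_inner_smul_left, h2]
  have h3 : v = 0 := H.injective u hu (by rw [inner_self_eq_zero.1 h1, map_zero])
  exact hx0 (by simpa [hv] using h3)

lemma pd_localMetric (H : IsLocalHypersurface F N Ω) (hu : u ∈ Ω) (i j l : Fin n) :
    pd i (fun v => localMetric F v j l) u
      = inner ℝ (pd i (pd j F) u) (pd l F u) + inner ℝ (pd j F u) (pd i (pd l F) u) := by
  have hd : ∀ j, HasFDerivAt (pd j F) (fderiv ℝ (pd j F) u) u := fun j =>
    hasFDerivAt_of_contDiffAt ((contDiffAt_fderiv (H.contDiffAt hu)).clm_apply contDiffAt_const)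
  have h := ((hd j).inner ℝ (hd l)).fderiv
  have e : (fun v => localMetric F v j l) = fun v => inner ℝ (pd j F v) (pd l F v) := rfl
  rw [pd, e, h]
  simp [pd, add_comm]

/-- The Christoffel symbols are the components of the tangential part of the second
derivatives. -/
lemma christoffel_eq (H : IsLocalHypersurface F N Ω) (hu : u ∈ Ω) (k i j : Fin n) :
    christoffel (localMetric F) k i j u
      = pinv (fderiv ℝ F u) (fderiv ℝ (fderiv ℝ F) u (EuclideanSpace.single i 1)
        (EuclideanSpace.single j 1)) k := by
  set z := fderiv ℝ (fderiv ℝ F) u (EuclideanSpace.single i 1) (EuclideanSpace.single j 1) with hz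
  set C := pinv (fderiv ℝ F u) z with hC
  have hNN : inner ℝ (N u) (N u) = 1 := by
    rw [real_inner_self_eq_norm_sq, H.norm_normal u hu, one_pow]
  have hdC : fderiv ℝ F u C = z - inner ℝ z (N u) • N u := by
    have e : C = pinv (fderiv ℝ F u) (z - inner ℝ z (N u) • N u) := by
      rw [map_sub, map_smul, H.pinv_normal hu, smul_zero, sub_zero]
    rw [e]
    refine H.fderiv_pinv hu ?_
    rw [inner_sub_left, real_inner_smul_left, hNN]
    ring
  -- Of the six scalar products produced by the three metric derivatives, four cancel in pairs by
  -- symmetry of second derivatives, and the other two both equal the product of ∂_l F with ∂_i ∂_j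
  -- F.
  have hco : ∀ l, (1 / 2) * (pd i (fun v => localMetric F v j l) u
      + pd j (fun v => localMetric F v i l) u - pd l (fun v => localMetric F v i j) u)
      = ∑ m, localMetric F u l m * C m := by
    intro l
    have e1 : ∑ m, localMetric F u l m * C m = inner ℝ (pd l F u) z := by
      have : inner ℝ (pd l F u) z = inner ℝ (pd l F u) (fderiv ℝ F u C) := by
        rw [hdC, inner_sub_right, real_inner_smul_right, pd, H.orthogonal u hu]
        ring
      rw [this, fderiv_eq_sum_pd F u C, inner_sum]
      refine Finset.sum_congr rfl fun m _ => ?_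
      rw [real_inner_smul_right, mul_comm]
      rfl
    have sym : ∀ a b, pd a (pd b F) u = pd b (pd a F) u := fun a b => by
      rw [pd_pd (H.contDiffAt hu), pd_pd (H.contDiffAt hu), sndFDeriv_comm (H.contDiffAt hu)]
    rw [e1, H.pd_localMetric hu, H.pd_localMetric hu, H.pd_localMetric hu, sym l i, sym l j,
      sym j i, hz, ← pd_pd (H.contDiffAt hu)]
    rw [real_inner_comm (pd l F u) (pd i (pd j F) u), real_inner_comm (pd i (pd l F) u) (pd j F u)]
    ring
  have hG := Matrix.nonsing_inv_mul _ (H.isUnit_det_localMetric hu)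
  have e2 : (localMetric F u)⁻¹.mulVec ((localMetric F u).mulVec C) = C := by
    rw [Matrix.mulVec_mulVec, hG, Matrix.one_mulVec]
  rw [christoffel, Finset.mul_sum]
  conv_rhs => rw [← congrFun e2 k]
  rw [Matrix.mulVec]
  refine Finset.sum_congr rfl fun l _ => ?_
  rw [Matrix.mulVec, dotProduct, ← hco l]
  ring

lemma sum_christoffel_smul (H : IsLocalHypersurface F N Ω) (hu : u ∈ Ω) {W : Type*}
    [NormedAddCommGroup W] [NormedSpace ℝ W] (Φ : E n → W) (i j : Fin n) :
    ∑ k, christoffel (localMetric F) k i j u • pd k Φ u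
      = fderiv ℝ Φ u (pinv (fderiv ℝ F u) (fderiv ℝ (fderiv ℝ F) u (EuclideanSpace.single i 1)
        (EuclideanSpace.single j 1))) := by
  rw [fderiv_eq_sum_pd]
  exact Finset.sum_congr rfl fun k _ => by rw [H.christoffel_eq hu]

end IsLocalHypersurface

/-! ### The Gauss equation -/

/-- The Christoffel form of the induced connection. -/
def conn {n : ℕ} (F : E n → E (n + 1)) (u v w : E n) : E n :=
  pinv (fderiv ℝ F u) (fderiv ℝ (fderiv ℝ F) u v w)

/-- Expansion of a bilinear map in the standard basis. -/
lemma clm₂_apply_eq_sum {n : ℕ} {W : Type*} [NormedAddCommGroup W] [NormedSpace ℝ W]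
    (L : E n →L[ℝ] E n →L[ℝ] W) (v w : E n) :
    L v w = ∑ i, ∑ j, (v i * w j) • L (EuclideanSpace.single i 1) (EuclideanSpace.single j 1) := by
  conv_lhs => rw [eq_sum_single v, eq_sum_single w]
  simp only [map_sum, map_smul, sum_apply, smul_apply, Finset.smul_sum, mul_smul]
  rw [Finset.sum_comm]
  exact Finset.sum_congr rfl fun i _ => Finset.sum_congr rfl fun j _ => smul_comm _ _ _

lemma sum_comm_four {n : ℕ} (f : Fin n → Fin n → Fin n → Fin n → Fin n → ℝ) :
    ∑ i, ∑ j, ∑ k, ∑ l, ∑ a, f i j k l a = ∑ a, ∑ i, ∑ j, ∑ k, ∑ l, f i j k l a := by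
  rw [Finset.sum_comm (f := fun a i => ∑ j, ∑ k, ∑ l, f i j k l a)]
  refine Finset.sum_congr rfl fun i _ => ?_
  rw [Finset.sum_comm (f := fun a j => ∑ k, ∑ l, f i j k l a)]
  refine Finset.sum_congr rfl fun j _ => ?_
  rw [Finset.sum_comm (f := fun a k => ∑ l, f i j k l a)]
  refine Finset.sum_congr rfl fun k _ => ?_
  rw [Finset.sum_comm]

namespace IsLocalHypersurface

variable {n : ℕ} {F N : E n → E (n + 1)} {Ω : Set (E n)} {u : E n}

/-- The Gauss formula. -/
lemma fderiv_conn (H : IsLocalHypersurface F N Ω) (hu : u ∈ Ω) (v w : E n) :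
    fderiv ℝ F u (conn F u v w)
      = fderiv ℝ (fderiv ℝ F) u v w - sff F N u v w • N u := by
  set z := fderiv ℝ (fderiv ℝ F) u v w with hz
  have hNN : inner ℝ (N u) (N u) = 1 := by
    rw [real_inner_self_eq_norm_sq, H.norm_normal u hu, one_pow]
  have e : conn F u v w = pinv (fderiv ℝ F u) (z - sff F N u v w • N u) := by
    rw [map_sub, map_smul, H.pinv_normal hu, smul_zero, sub_zero, conn]
  rw [e]
  refine H.fderiv_pinv hu ?_
  rw [inner_sub_left, real_inner_smul_left, hNN, sff]
  ring

lemma inner_fderiv_conn (H : IsLocalHypersurface F N Ω) (hu : u ∈ Ω) (v w z : E n) :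
    inner ℝ (fderiv ℝ F u (conn F u v w)) (fderiv ℝ F u z)
      = inner ℝ (fderiv ℝ (fderiv ℝ F) u v w) (fderiv ℝ F u z) := by
  rw [H.fderiv_conn hu, inner_sub_left, real_inner_smul_left,
    real_inner_comm (fderiv ℝ F u z) (N u), H.orthogonal u hu]
  ring

lemma contDiffAt_conn (H : IsLocalHypersurface F N Ω) (hu : u ∈ Ω) (v w : E n) :
    ContDiffAt ℝ ∞ (fun t => conn F t v w) u :=
  (H.contDiffAt_pinv_fderiv hu).clm_apply
    (((contDiffAt_fderiv (contDiffAt_fderiv (H.contDiffAt hu))).clm_apply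
      contDiffAt_const).clm_apply contDiffAt_const)

/-- Differentiate the Gauss formula in the direction x and take the tangential part. The third
derivative on the right is symmetric in x and y, so antisymmetrizing leaves only products of second
fundamental forms, as in the Gauss equation. -/
lemma inner_fderiv_covariant (H : IsLocalHypersurface F N Ω) (hu : u ∈ Ω) (x y z w : E n) :
    inner ℝ (fderiv ℝ F u (fderiv ℝ (fun t => conn F t y z) u x + conn F u x (conn F u y z)))
      (fderiv ℝ F u w)
    = inner ℝ (fderiv ℝ (fderiv ℝ (fderiv ℝ F)) u x y z) (fderiv ℝ F u w)
      + sff F N u y z * sff F N u x w := by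
  have hC := hasFDerivAt_of_contDiffAt (H.contDiffAt_conn hu y z)
  have hF := hasFDerivAt_fderiv_of_contDiffAt (H.contDiffAt hu)
  have hD2 := ((hasFDerivAt_fderiv_of_contDiffAt (contDiffAt_fderiv (H.contDiffAt hu))).clm_apply
    (hasFDerivAt_const y u)).clm_apply (hasFDerivAt_const z u)
  have hN := hasFDerivAt_of_contDiffAt (H.contDiffAt_normal hu)
  have hb : HasFDerivAt (fun t => sff F N t y z) (fderiv ℝ (fun t => sff F N t y z) u) u :=
    hasFDerivAt_of_contDiffAt
      ((((contDiffAt_fderiv (contDiffAt_fderiv (H.contDiffAt hu))).clm_apply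
        contDiffAt_const).clm_apply contDiffAt_const).inner ℝ (H.contDiffAt_normal hu))
  have h1 := hF.clm_apply hC
  have h2 := hD2.sub (hb.smul hN)
  have h3 : (fun t => fderiv ℝ F t (conn F t y z)) =ᶠ[𝓝 u]
      fun t => fderiv ℝ (fderiv ℝ F) t y z - sff F N t y z • N t :=
    eventually_of_mem (H.isOpen.mem_nhds hu) fun t ht => H.fderiv_conn ht y z
  have h4 := congrArg (fun L => L x) (h1.unique (h2.congr_of_eventuallyEq h3))
  simp at h4
  rw [map_add, inner_add_left, H.inner_fderiv_conn hu]
  have h5 := congrArg (fun s => inner ℝ s (fderiv ℝ F u w)) h4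
  simp only [inner_add_left, inner_sub_left, real_inner_smul_left] at h5
  rw [real_inner_comm (fderiv ℝ F u w) (N u), H.orthogonal u hu] at h5
  rw [h5, H.sff_eq hu x w]
  ring

/-- The **Gauss equation**. -/
lemma riemann_eq (H : IsLocalHypersurface F N Ω) (hu : u ∈ Ω) (i j k l : Fin n) :
    riemann (localMetric F) i j k l u
      = sff F N u (EuclideanSpace.single j 1) (EuclideanSpace.single k 1)
          * sff F N u (EuclideanSpace.single i 1) (EuclideanSpace.single l 1)
        - sff F N u (EuclideanSpace.single i 1) (EuclideanSpace.single k 1)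
          * sff F N u (EuclideanSpace.single j 1) (EuclideanSpace.single l 1) := by
  have hpd : ∀ i j k m : Fin n, pd i (christoffel (localMetric F) m j k) u
      = fderiv ℝ (fun t => conn F t (EuclideanSpace.single j 1) (EuclideanSpace.single k 1)) u
          (EuclideanSpace.single i 1) m := by
    intro i j k m
    have h1 : christoffel (localMetric F) m j k =ᶠ[𝓝 u] fun t =>
        EuclideanSpace.proj (𝕜 := ℝ) m
          (conn F t (EuclideanSpace.single j 1) (EuclideanSpace.single k 1)) :=
      eventually_of_mem (H.isOpen.mem_nhds hu) fun t ht => H.christoffel_eq ht m j k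
    rw [pd, h1.fderiv_eq]
    have h2 := hasFDerivAt_of_contDiffAt (H.contDiffAt_conn hu (EuclideanSpace.single j 1)
      (EuclideanSpace.single k 1))
    exact congrArg (fun L => L (EuclideanSpace.single i 1))
      ((EuclideanSpace.proj (𝕜 := ℝ) m).hasFDerivAt.comp u h2).fderiv
  have hcc : ∀ i j k m : Fin n, ∑ a, christoffel (localMetric F) m i a u
      * christoffel (localMetric F) a j k u
      = conn F u (EuclideanSpace.single i 1)
          (conn F u (EuclideanSpace.single j 1) (EuclideanSpace.single k 1)) m := by
    intro i j k m
    set C := conn F u (EuclideanSpace.single j 1) (EuclideanSpace.single k 1) with hC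
    have e : conn F u (EuclideanSpace.single i 1) C
        = ∑ a, C a • conn F u (EuclideanSpace.single i 1) (EuclideanSpace.single a 1) := by
      conv_lhs => rw [eq_sum_single C]
      simp only [conn, map_sum, map_smul]
    rw [e]
    simp only [WithLp.ofLp_sum, Finset.sum_apply, PiLp.smul_apply, smul_eq_mul]
    refine Finset.sum_congr rfl fun a _ => ?_
    rw [H.christoffel_eq hu, H.christoffel_eq hu, mul_comm]
    rfl
  have hsum : ∀ v : E n, ∑ m, v m * localMetric F u m l
      = inner ℝ (fderiv ℝ F u v) (fderiv ℝ F u (EuclideanSpace.single l 1)) := by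
    intro v
    rw [fderiv_eq_sum_pd F u v, sum_inner]
    refine Finset.sum_congr rfl fun m _ => ?_
    rw [real_inner_smul_left]
    rfl
  have key : ∀ i j m, riemannUp (localMetric F) i j k m u
      = ((fderiv ℝ (fun t => conn F t (EuclideanSpace.single j 1) (EuclideanSpace.single k 1)) u
          (EuclideanSpace.single i 1) + conn F u (EuclideanSpace.single i 1)
          (conn F u (EuclideanSpace.single j 1) (EuclideanSpace.single k 1)))
        - (fderiv ℝ (fun t => conn F t (EuclideanSpace.single i 1) (EuclideanSpace.single k 1)) u
          (EuclideanSpace.single j 1) + conn F u (EuclideanSpace.single j 1)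
          (conn F u (EuclideanSpace.single i 1) (EuclideanSpace.single k 1)))) m := by
    intro i j m
    rw [riemannUp, hpd, hpd, Finset.sum_sub_distrib, hcc, hcc]
    simp only [PiLp.sub_apply, PiLp.add_apply]
    ring
  simp only [riemann, key]
  rw [hsum, map_sub, inner_sub_left, H.inner_fderiv_covariant hu, H.inner_fderiv_covariant hu,
    sndFDeriv_comm (contDiffAt_fderiv (H.contDiffAt hu)) (EuclideanSpace.single i 1)]
  ring

lemma sff_eq_sum (v w : E n) : sff F N u v w = ∑ i, ∑ j, v i * w j *
    sff F N u (EuclideanSpace.single i 1) (EuclideanSpace.single j 1) := by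
  rw [sff, clm₂_apply_eq_sum]
  simp only [sum_inner, real_inner_smul_left]
  rfl

lemma sum_mul_riemann (H : IsLocalHypersurface F N Ω) (hu : u ∈ Ω) (v w : E n) :
    ∑ i, ∑ j, ∑ k, ∑ l, v i * w j * w k * v l * riemann (localMetric F) i j k l u
      = sff F N u v v * sff F N u w w - sff F N u v w ^ 2 := by
  have e1 : ∑ i, ∑ j, ∑ k, ∑ l, v i * w j * w k * v l * riemann (localMetric F) i j k l u
      = ∑ i, ∑ j, ∑ k, ∑ l,
        ((v i * v l * sff F N u (EuclideanSpace.single i 1) (EuclideanSpace.single l 1))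
          * (w j * w k * sff F N u (EuclideanSpace.single j 1) (EuclideanSpace.single k 1))
        - (v i * w k * sff F N u (EuclideanSpace.single i 1) (EuclideanSpace.single k 1))
          * (w j * v l * sff F N u (EuclideanSpace.single j 1) (EuclideanSpace.single l 1))) := by
    refine Finset.sum_congr rfl fun i _ => Finset.sum_congr rfl fun j _ =>
      Finset.sum_congr rfl fun k _ => Finset.sum_congr rfl fun l _ => ?_
    rw [H.riemann_eq hu]
    ring
  rw [e1, pow_two]
  nth_rewrite 4 [H.sff_comm hu]
  rw [sff_eq_sum v v, sff_eq_sum w w, sff_eq_sum v w, sff_eq_sum w v]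
  simp only [Finset.sum_sub_distrib, ← Finset.sum_mul, ← Finset.mul_sum]

/-- If P has the frame vectors as columns and G is the metric, orthonormality reads PᵀGP = 1, so G⁻¹
= PPᵀ. This converts coordinate contractions into sums over a frame. -/
lemma inv_localMetric_apply {ε : Fin n → E n}
    (hε : Orthonormal ℝ fun a => fderiv ℝ F u (ε a)) (i j : Fin n) :
    (localMetric F u)⁻¹ i j = ∑ a, ε a i * ε a j := by
  set P : Matrix (Fin n) (Fin n) ℝ := Matrix.of fun i a => ε a i with hP
  have h1 : (P.transpose * localMetric F u) * P = 1 := by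
    ext a b
    rw [Matrix.one_apply, ← orthonormal_iff_ite.1 hε a b, fderiv_eq_sum_pd F u (ε a),
      fderiv_eq_sum_pd F u (ε b)]
    simp only [Matrix.mul_apply, Matrix.transpose_apply, hP, Matrix.of_apply, localMetric,
      sum_inner, inner_sum, real_inner_smul_left, real_inner_smul_right, Finset.sum_mul]
    refine Finset.sum_congr rfl fun x _ => Finset.sum_congr rfl fun y _ => ?_
    rw [real_inner_comm (pd x F u) (pd y F u)]
    ring
  have h2 := mul_eq_one_comm.1 h1
  have h3 : (localMetric F u)⁻¹ = P * P.transpose := by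
    refine Matrix.inv_eq_left_inv ?_
    rw [Matrix.mul_assoc, h2]
  rw [h3]
  rfl

lemma sum_inv_localMetric_smul {ε : Fin n → E n}
    (hε : Orthonormal ℝ fun a => fderiv ℝ F u (ε a)) {W : Type*} [NormedAddCommGroup W]
    [NormedSpace ℝ W] (L : E n →L[ℝ] E n →L[ℝ] W) :
    ∑ i, ∑ j, (localMetric F u)⁻¹ i j •
      L (EuclideanSpace.single i 1) (EuclideanSpace.single j 1) = ∑ a, L (ε a) (ε a) := by
  simp only [inv_localMetric_apply hε, Finset.sum_smul]
  simp only [fun a => clm₂_apply_eq_sum L (ε a) (ε a)]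
  rw [Finset.sum_comm (f := fun a i => ∑ j, (ε a i * ε a j) •
    L (EuclideanSpace.single i 1) (EuclideanSpace.single j 1))]
  exact Finset.sum_congr rfl fun i _ => Finset.sum_comm

lemma coordLaplacian_eq (H : IsLocalHypersurface F N Ω) (hu : u ∈ Ω) {ε : Fin n → E n}
    (hε : Orthonormal ℝ fun a => fderiv ℝ F u (ε a)) {W : Type*} [NormedAddCommGroup W]
    [NormedSpace ℝ W] {Φ : E n → W} (hΦ : ContDiffAt ℝ ∞ Φ u) :
    coordLaplacian (localMetric F) Φ u
      = -∑ a, (fderiv ℝ (fderiv ℝ Φ) u (ε a) (ε a) - fderiv ℝ Φ u (conn F u (ε a) (ε a))) := by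
  have h := sum_inv_localMetric_smul hε (fderiv ℝ (fderiv ℝ Φ) u
    - (ContinuousLinearMap.compL ℝ (E n) (E (n + 1)) W
      (fderiv ℝ Φ u ∘L pinv (fderiv ℝ F u))) ∘L fderiv ℝ (fderiv ℝ F) u)
  rw [coordLaplacian]
  simp only [pd_pd hΦ, H.sum_christoffel_smul hu]
  exact congrArg Neg.neg h

lemma sum_inv_mul_riemann (H : IsLocalHypersurface F N Ω) (hu : u ∈ Ω) {ε : Fin n → E n}
    (hε : Orthonormal ℝ fun a => fderiv ℝ F u (ε a)) :
    ∑ i, ∑ j, ∑ k, ∑ l, (localMetric F u)⁻¹ i l * (localMetric F u)⁻¹ j k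
        * riemann (localMetric F) i j k l u
      = ∑ a, ∑ b, (sff F N u (ε a) (ε a) * sff F N u (ε b) (ε b)
        - sff F N u (ε a) (ε b) ^ 2) := by
  simp only [inv_localMetric_apply hε, Finset.sum_mul_sum, ← H.sum_mul_riemann hu]
  simp only [Finset.sum_mul]
  rw [sum_comm_four]
  refine Finset.sum_congr rfl fun a _ => ?_
  rw [sum_comm_four]
  refine Finset.sum_congr rfl fun b _ => Finset.sum_congr rfl fun i _ =>
    Finset.sum_congr rfl fun j _ => Finset.sum_congr rfl fun k _ =>
    Finset.sum_congr rfl fun l _ => by ring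

end IsLocalHypersurface

/-! ### Equality in Chen's inequality -/

/-- The algebraic equality case: a symmetric matrix for which equality holds in Chen's inequality
is `m = T / (s + 1)` times the identity on the second block, where `T` is the trace. -/
lemma eq_of_chen_equality {α β : Type*} [Fintype α] [Fintype β] [DecidableEq β]
    (B : α ⊕ β → α ⊕ β → ℝ) {T : ℝ} (hT : T = ∑ i, B i i)
    (h : (T ^ 2 - ∑ i, ∑ j, B i j ^ 2)
        - ((∑ a, B (.inl a) (.inl a)) ^ 2 - ∑ a, ∑ b, B (.inl a) (.inl b) ^ 2)
      = T ^ 2 * (Fintype.card β / (Fintype.card β + 1))) (x : β) :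
    B (.inr x) (.inr x) = T / (Fintype.card β + 1) ∧ (∀ y, y ≠ x → B (.inr x) (.inr y) = 0) ∧
      ∀ a, B (.inr x) (.inl a) = 0 := by
  set s : ℝ := (Fintype.card β : ℝ) with hs
  set m := T / (s + 1) with hm
  have hs1 : s + 1 ≠ 0 := by positivity
  have hTm : T = m * (s + 1) := by rw [hm]; field_simp
  set S := ∑ a, B (.inl a) (.inl a) with hS
  set D := ∑ x, ∑ y, if y = x then 0 else B (.inr x) (.inr y) ^ 2 with hD
  have hD2 : ∑ x, ∑ y, B (.inr x) (.inr y) ^ 2 = ∑ x, B (.inr x) (.inr x) ^ 2 + D := by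
    rw [hD, ← Finset.sum_add_distrib]
    refine Finset.sum_congr rfl fun x _ => ?_
    have : B (.inr x) (.inr x) ^ 2 = ∑ y, if y = x then B (.inr x) (.inr y) ^ 2 else 0 := by simp
    rw [this, ← Finset.sum_add_distrib]
    refine Finset.sum_congr rfl fun y _ => ?_
    split_ifs <;> simp
  simp only [Fintype.sum_sum_type, Finset.sum_add_distrib] at h hT
  rw [hD2] at h
  set A1 := ∑ a, ∑ b, B (.inl a) (.inr b) ^ 2 with hA1
  set A2 := ∑ a, ∑ b, B (.inr a) (.inl b) ^ 2 with hA2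
  have e1 : ∑ x, (B (.inr x) (.inr x) - m) ^ 2
      = ∑ x, B (.inr x) (.inr x) ^ 2 - 2 * m * ∑ x, B (.inr x) (.inr x) + s * m ^ 2 := by
    simp only [sub_sq, Finset.sum_add_distrib, Finset.sum_sub_distrib, Finset.mul_sum]
    simp only [Finset.sum_const, Finset.card_univ, nsmul_eq_mul, hs]
    congr 2
    exact Finset.sum_congr rfl fun x _ => by ring
  have n1 : 0 ≤ A1 := Finset.sum_nonneg fun _ _ => Finset.sum_nonneg fun _ _ => sq_nonneg _
  have n2 : 0 ≤ A2 := Finset.sum_nonneg fun _ _ => Finset.sum_nonneg fun _ _ => sq_nonneg _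
  have p3 : ∀ x y, 0 ≤ if y = x then 0 else B (.inr x) (.inr y) ^ 2 := fun x y => by
    split_ifs <;> positivity
  have n3 : 0 ≤ D := Finset.sum_nonneg fun x _ => Finset.sum_nonneg fun y _ => p3 x y
  have n4 : 0 ≤ ∑ x, (B (.inr x) (.inr x) - m) ^ 2 := Finset.sum_nonneg fun _ _ => sq_nonneg _
  have h' : T ^ 2 * (s / (s + 1)) = m ^ 2 * s * (s + 1) := by rw [hTm]; field_simp
  -- With T = m(s + 1), the defect in Chen's inequality is exactly this sum of squares: the two
  -- off-diagonal blocks, the off-diagonal part of the second block, and the deviations from m of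
  -- the trace of the first block and of the diagonal entries of the second.
  have key : A1 + A2 + D + (S - m) ^ 2 + ∑ x, (B (.inr x) (.inr x) - m) ^ 2 = 0 := by
    rw [e1]
    rw [h'] at h
    have : ∑ x, B (.inr x) (.inr x) = m * (s + 1) - S := by linarith
    rw [this]
    rw [hTm] at h
    linear_combination -h
  have n5 := sq_nonneg (S - m)
  have z2 : A2 = 0 := by linarith
  have z3 : D = 0 := by linarith
  have z4 : ∑ x, (B (.inr x) (.inr x) - m) ^ 2 = 0 := by linarith
  refine ⟨?_, fun y hy => ?_, fun a => ?_⟩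
  · have := (Finset.sum_eq_zero_iff_of_nonneg fun _ _ => sq_nonneg _).1 z4 x (Finset.mem_univ x)
    nlinarith [pow_eq_zero_iff two_ne_zero |>.1 this]
  · have := (Finset.sum_eq_zero_iff_of_nonneg fun x _ => Finset.sum_nonneg fun y _ => p3 x y).1
      z3 x (Finset.mem_univ x)
    have := (Finset.sum_eq_zero_iff_of_nonneg fun y _ => p3 x y).1 this y (Finset.mem_univ y)
    rw [if_neg hy] at this
    exact pow_eq_zero_iff two_ne_zero |>.1 this
  · have := (Finset.sum_eq_zero_iff_of_nonneg
      fun x _ => Finset.sum_nonneg fun y _ => sq_nonneg _).1 z2 x (Finset.mem_univ x)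
    have := (Finset.sum_eq_zero_iff_of_nonneg fun y _ => sq_nonneg _).1 this a (Finset.mem_univ a)
    exact pow_eq_zero_iff two_ne_zero |>.1 this

/-- A sum of a symmetric function over pairs `a < b`. -/
lemma two_mul_sum_lt {r : ℕ} (f : Fin r → Fin r → ℝ) (hs : ∀ a b, f a b = f b a)
    (h0 : ∀ a, f a a = 0) :
    2 * ∑ a, ∑ b, (if a < b then f a b else 0) = ∑ a, ∑ b, f a b := by
  have h1 : ∑ a, ∑ b, (if a < b then f a b else 0) = ∑ a, ∑ b, (if b < a then f a b else 0) := by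
    rw [Finset.sum_comm]
    exact Finset.sum_congr rfl fun a _ => Finset.sum_congr rfl fun b _ => by rw [hs]
  rw [two_mul]
  nth_rewrite 2 [h1]
  simp only [← Finset.sum_add_distrib]
  refine Finset.sum_congr rfl fun a _ => Finset.sum_congr rfl fun b _ => ?_
  rcases lt_trichotomy a b with h | h | h
  · simp [h, h.not_gt]
  · simp [h, h0]
  · simp [h, h.not_gt]

/-! ### Orthonormal frames -/

section Frames

variable {n m : ℕ}

/-- The left inverse of L bounds the frame vectors. Compactness ensures that the infimum defining
δ(r) is attained. -/
lemma isCompact_orthonormal_frames {L : E n →L[ℝ] E m} (hL : Function.Injective L) (r : ℕ) :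
    IsCompact {e : Fin r → E n | Orthonormal ℝ fun a => L (e a)} := by
  refine Metric.isCompact_of_isClosed_isBounded ?_ ?_
  · simp only [orthonormal_iff_ite, Set.ofPred_forall]
    refine isClosed_iInter fun a => isClosed_iInter fun b => isClosed_eq ?_ continuous_const
    fun_prop
  · refine (Metric.isBounded_closedBall (x := 0) (r := ‖pinv L‖)).subset fun e he => ?_
    rw [mem_closedBall_zero_iff, pi_norm_le_iff_of_nonneg (norm_nonneg _)]
    intro a
    have h1 : ‖L (e a)‖ = 1 := he.1 a
    calc ‖e a‖ = ‖pinv L (L (e a))‖ := by rw [pinv_apply_apply hL]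
      _ ≤ ‖pinv L‖ * ‖L (e a)‖ := (pinv L).le_opNorm _
      _ = ‖pinv L‖ := by rw [h1, mul_one]

lemma exists_orthonormal_extension {L : E n →L[ℝ] E m} (hL : Function.Injective L) {r s : ℕ}
    (hrs : r + s = n) {e : Fin r → E n} (he : Orthonormal ℝ fun a => L (e a)) :
    ∃ ε : Fin r ⊕ Fin s → E n, (Orthonormal ℝ fun a => L (ε a)) ∧ ∀ a, ε (.inl a) = e a := by
  set R := LinearMap.range L.toLinearMap with hR
  have h1 : Module.finrank ℝ R = Fintype.card (Fin r ⊕ Fin s) := by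
    rw [LinearMap.finrank_range_of_inj hL]; simp [hrs]
  let v : Fin r ⊕ Fin s → R := Sum.elim (fun a => ⟨L (e a), e a, rfl⟩) fun _ => 0
  have hv : Orthonormal ℝ ((Set.range Sum.inl).domRestrict v) := by
    have h2 : Orthonormal ℝ fun a : Fin r => (⟨L (e a), e a, rfl⟩ : R) :=
      (R.subtypeₗᵢ.orthonormal_comp_iff).1 he
    have h3 := h2.comp (Equiv.ofInjective (Sum.inl : Fin r → Fin r ⊕ Fin s)
      Sum.inl_injective).symm (Equiv.injective _)
    convert h3 using 1
    ext1 ⟨_, a, rfl⟩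
    simp [v, Set.domRestrict]
  obtain ⟨b, hb⟩ := hv.exists_orthonormalBasis_extension_of_card_eq h1
  have ho : Orthonormal ℝ fun j => (b j : E m) := b.orthonormal.comp_linearIsometry R.subtypeₗᵢ
  choose ε hε using fun j => (b j).2
  have hε' : ∀ j, L (ε j) = b j := hε
  refine ⟨ε, by simpa only [hε'] using ho, fun a => hL ?_⟩
  rw [hε', hb _ ⟨a, rfl⟩]
  rfl

lemma trace_eq_sum_inner {L : E n →L[ℝ] E m} {ε : Fin n → E n}
    (hε : Orthonormal ℝ fun a => L (ε a)) (T : E n →ₗ[ℝ] E n) :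
    LinearMap.trace ℝ (E n) T = ∑ a, inner ℝ (L (T (ε a))) (L (ε a)) := by
  have hli : LinearIndependent ℝ ε := hε.linearIndependent.of_comp L.toLinearMap
  by_cases h0 : n = 0
  · subst h0
    have : T = 0 := Subsingleton.elim _ _
    simp [this]
  have : Nonempty (Fin n) := ⟨⟨0, Nat.pos_of_ne_zero h0⟩⟩
  let b := basisOfLinearIndependentOfCardEqFinrank hli (by simp)
  have hb : ∀ a, b a = ε a := fun a => by simp [b]
  rw [LinearMap.trace_eq_matrix_trace ℝ b, Matrix.trace]
  refine Finset.sum_congr rfl fun a _ => ?_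
  rw [Matrix.diag_apply, LinearMap.toMatrix_apply]
  conv_rhs => rw [← hb a, ← b.sum_repr (T (b a))]
  simp only [map_sum, map_smul, hb]
  rw [hε.inner_left_fintype]
  simp

end Frames

namespace IsLocalHypersurface

variable {n : ℕ} {F N : E n → E (n + 1)} {Ω : Set (E n)} {u : E n}

lemma trace_localShape (H : IsLocalHypersurface F N Ω) (hu : u ∈ Ω) {ε : Fin n → E n}
    (hε : Orthonormal ℝ fun a => fderiv ℝ F u (ε a)) :
    LinearMap.trace ℝ (E n) (localShape F N u).toLinearMap = ∑ a, sff F N u (ε a) (ε a) := by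
  rw [trace_eq_sum_inner hε]
  refine Finset.sum_congr rfl fun a _ => ?_
  rw [H.sff_eq hu, ← inner_neg_left, ← H.fderiv_localShape hu]
  rfl

lemma eq_zero_of_inner_frame (H : IsLocalHypersurface F N Ω) (hu : u ∈ Ω) {ι : Type*} [Fintype ι]
    (hι : Fintype.card ι = n) {ε : ι → E n}
    (hε : Orthonormal ℝ fun a => fderiv ℝ F u (ε a)) {z : E (n + 1)} (hz : inner ℝ z (N u) = 0)
    (h : ∀ a, inner ℝ z (fderiv ℝ F u (ε a)) = 0) : z = 0 := by
  have hli : LinearIndependent ℝ ε := hε.linearIndependent.of_comp (fderiv ℝ F u).toLinearMap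
  have hsp := hli.span_eq_top_of_card_eq_finrank' (by simp [hι])
  refine H.eq_zero_of_inner hu hz fun v => ?_
  have hv : v ∈ Submodule.span ℝ (Set.range ε) := by rw [hsp]; trivial
  induction hv using Submodule.span_induction with
  | mem x hx => obtain ⟨a, rfl⟩ := hx; exact h a
  | zero => simp
  | add x y _ _ hx hy => rw [map_add, inner_add_right, hx, hy, add_zero]
  | smul c x _ hx => rw [map_smul, real_inner_smul_right, hx, mul_zero]

/-- On a `δ(r)`-ideal hypersurface, `n H / (n - r + 1)` is a principal curvature. -/
theorem exists_eigenvector_of_ideal (H : IsLocalHypersurface F N Ω) (hu : u ∈ Ω) {r : ℕ}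
    (hr : r < n) {h : ℝ}
    (htr : LinearMap.trace ℝ (E n) (localShape F N u).toLinearMap = n * h)
    (hid : (1 / 2) * (∑ i, ∑ j, ∑ k, ∑ l, (localMetric F u)⁻¹ i l * (localMetric F u)⁻¹ j k
        * riemann (localMetric F) i j k l u)
      - sInf {t : ℝ | ∃ e : Fin r → E n, (Orthonormal ℝ fun a => fderiv ℝ F u (e a)) ∧
        t = ∑ a, ∑ b, if a < b then (∑ i, ∑ j, ∑ k, ∑ l, e a i * e b j * e b k * e a l
          * riemann (localMetric F) i j k l u) else 0}
      = (n : ℝ) ^ 2 * ((n : ℝ) - r) / (2 * ((n : ℝ) - r + 1)) * h ^ 2) :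
    ∃ v ≠ 0, fderiv ℝ N u v = (-2 / ((n : ℝ) - r + 1) * (n / 2) * h) • fderiv ℝ F u v := by
  have hinj := H.injective u hu
  set K := {e : Fin r → E n | Orthonormal ℝ fun a => fderiv ℝ F u (e a)} with hK
  let g : (Fin r → E n) → ℝ := fun e => ∑ a, ∑ b, if a < b then
    (sff F N u (e a) (e a) * sff F N u (e b) (e b) - sff F N u (e a) (e b) ^ 2) else 0
  have hset : {t : ℝ | ∃ e : Fin r → E n, (Orthonormal ℝ fun a => fderiv ℝ F u (e a)) ∧
        t = ∑ a, ∑ b, if a < b then (∑ i, ∑ j, ∑ k, ∑ l, e a i * e b j * e b k * e a l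
          * riemann (localMetric F) i j k l u) else 0} = g '' K := by
    ext t
    simp only [H.sum_mul_riemann hu, Set.mem_ofPred_eq, Set.mem_image, hK, g]
    exact exists_congr fun e => and_congr_right fun _ => eq_comm
  have hg : Continuous g := by
    refine continuous_finsetSum _ fun a _ => continuous_finsetSum _ fun b _ => ?_
    have hc : ∀ a b, Continuous fun e : Fin r → E n => sff F N u (e a) (e b) := fun a b => by
      unfold sff
      fun_prop
    split_ifs
    · exact ((hc a a).mul (hc b b)).sub ((hc a b).pow 2)
    · exact continuous_const
  obtain ⟨ε₀, hε₀⟩ := exists_orthonormal_fderiv hinj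
  have hne : K.Nonempty :=
    ⟨fun a => ε₀ (Fin.castLE hr.le a), hε₀.comp _ (Fin.castLE_injective hr.le)⟩
  -- e spans a subspace realizing the infimum. Equality in Chen's inequality then holds for the
  -- block splitting given by e and its orthonormal completion.
  obtain ⟨e, he, hmin⟩ := ((isCompact_orthonormal_frames hinj r).image hg).sInf_mem
    (hne.image g)
  obtain ⟨s, hs⟩ : ∃ s, r + s = n := ⟨n - r, by omega⟩
  obtain ⟨ε, hε, hεe⟩ := exists_orthonormal_extension hinj hs he
  have hcard : Fintype.card (Fin r ⊕ Fin s) = n := by simp [hs]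
  let σ : Fin n ≃ Fin r ⊕ Fin s := Fintype.equivOfCardEq (by simp [hs])
  have hεσ : Orthonormal ℝ fun a => fderiv ℝ F u (ε (σ a)) := hε.comp σ σ.injective
  rw [hset, ← hmin, H.sum_inv_mul_riemann hu hεσ] at hid
  set B : Fin r ⊕ Fin s → Fin r ⊕ Fin s → ℝ := fun i j => sff F N u (ε i) (ε j) with hB
  have hT : (n : ℝ) * h = ∑ i, B i i := by
    rw [← htr, H.trace_localShape hu hεσ, ← Equiv.sum_comp σ]
  have e1 : ∑ a, ∑ b, (sff F N u (ε (σ a)) (ε (σ a)) * sff F N u (ε (σ b)) (ε (σ b))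
      - sff F N u (ε (σ a)) (ε (σ b)) ^ 2) = (n * h) ^ 2 - ∑ i, ∑ j, B i j ^ 2 := by
    rw [hT, pow_two, Finset.sum_mul_sum, ← Finset.sum_sub_distrib, ← Equiv.sum_comp σ]
    refine Finset.sum_congr rfl fun a _ => ?_
    rw [← Finset.sum_sub_distrib, ← Equiv.sum_comp σ]
  have e2 : 2 * g e = (∑ a, B (.inl a) (.inl a)) ^ 2 - ∑ a, ∑ b, B (.inl a) (.inl b) ^ 2 := by
    simp only [g]
    rw [two_mul_sum_lt (fun a b => sff F N u (e a) (e a) * sff F N u (e b) (e b)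
      - sff F N u (e a) (e b) ^ 2) (fun a b => by rw [H.sff_comm hu (e a) (e b)]; ring)
      (fun a => by ring)]
    simp only [hB, hεe, Finset.sum_sub_distrib]
    rw [pow_two (∑ a, _), Finset.sum_mul_sum]
  have hns : (n : ℝ) - r = s := by rw [← hs]; push_cast; ring
  have hs0 : (s : ℝ) + 1 ≠ 0 := by positivity
  have key := eq_of_chen_equality B hT (by
    rw [← e2, Fintype.card_fin]
    rw [e1, hns] at hid
    have : (n : ℝ) ^ 2 * s / (2 * (s + 1)) * h ^ 2 = (n * h) ^ 2 * (s / (s + 1)) / 2 := by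
      field_simp
    rw [this] at hid
    linear_combination 2 * hid)
  rw [Fintype.card_fin] at key
  -- As r < n, the second block is nonempty. Any frame vector in it is principal, with curvature n h
  -- / (s + 1) = n h / (n - r + 1).
  let x : Fin s := ⟨0, by omega⟩
  obtain ⟨k1, k2, k3⟩ := key x
  have hb : ∀ i, inner ℝ (fderiv ℝ N u (ε (.inr x))) (fderiv ℝ F u (ε i)) = -B (.inr x) i :=
    fun i => by rw [hB]; simp only [H.sff_eq hu, neg_neg]
  refine ⟨ε (.inr x), fun h0 => ?_, ?_⟩
  · have := hε.1 (.inr x)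
    simp [h0] at this
  rw [← sub_eq_zero, hns]
  refine H.eq_zero_of_inner_frame hu hcard hε ?_ fun i => ?_
  · rw [inner_sub_left, real_inner_smul_left, H.inner_fderiv_normal hu, H.orthogonal u hu]
    ring
  · rw [inner_sub_left, real_inner_smul_left, hb, orthonormal_iff_ite.1 hε]
    rcases i with a | y
    · simp [k3]
    · by_cases hy : y = x
      · subst hy
        rw [k1, if_pos rfl]
        ring
      · rw [k2 y hy, if_neg (fun hh => hy (Sum.inr_injective hh).symm)]
        ring

end IsLocalHypersurface

/-! ### The biharmonic equation -/

/-- The trace of an endomorphism as a continuous linear functional. -/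
def traceCLM (n : ℕ) : (E n →L[ℝ] E n) →L[ℝ] ℝ :=
  LinearMap.toContinuousLinearMap (LinearMap.trace ℝ (E n) ∘ₗ ContinuousLinearMap.coeLM ℝ)

namespace IsLocalHypersurface

variable {n : ℕ} {F N : E n → E (n + 1)} {Ω : Set (E n)} {u : E n}

lemma inner_sndFDeriv_normal (H : IsLocalHypersurface F N Ω) (hu : u ∈ Ω) (v : E n) :
    inner ℝ (fderiv ℝ (fderiv ℝ N) u v v) (N u) = -‖fderiv ℝ N u v‖ ^ 2 := by
  have hN := hasFDerivAt_of_contDiffAt (H.contDiffAt_normal hu)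
  have hdN := (hasFDerivAt_fderiv_of_contDiffAt (H.contDiffAt_normal hu)).clm_apply
    (hasFDerivAt_const v u)
  have h1 := (hdN.inner ℝ hN).fderiv
  have h2 : (fun t => inner ℝ (fderiv ℝ N t v) (N t)) =ᶠ[𝓝 u] fun _ => (0 : ℝ) :=
    eventually_of_mem (H.isOpen.mem_nhds hu) fun t ht => H.inner_fderiv_normal ht v
  rw [h2.fderiv_eq, fderiv_fun_const] at h1
  have := congrArg (fun L => L v) h1
  simp at this
  linarith

/-- The Codazzi equation, before subtracting the Christoffel terms. -/
lemma inner_sndFDeriv_normal_fderiv (H : IsLocalHypersurface F N Ω) (hu : u ∈ Ω) (x v w : E n) :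
    inner ℝ (fderiv ℝ (fderiv ℝ N) u x v) (fderiv ℝ F u w)
        + inner ℝ (fderiv ℝ N u v) (fderiv ℝ (fderiv ℝ F) u x w)
      = inner ℝ (fderiv ℝ (fderiv ℝ N) u x w) (fderiv ℝ F u v)
        + inner ℝ (fderiv ℝ N u w) (fderiv ℝ (fderiv ℝ F) u x v) := by
  have hN := fun v => (hasFDerivAt_fderiv_of_contDiffAt (H.contDiffAt_normal hu)).clm_apply
    (hasFDerivAt_const v u)
  have hF := fun v => (hasFDerivAt_fderiv_of_contDiffAt (H.contDiffAt hu)).clm_apply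
    (hasFDerivAt_const v u)
  have h2 : (fun t => inner ℝ (fderiv ℝ N t v) (fderiv ℝ F t w)) =ᶠ[𝓝 u]
      fun t => inner ℝ (fderiv ℝ N t w) (fderiv ℝ F t v) :=
    eventually_of_mem (H.isOpen.mem_nhds hu) fun t ht => H.inner_fderiv_normal_comm ht v w
  have h3 := ((hN v).inner ℝ (hF w)).unique
    (((hN w).inner ℝ (hF v)).congr_of_eventuallyEq h2)
  have := congrArg (fun L => L x) h3
  simp at this
  linarith

lemma sndFDeriv_normal_eq (H : IsLocalHypersurface F N Ω) (hu : u ∈ Ω) (z v : E n) :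
    fderiv ℝ (fderiv ℝ N) u z v = -(fderiv ℝ (fderiv ℝ F) u z (localShape F N u v)
      + fderiv ℝ F u (fderiv ℝ (localShape F N) u z v)) := by
  have hN := (hasFDerivAt_fderiv_of_contDiffAt (H.contDiffAt_normal hu)).clm_apply
    (hasFDerivAt_const v u)
  have hF := (hasFDerivAt_fderiv_of_contDiffAt (H.contDiffAt hu)).clm_apply
    ((hasFDerivAt_of_contDiffAt (H.contDiffAt_localShape hu)).clm_apply (hasFDerivAt_const v u))
  have h2 : (fun t => fderiv ℝ N t v) =ᶠ[𝓝 u]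
      fun t => -fderiv ℝ F t (localShape F N t v) :=
    eventually_of_mem (H.isOpen.mem_nhds hu) fun t ht => by
      simp only [H.fderiv_localShape ht, neg_neg]
  have := congrArg (fun L => L z) (hN.unique (hF.neg.congr_of_eventuallyEq h2))
  simp at this
  rw [this]
  abel

lemma inner_fderiv_localShape_comm (H : IsLocalHypersurface F N Ω) (hu : u ∈ Ω) (v w : E n) :
    inner ℝ (fderiv ℝ F u (localShape F N u v)) (fderiv ℝ F u w)
      = inner ℝ (fderiv ℝ F u (localShape F N u w)) (fderiv ℝ F u v) := by
  rw [H.fderiv_localShape hu, H.fderiv_localShape hu, inner_neg_left, inner_neg_left,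
    H.inner_fderiv_normal_comm hu]

lemma inner_fderiv_normal_conn (H : IsLocalHypersurface F N Ω) (hu : u ∈ Ω) (v w z : E n) :
    inner ℝ (fderiv ℝ N u z) (fderiv ℝ F u (conn F u v w))
      = inner ℝ (fderiv ℝ N u z) (fderiv ℝ (fderiv ℝ F) u v w) := by
  rw [H.fderiv_conn hu, inner_sub_right, real_inner_smul_right, H.inner_fderiv_normal hu]
  ring

/-- The tangential part of the Laplacian of the normal field. -/
lemma inner_laplacian_normal (H : IsLocalHypersurface F N Ω) (hu : u ∈ Ω) {ε : Fin n → E n}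
    (hε : Orthonormal ℝ fun a => fderiv ℝ F u (ε a)) (z : E n) :
    ∑ a, (inner ℝ (fderiv ℝ (fderiv ℝ N) u (ε a) (ε a)) (fderiv ℝ F u z)
      - inner ℝ (fderiv ℝ N u (conn F u (ε a) (ε a))) (fderiv ℝ F u z))
    = -LinearMap.trace ℝ (E n) (fderiv ℝ (localShape F N) u z).toLinearMap := by
  let Γ : E n →L[ℝ] E n := pinv (fderiv ℝ F u) ∘L fderiv ℝ (fderiv ℝ F) u z
  have hΓ : ∀ v, Γ v = conn F u z v := fun v => rfl
  -- The Christoffel corrections enter as the trace of ΓA - AΓ, which vanishes. Together with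
  -- Codazzi this leaves the derivative of the trace of the shape operator.
  have hcomm : LinearMap.trace ℝ (E n) (Γ.toLinearMap * (localShape F N u).toLinearMap)
      = LinearMap.trace ℝ (E n) ((localShape F N u).toLinearMap * Γ.toLinearMap) :=
    LinearMap.trace_mul_comm ℝ _ _
  rw [trace_eq_sum_inner hε, trace_eq_sum_inner hε] at hcomm
  have hterm : ∀ a, inner ℝ (fderiv ℝ (fderiv ℝ N) u (ε a) (ε a)) (fderiv ℝ F u z)
      - inner ℝ (fderiv ℝ N u (conn F u (ε a) (ε a))) (fderiv ℝ F u z)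
      = -inner ℝ (fderiv ℝ F u (fderiv ℝ (localShape F N) u z (ε a))) (fderiv ℝ F u (ε a))
        - inner ℝ (fderiv ℝ F u (Γ (localShape F N u (ε a)))) (fderiv ℝ F u (ε a))
        + inner ℝ (fderiv ℝ F u (localShape F N u (Γ (ε a)))) (fderiv ℝ F u (ε a)) := by
    intro a
    have h1 := H.inner_sndFDeriv_normal_fderiv hu (ε a) (ε a) z
    have h2 := H.inner_fderiv_normal_comm hu (conn F u (ε a) (ε a)) z
    rw [H.inner_fderiv_normal_conn hu] at h2
    have h3 := H.sndFDeriv_normal_eq hu z (ε a)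
    rw [sndFDeriv_comm (H.contDiffAt_normal hu) (ε a) z, h3, inner_neg_left, inner_add_left,
      sndFDeriv_comm (H.contDiffAt hu) (ε a) z, ← H.inner_fderiv_conn hu,
      ← H.inner_fderiv_normal_conn hu z (ε a) (ε a)] at h1
    rw [H.inner_fderiv_localShape_comm hu, H.fderiv_localShape hu (ε a), inner_neg_left,
      hΓ, hΓ]
    linarith
  rw [trace_eq_sum_inner hε, ← Finset.sum_neg_distrib]
  simp only [hterm, Finset.sum_add_distrib, Finset.sum_sub_distrib]
  have hc : ∑ a, inner ℝ (fderiv ℝ F u (Γ (localShape F N u (ε a)))) (fderiv ℝ F u (ε a))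
      = ∑ a, inner ℝ (fderiv ℝ F u (localShape F N u (Γ (ε a)))) (fderiv ℝ F u (ε a)) := hcomm
  rw [hc, sub_add_cancel]
  rfl

lemma sum_inner_smul (H : IsLocalHypersurface F N Ω) (hu : u ∈ Ω) {ε : Fin n → E n}
    (hε : Orthonormal ℝ fun a => fderiv ℝ F u (ε a)) (v : E n) :
    ∑ a, inner ℝ (fderiv ℝ F u v) (fderiv ℝ F u (ε a)) • ε a = v := by
  refine H.injective u hu ?_
  rw [← sub_eq_zero]
  refine H.eq_zero_of_inner_frame hu (by simp) hε ?_ fun a => ?_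
  · rw [inner_sub_left, H.orthogonal u hu, H.orthogonal u hu, sub_zero]
  · rw [inner_sub_left, map_sum]
    simp only [map_smul]
    rw [hε.inner_left_fintype]
    simp

/-- The curvature equations of a biharmonic `δ(r)`-ideal hypersurface. -/
theorem curvatureEquationsAt (H : IsLocalHypersurface F N Ω) (hu : u ∈ Ω) {h : E n → ℝ} {c : ℝ}
    (hh : ContDiffAt ℝ ∞ h u)
    (htr : ∀ᶠ t in 𝓝 u, LinearMap.trace ℝ (E n) (localShape F N t).toLinearMap = n * h t)
    (hbi : coordLaplacian (localMetric F) (fun t => h t • N t) u = 0)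
    (heig : ∃ v ≠ 0, fderiv ℝ N u v = (c * (n / 2) * h u) • fderiv ℝ F u v) :
    CurvatureEquationsAt F N h c u := by
  have hN := H.contDiffAt_normal hu
  have hsm : ContDiffAt ℝ ∞ (fun t => h t • N t) u := hh.smul hN
  have hdh := hasFDerivAt_of_contDiffAt hh
  have hdN := hasFDerivAt_of_contDiffAt hN
  have hd1 : ∀ w, fderiv ℝ (fun t => h t • N t) u w = fderiv ℝ h u w • N u + h u • fderiv ℝ N u w :=
    fun w => by
      rw [(hdh.fun_smul hdN).fderiv]
      simp [add_comm]
  have hd2 : ∀ v, fderiv ℝ (fderiv ℝ (fun t => h t • N t)) u v v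
      = fderiv ℝ (fderiv ℝ h) u v v • N u + (2 * fderiv ℝ h u v) • fderiv ℝ N u v
        + h u • fderiv ℝ (fderiv ℝ N) u v v := by
    intro v
    have e : fderiv ℝ (fun t => h t • N t) =ᶠ[𝓝 u]
        fun t => h t • fderiv ℝ N t + (fderiv ℝ h t).smulRight (N t) := by
      filter_upwards [eventually_contDiffAt hh, eventually_contDiffAt hN] with t h1 h2
      exact (h1.hasFDerivAt.smul h2.hasFDerivAt).fderiv
    have e' : (fun t => fderiv ℝ (fun t => h t • N t) t v) =ᶠ[𝓝 u]
        fun t => h t • fderiv ℝ N t v + fderiv ℝ h t v • N t := by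
      filter_upwards [e] with t ht
      rw [ht]
      rfl
    have l := (hasFDerivAt_fderiv_of_contDiffAt hsm).clm_apply (hasFDerivAt_const v u)
    have r1 := hdh.smul ((hasFDerivAt_fderiv_of_contDiffAt hN).clm_apply (hasFDerivAt_const v u))
    have r2 := ((hasFDerivAt_fderiv_of_contDiffAt hh).clm_apply (hasFDerivAt_const v u)).smul hdN
    have := congrArg (fun L => L v) (l.unique ((r1.add r2).congr_of_eventuallyEq e'))
    simp at this
    refine this.trans ?_
    module
  -- The biharmonic equation is paired with an arbitrary ambient vector z. Tangent z will give the
  -- tangential equation, and z = N u the normal one.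
  have hmain : ∀ ε : Fin n → E n, (Orthonormal ℝ fun a => fderiv ℝ F u (ε a)) →
      ∀ z, ∑ a, (fderiv ℝ (fderiv ℝ h) u (ε a) (ε a) * inner ℝ (N u) z
        + 2 * fderiv ℝ h u (ε a) * inner ℝ (fderiv ℝ N u (ε a)) z
        + h u * inner ℝ (fderiv ℝ (fderiv ℝ N) u (ε a) (ε a)) z
        - (fderiv ℝ h u (conn F u (ε a) (ε a)) * inner ℝ (N u) z
        + h u * inner ℝ (fderiv ℝ N u (conn F u (ε a) (ε a))) z)) = 0 := by
    intro ε hε z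
    have h1 := H.coordLaplacian_eq hu hε hsm
    rw [hbi, eq_comm, neg_eq_zero] at h1
    have h2 := congrArg (fun x => inner ℝ x z) h1
    simp only [sum_inner, inner_zero_left, hd1, hd2, inner_sub_left, inner_add_left,
      real_inner_smul_left] at h2
    exact h2
  have hNN : inner ℝ (N u) (N u) = 1 := by
    rw [real_inner_self_eq_norm_sq, H.norm_normal u hu, one_pow]
  refine ⟨fun ε hε => ?_, heig, fun v hv => ?_, fun ε hε v hv => ?_⟩
  · rw [← htr.self_of_nhds, H.trace_localShape hu hε, ← Finset.sum_neg_distrib]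
    exact Finset.sum_congr rfl fun a _ => by rw [H.sff_eq hu, neg_neg]
  · obtain ⟨ε, hε⟩ := exists_orthonormal_fderiv (H.injective u hu)
    rw [← sub_eq_zero]
    refine H.eq_zero_of_inner hu ?_ fun z => ?_
    · rw [inner_sub_left, real_inner_smul_left, H.inner_fderiv_normal hu, H.orthogonal u hu]
      ring
    have h1 := hmain ε hε (fderiv ℝ F u z)
    have h2 := H.inner_laplacian_normal hu hε z
    have h3 : LinearMap.trace ℝ (E n) (fderiv ℝ (localShape F N) u z).toLinearMap
        = n * fderiv ℝ h u z := by
      have d1 := (traceCLM n).hasFDerivAt.comp u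
        (hasFDerivAt_of_contDiffAt (H.contDiffAt_localShape hu))
      have d2 := (hdh.const_mul (n : ℝ)).congr_of_eventuallyEq htr
      exact congrArg (fun L => L z) (d1.unique d2)
    have h4 : ∑ a, fderiv ℝ h u (ε a) * inner ℝ (fderiv ℝ N u (ε a)) (fderiv ℝ F u z)
        = inner ℝ (fderiv ℝ N u v) (fderiv ℝ F u z) := by
      conv_rhs => rw [← H.sum_inner_smul hu hε v]
      simp only [map_sum, map_smul, sum_inner, real_inner_smul_left, hv]
    have h5 : inner ℝ (N u) (fderiv ℝ F u z) = 0 := by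
      rw [real_inner_comm, H.orthogonal u hu]
    rw [h3] at h2
    -- The cross terms 2 dh · dN give 2 dN(grad h), and the tangential Laplacian of the normal gives
    -- -n h grad h through the derivative of trace A = n h.
    have h6 : 2 * inner ℝ (fderiv ℝ N u v) (fderiv ℝ F u z) + h u * (-(n * fderiv ℝ h u z)) = 0 := by
      rw [← h1, ← h4, ← h2, Finset.mul_sum, Finset.mul_sum, ← Finset.sum_add_distrib]
      refine Finset.sum_congr rfl fun a _ => ?_
      rw [h5]
      ring
    rw [inner_sub_left, real_inner_smul_left, hv]
    linarith
  · have h1 := hmain ε hε (N u)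
    rw [Finset.mul_sum, ← sub_eq_zero, ← Finset.sum_sub_distrib, ← h1]
    refine Finset.sum_congr rfl fun a _ => ?_
    rw [hNN, H.inner_fderiv_normal hu, H.inner_fderiv_normal hu, H.inner_sndFDeriv_normal hu,
      ← hv (conn F u (ε a) (ε a)), real_inner_comm (fderiv ℝ F u (conn F u (ε a) (ε a))),
      H.inner_fderiv_conn hu, real_inner_comm (fderiv ℝ F u v)]
    ring

end IsLocalHypersurface

/-! ### Hypersurfaces in charts -/

section Charts

variable {n : ℕ} {M : Type*} [TopologicalSpace M] [ChartedSpace (E n) M]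

lemma differential_eq {m : ℕ} {f : M → E m} {p : M}
    (hf : MDifferentiableAt (𝓡 n) 𝓘(ℝ, E m) f p) (v : E n) :
    differential (n := n) f p v
      = fderiv ℝ (f ∘ (chartAt (E n) p).symm) (chartAt (E n) p p) v := by
  have h1 := hf.hasMFDerivAt.2
  rw [ModelWithCorners.range_eq_univ] at h1
  let D : E n →L[ℝ] E m := mfderiv (𝓡 n) 𝓘(ℝ, E m) f p
  have h2 : HasFDerivWithinAt (f ∘ (chartAt (E n) p).symm) D Set.univ (chartAt (E n) p p) := h1
  have h3 : D = fderiv ℝ (f ∘ (chartAt (E n) p).symm) (chartAt (E n) p p) :=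
    (hasFDerivWithinAt_univ.1 h2).fderiv.symm
  exact congrArg (fun L : E n →L[ℝ] E m => L v) h3

lemma neg_leftInverse_comp_eq {V W : Type*} [AddCommGroup V] [Module ℝ V] [AddCommGroup W]
    [Module ℝ W] {D D' : V →ₗ[ℝ] W} (hD : Function.Injective D) {S : V →ₗ[ℝ] V}
    (h : ∀ v, D (S v) = -D' v) : -(D.leftInverse ∘ₗ D') = S := by
  refine LinearMap.ext fun v => ?_
  have h2 : D' v = D (-S v) := by rw [map_neg, h, neg_neg]
  rw [LinearMap.neg_apply, LinearMap.comp_apply, h2,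
    LinearMap.leftInverse_apply_of_inj (LinearMap.ker_eq_bot.2 hD), neg_neg]

/-- The change from the preferred chart at `p` to the preferred chart at `q`. -/
def transition (p q : M) (t : E n) : E n := chartAt (E n) q ((chartAt (E n) p).symm t)

lemma eventuallyEq_comp_transition {W : Type*} (g : M → W) {p q : M} {u : E n}
    (hu : u ∈ (chartAt (E n) p).target) (hq : (chartAt (E n) p).symm u ∈ (chartAt (E n) q).source) :
    g ∘ (chartAt (E n) p).symm =ᶠ[𝓝 u]
      fun t => (g ∘ (chartAt (E n) q).symm) (transition p q t) := by
  have h1 := ((chartAt (E n) p).continuousAt_symm hu).eventually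
    ((chartAt (E n) q).open_source.mem_nhds hq)
  filter_upwards [h1] with t ht
  simp only [Function.comp_apply, transition]
  rw [(chartAt (E n) q).left_inv ht]

lemma contDiffAt_transition [IsManifold (𝓡 n) ∞ M] {p q : M} {u : E n}
    (hu : u ∈ (chartAt (E n) p).target) (hq : (chartAt (E n) p).symm u ∈ (chartAt (E n) q).source) :
    ContDiffAt ℝ ∞ (transition p q) u := by
  have h1 : ContMDiffAt (𝓡 n) (𝓡 n) ∞ (chartAt (E n) p).symm u :=
    (contMDiffOn_chart_symm (I := 𝓡 n) (x := p)).contMDiffAt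
      ((chartAt (E n) p).open_target.mem_nhds hu)
  have h2 : ContMDiffAt (𝓡 n) (𝓡 n) ∞ (chartAt (E n) q) ((chartAt (E n) p).symm u) :=
    (contMDiffOn_chart (I := 𝓡 n) (x := q)).contMDiffAt
      ((chartAt (E n) q).open_source.mem_nhds hq)
  exact (ContMDiffAt.comp u h2 h1).contDiffAt

lemma fderiv_transition_comp [IsManifold (𝓡 n) ∞ M] {p q : M} {u : E n}
    (hu : u ∈ (chartAt (E n) p).target) (hq : (chartAt (E n) p).symm u ∈ (chartAt (E n) q).source)
    (v : E n) :
    fderiv ℝ (transition q p) (transition p q u) (fderiv ℝ (transition p q) u v) = v := by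
  have hu' : transition p q u ∈ (chartAt (E n) q).target := (chartAt (E n) q).map_source hq
  have he : (chartAt (E n) q).symm (transition p q u) = (chartAt (E n) p).symm u :=
    (chartAt (E n) q).left_inv hq
  have hq' : (chartAt (E n) q).symm (transition p q u) ∈ (chartAt (E n) p).source := by
    rw [he]
    exact (chartAt (E n) p).map_target hu
  have h1 : (id : E n → E n) =ᶠ[𝓝 u] fun t => transition q p (transition p q t) := by
    have h2 := eventuallyEq_comp_transition (chartAt (E n) p) hu hq
    filter_upwards [h2, (chartAt (E n) p).open_target.mem_nhds hu] with t ht htt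
    simp only [Function.comp_apply] at ht
    rw [(chartAt (E n) p).right_inv htt] at ht
    exact ht
  have h3 := fderiv_eq_of_eventuallyEq_comp (contDiffAt_transition hu' hq')
    (contDiffAt_transition hu hq) h1 v
  rw [← h3, fderiv_id]
  rfl

lemma bijective_fderiv_transition [IsManifold (𝓡 n) ∞ M] {p q : M} {u : E n}
    (hu : u ∈ (chartAt (E n) p).target)
    (hq : (chartAt (E n) p).symm u ∈ (chartAt (E n) q).source) :
    Function.Bijective (fderiv ℝ (transition p q) u) := by
  have hinj : Function.Injective (fderiv ℝ (transition p q) u).toLinearMap :=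
    Function.LeftInverse.injective (fderiv_transition_comp hu hq)
  exact ⟨hinj, LinearMap.injective_iff_surjective.1 hinj⟩

lemma contDiffOn_comp_chart_symm [IsManifold (𝓡 n) ∞ M] {m : ℕ} {g : M → E m}
    (hg : ContMDiff (𝓡 n) 𝓘(ℝ, E m) ∞ g) (p : M) :
    ContDiffOn ℝ ∞ (g ∘ (chartAt (E n) p).symm) (chartAt (E n) p).target :=
  (hg.comp_contMDiffOn (contMDiffOn_chart_symm (I := 𝓡 n) (x := p))).contDiffOn

namespace IsOrientedHypersurface

variable {f ξ : M → E (n + 1)}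

lemma differential_eq (H : IsOrientedHypersurface f ξ) (p : M) (v : E n) :
    differential (n := n) f p v
      = fderiv ℝ (f ∘ (chartAt (E n) p).symm) (chartAt (E n) p p) v :=
  DeltaIdeal.differential_eq ((H.smooth p).mdifferentiableAt (by simp)) v

lemma differential_normal_eq (H : IsOrientedHypersurface f ξ) (p : M) (v : E n) :
    differential (n := n) ξ p v
      = fderiv ℝ (ξ ∘ (chartAt (E n) p).symm) (chartAt (E n) p p) v :=
  DeltaIdeal.differential_eq ((H.smooth_normal p).mdifferentiableAt (by simp)) v

variable [IsManifold (𝓡 n) ∞ M]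

lemma fderiv_comp_chart_symm (H : IsOrientedHypersurface f ξ) {p : M} {u : E n}
    (hu : u ∈ (chartAt (E n) p).target) (v : E n) :
    fderiv ℝ (f ∘ (chartAt (E n) p).symm) u v
      = differential (n := n) f ((chartAt (E n) p).symm u)
        (fderiv ℝ (transition p ((chartAt (E n) p).symm u)) u v) := by
  set q := (chartAt (E n) p).symm u with hq
  have hqs : (chartAt (E n) p).symm u ∈ (chartAt (E n) q).source := mem_chart_source _ q
  rw [H.differential_eq, fderiv_eq_of_eventuallyEq_comp
    (F := f ∘ (chartAt (E n) q).symm) ?_ (contDiffAt_transition hu hqs)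
    (eventuallyEq_comp_transition f hu hqs)]
  · rfl
  · exact (contDiffOn_comp_chart_symm H.smooth q).contDiffAt
      ((chartAt (E n) q).open_target.mem_nhds (mem_chart_target _ q))

lemma isLocalHypersurface (H : IsOrientedHypersurface f ξ) (p : M) :
    IsLocalHypersurface (f ∘ (chartAt (E n) p).symm) (ξ ∘ (chartAt (E n) p).symm)
      (chartAt (E n) p).target := by
  refine ⟨(chartAt (E n) p).open_target, contDiffOn_comp_chart_symm H.smooth p,
    contDiffOn_comp_chart_symm H.smooth_normal p, fun u hu => ?_,
    fun u _ => H.unit_normal _, fun u hu v => ?_⟩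
  · intro v w hvw
    rw [H.fderiv_comp_chart_symm hu, H.fderiv_comp_chart_symm hu] at hvw
    exact (bijective_fderiv_transition hu (mem_chart_source _ _)).1 (H.immersion _ hvw)
  · rw [H.fderiv_comp_chart_symm hu]
    exact H.orthogonal _ _

lemma trace_shapeOperator (H : IsOrientedHypersurface f ξ) (q : M) :
    LinearMap.trace ℝ (TangentSpace (𝓡 n) q) (shapeOperator f ξ q)
      = LinearMap.trace ℝ (E n) (localShape (f ∘ (chartAt (E n) q).symm)
        (ξ ∘ (chartAt (E n) q).symm) (chartAt (E n) q q)).toLinearMap := by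
  have h : shapeOperator f ξ q = (localShape (f ∘ (chartAt (E n) q).symm)
      (ξ ∘ (chartAt (E n) q).symm) (chartAt (E n) q q)).toLinearMap := by
    refine neg_leftInverse_comp_eq (H.immersion q) fun (v : E n) => ?_
    have h1 := (H.isLocalHypersurface q).fderiv_localShape (mem_chart_target (E n) q) v
    rw [← H.differential_normal_eq q v, ← H.differential_eq q] at h1
    exact h1
  rw [h]
  rfl

/-- `meanCurvature` at a nearby point is computed in that point's own chart. The two traces agree
because the transition map carries an orthonormal frame to an orthonormal frame and preserves the
second fundamental form. -/
lemma trace_localShape (H : IsOrientedHypersurface f ξ) {p : M} {u : E n}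
    (hu : u ∈ (chartAt (E n) p).target) (hn : n ≠ 0) :
    LinearMap.trace ℝ (E n) (localShape (f ∘ (chartAt (E n) p).symm)
      (ξ ∘ (chartAt (E n) p).symm) u).toLinearMap
      = n * meanCurvature f ξ ((chartAt (E n) p).symm u) := by
  set q := (chartAt (E n) p).symm u with hq
  have hqs : (chartAt (E n) p).symm u ∈ (chartAt (E n) q).source := mem_chart_source _ q
  have hqt := mem_chart_target (E n) q
  have Hp := H.isLocalHypersurface p
  have Hq := H.isLocalHypersurface q
  have hτ := contDiffAt_transition hu hqs
  have hτu : transition p q u = chartAt (E n) q q := rfl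
  have dF := fderiv_eq_of_eventuallyEq_comp (Hq.contDiffAt hqt) hτ
    (eventuallyEq_comp_transition f hu hqs)
  have dN := fderiv_eq_of_eventuallyEq_comp (Hq.contDiffAt_normal hqt) hτ
    (eventuallyEq_comp_transition ξ hu hqs)
  obtain ⟨ε, hε⟩ := exists_orthonormal_fderiv (Hp.injective u hu)
  have hε' := hε
  simp only [dF] at hε'
  rw [meanCurvature, H.trace_shapeOperator q, Hp.trace_localShape hu hε,
    Hq.trace_localShape hqt hε', ← mul_assoc, mul_one_div_cancel (Nat.cast_ne_zero.2 hn), one_mul]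
  refine Finset.sum_congr rfl fun a _ => ?_
  rw [Hp.sff_eq hu, Hq.sff_eq hqt, dF, dN, hτu]

lemma contDiffOn_meanCurvature (H : IsOrientedHypersurface f ξ) (p : M) (hn : n ≠ 0) :
    ContDiffOn ℝ ∞ (meanCurvature f ξ ∘ (chartAt (E n) p).symm) (chartAt (E n) p).target := by
  have h1 : ContDiffOn ℝ ∞ (fun u => (1 / (n : ℝ)) * traceCLM n
      (localShape (f ∘ (chartAt (E n) p).symm) (ξ ∘ (chartAt (E n) p).symm) u))
      (chartAt (E n) p).target := fun u hu =>
    (contDiffAt_const.mul ((traceCLM n).contDiff.contDiffAt.comp u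
      ((H.isLocalHypersurface p).contDiffAt_localShape hu))).contDiffWithinAt
  refine h1.congr fun u hu => ?_
  have h2 := H.trace_localShape hu hn
  have h3 : traceCLM n (localShape (f ∘ (chartAt (E n) p).symm) (ξ ∘ (chartAt (E n) p).symm) u)
    = n * meanCurvature f ξ ((chartAt (E n) p).symm u) := h2
  rw [h3, ← mul_assoc, one_div_mul_cancel (Nat.cast_ne_zero.2 hn), one_mul]
  rfl

/-- Idealness and biharmonicity at q are conditions at the centre of the preferred chart at q, so
the equations are first obtained there. The constant is chosen so that the principal curvature n H /
(n - r + 1) equals -c (n/2) H. -/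
lemma curvatureEquationsAt_chart (H : IsOrientedHypersurface f ξ) {r : ℕ} (hr : r < n)
    (hideal : IsDeltaIdeal r f ξ) (hbi : IsBiharmonic f ξ) (q : M) :
    CurvatureEquationsAt (f ∘ (chartAt (E n) q).symm) (ξ ∘ (chartAt (E n) q).symm)
      (meanCurvature f ξ ∘ (chartAt (E n) q).symm) (-2 / ((n : ℝ) - r + 1))
      (chartAt (E n) q q) := by
  have hn : n ≠ 0 := by omega
  have hqt := mem_chart_target (E n) q
  have hnhds := (chartAt (E n) q).open_target.mem_nhds hqt
  have Hq := H.isLocalHypersurface q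
  have hmq : (meanCurvature f ξ ∘ (chartAt (E n) q).symm) (chartAt (E n) q q)
      = meanCurvature f ξ q := by
    rw [Function.comp_apply, (chartAt (E n) q).left_inv (mem_chart_source _ q)]
  refine Hq.curvatureEquationsAt hqt
    ((H.contDiffOn_meanCurvature q hn).contDiffAt hnhds)
    (eventually_of_mem hnhds fun t ht => H.trace_localShape ht hn) (hbi q) ?_
  refine Hq.exists_eigenvector_of_ideal hqt hr (H.trace_localShape hqt hn) ?_
  have h1 := hideal q
  rw [← hmq] at h1
  refine Eq.trans ?_ h1
  have hd : ∀ v : E n, differential (n := n) f q v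
      = fderiv ℝ (f ∘ (chartAt (E n) q).symm) (chartAt (E n) q q) v := H.differential_eq q
  have hframe : ∀ e : Fin r → E n, IsOrthonormalFrame f q e ↔
      Orthonormal ℝ fun a => fderiv ℝ (f ∘ (chartAt (E n) q).symm) (chartAt (E n) q q) (e a) :=
    fun e => by
      have : (fun a => differential f q (e a))
          = fun a => fderiv ℝ (f ∘ (chartAt (E n) q).symm) (chartAt (E n) q q) (e a) :=
        funext fun a => hd (e a)
      rw [← this]
      rfl
  rw [deltaInvariant]
  congr 2
  ext t
  exact exists_congr fun e => and_congr_left fun _ => (hframe e).symm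

/-- A biharmonic `δ(r)`-ideal oriented hypersurface is minimal. -/
theorem meanCurvature_eq_zero (H : IsOrientedHypersurface f ξ) {r : ℕ} (hr : r < n)
    (hideal : IsDeltaIdeal r f ξ) (hbi : IsBiharmonic f ξ) (p : M) :
    meanCurvature f ξ p = 0 := by
  by_contra hp
  obtain ⟨k, rfl⟩ : ∃ k, n = k + 1 := ⟨n - 1, by omega⟩
  have hn : k + 1 ≠ 0 := by omega
  set h := meanCurvature f ξ ∘ (chartAt (E (k + 1)) p).symm with hh
  have hc := H.contDiffOn_meanCurvature p hn
  have ho : IsOpen ((chartAt (E (k + 1)) p).target ∩ h ⁻¹' {0}ᶜ) :=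
    hc.continuousOn.isOpen_inter_preimage (chartAt (E (k + 1)) p).open_target
      isOpen_compl_singleton
  have hsub : (chartAt (E (k + 1)) p).target ∩ h ⁻¹' {0}ᶜ ⊆ (chartAt (E (k + 1)) p).target :=
    Set.inter_subset_left
  refine ((H.isLocalHypersurface p).mono ho hsub).absurd
    ⟨chartAt (E (k + 1)) p p, mem_chart_target _ p, ?_⟩ (hc.mono hsub) (fun u hu => hu.2)
    (c := -2 / (((k + 1 : ℕ) : ℝ) - r + 1)) ?_ fun u hu => ?_
  · have : h (chartAt (E (k + 1)) p p) = meanCurvature f ξ p := by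
      rw [hh, Function.comp_apply, (chartAt (E (k + 1)) p).left_inv (mem_chart_source _ p)]
    rw [Set.mem_preimage, this]
    exact hp
  · have : (r : ℝ) < ((k + 1 : ℕ) : ℝ) := Nat.cast_lt.2 hr
    exact div_neg_of_neg_of_pos (by norm_num) (by linarith)
  -- The equations at the centre of the chart of each point q near p are transported to the single
  -- chart at p, where they hold on an open set and can be differentiated.
  · have hu' := hsub hu
    set q := (chartAt (E (k + 1)) p).symm u with hq
    have hqs : (chartAt (E (k + 1)) p).symm u ∈ (chartAt (E (k + 1)) q).source :=
      mem_chart_source _ q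
    have hqt := mem_chart_target (E (k + 1)) q
    have Hq := H.isLocalHypersurface q
    exact CurvatureEquationsAt.comp (τ := transition p q)
      (H.curvatureEquationsAt_chart hr hideal hbi q) (contDiffAt_transition hu' hqs)
      (bijective_fderiv_transition hu' hqs) (Hq.contDiffAt hqt) (Hq.contDiffAt_normal hqt)
      ((H.contDiffOn_meanCurvature q hn).contDiffAt
        ((chartAt (E (k + 1)) q).open_target.mem_nhds hqt))
      (eventuallyEq_comp_transition f hu' hqs) (eventuallyEq_comp_transition ξ hu' hqs)
      (eventuallyEq_comp_transition (meanCurvature f ξ) hu' hqs)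

end IsOrientedHypersurface

end Charts

end DeltaIdeal

end

theorem theorem1p1 {n r : ℕ} (hn : 3 ≤ n) (hr : 2 ≤ r) (hrn : r ≤ n - 1)
    {M : Type*} [TopologicalSpace M] [ChartedSpace (DeltaIdeal.E n) M]
    [IsManifold (𝓡 n) ∞ M] (f ξ : M → DeltaIdeal.E (n + 1))
    (hM : DeltaIdeal.IsOrientedHypersurface f ξ)
    (hideal : DeltaIdeal.IsDeltaIdeal r f ξ)
    (hbiharmonic : DeltaIdeal.IsBiharmonic f ξ)
    (hcurv : ∀ p, (DeltaIdeal.principalCurvatures f ξ p).encard ≤ r + 1) :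
    ∀ p, DeltaIdeal.meanCurvature f ξ p = 0 :=
  hM.meanCurvature_eq_zero (by omega) hideal hbiharmonic
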